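/- Let $p>1$ and $\alpha\in\mathbb{R}$, let $\gamma$ be the Euler--Mascheroni constant, put $e_\alpha:=-4e^{-4\pi\alpha-2\gamma}$, and let $\lambda>|e_\alpha|$. Let $$\beta(\lambda):=\frac1{2\pi}\Bigl(\gamma+\log\frac{\sqrt\lambda}{2}\Bigr),\qquad G_\lambda(x):=\frac1{2\pi}K_0(\sqrt\lambda\,|x|)\quad(x\in\mathbb{R}^2\setminus\{0\}),$$ where $K_0(z)=\int_0^\infty e^{-z\cosh t}\,dt$ is the modified Bessel function of the second kind of order zero, so that $G_\lambda$ is the Green function of $-\Delta+\lambda$ on $\mathbb{R}^2$. Let $-\Delta_\alpha$ be the Schrödinger operator on $L^2(\mathbb{R}^2;\mathbb{C})$ with a point interaction of strength $\alpha$ at the origin. Its form domain is $$H^1_\alpha(\mathbb{R}^2)=\{f+cG_\lambda : f\in H^1(\mathbb{R}^2;\mathbb{C}),\ c\in\mathbb{C}\},$$ and its form, shifted by $\lambda$, is $$\langle(-\Delta_\alpha+\lambda)u,v\rangle=\int_{\mathbb{R}^2}\nabla f\cdot\overline{\nabla g}\,dx+\lambda\int_{\mathbb{R}^2}f\,\overline{g}\,dx+(\alpha+\beta(\lambda))\,c\,\overline{d}$$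 for $u=f+cG_\lambda$ and $v=g+dG_\lambda$ with $f,g\in H^1(\mathbb{R}^2;\mathbb{C})$ and $c,d\in\mathbb{C}$. Then the equation $$(-\Delta_\alpha+\lambda)u-|u|^{p-1}u=0,\qquad u\in H^1_\alpha(\mathbb{R}^2),$$ understood as $\langle(-\Delta_\alpha+\lambda)u,v\rangle=\int_{\mathbb{R}^2}|u|^{p-1}u\,\overline{v}\,dx$ for all $v\in H^1_\alpha(\mathbb{R}^2)$, has at most one positive radial solution: if $u$ and $v$ are two solutions, each of which is (almost everywhere) real, positive and equal to a function of $|x|$, then $u=v$ almost everywhere. -/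

import Mathlib

open MeasureTheory

noncomputable section

namespace PointInteraction

/-- The Euclidean plane `ℝ²`. -/
abbrev Plane : Type := EuclideanSpace ℝ (Fin 2)

/-- The modified Bessel function of the second kind (Macdonald function) of order zero,
`K₀(z) = ∫₀^∞ exp (-z cosh t) dt` for `z > 0`. -/
def besselK0 (z : ℝ) : ℝ :=
  ∫ t in Set.Ioi (0 : ℝ), Real.exp (-z * Real.cosh t)

/-- The Green function `G_λ(x) = (2π)⁻¹ K₀(√λ |x|)` of `-Δ + λ` on `ℝ²`. -/
def green (lam : ℝ) (x : Plane) : ℝ :=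
  (2 * Real.pi)⁻¹ * besselK0 (√lam * ‖x‖)

/-- The constant `β(λ) = (2π)⁻¹ (γ + log (√λ / 2))`, with `γ` the Euler–Mascheroni constant. -/
def beta (lam : ℝ) : ℝ :=
  (2 * Real.pi)⁻¹ * (Real.eulerMascheroniConstant + Real.log (√lam / 2))

/-- The negative eigenvalue `e_α = -4 exp (-4πα - 2γ)` of `-Δ_α`. -/
def eigenvalue (α : ℝ) : ℝ :=
  -4 * Real.exp (-4 * Real.pi * α - 2 * Real.eulerMascheroniConstant)

/-- `f` belongs to the complex Sobolev space `H¹(ℝ²)`, and `F i` is its weak partial derivative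
`∂ᵢ f`, characterized by integration against smooth compactly supported functions. -/
structure HasH1Gradient (f : Plane → ℂ) (F : Fin 2 → Plane → ℂ) : Prop where
  memLp : MemLp f 2 volume
  memLp_grad : ∀ i, MemLp (F i) 2 volume
  integral_eq : ∀ (φ : Plane → ℝ), ContDiff ℝ (⊤ : ℕ∞) φ → HasCompactSupport φ → ∀ i : Fin 2,
    ∫ x, ((fderiv ℝ φ x (EuclideanSpace.single i 1) : ℝ) : ℂ) * f x
      = -∫ x, (φ x : ℂ) * F i x

/-- The decomposition `v = f + c G_λ` (almost everywhere) of an element `v` of the form domain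
`H¹_α(ℝ²)`, where `f ∈ H¹(ℝ²)` has weak gradient `F` and `c ∈ ℂ`. Since `G_λ ∉ H¹(ℝ²)`, the
function `f`, its gradient `F` (both up to null sets) and the number `c` are determined by `v`. -/
structure HasFormDecomposition (lam : ℝ) (v f : Plane → ℂ) (F : Fin 2 → Plane → ℂ) (c : ℂ) :
    Prop where
  hasH1Gradient : HasH1Gradient f F
  ae_eq : v =ᵐ[volume] fun x => f x + c * (green lam x : ℂ)

/-- The sesquilinear form `⟨(-Δ_α + λ) v, w⟩` on `H¹_α(ℝ²)` for `v = f + c G_λ` and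
`w = g + d G_λ`, where `F = ∇f` and `G = ∇g`. Its diagonal is the quadratic form
`‖∇f‖² + λ ‖f‖² + (α + β(λ)) |c|²`. -/
def shiftedForm (α lam : ℝ) (f : Plane → ℂ) (F : Fin 2 → Plane → ℂ) (c : ℂ)
    (g : Plane → ℂ) (G : Fin 2 → Plane → ℂ) (d : ℂ) : ℂ :=
  (∑ i, ∫ x, F i x * starRingEnd ℂ (G i x))
    + (lam : ℂ) * (∫ x, f x * starRingEnd ℂ (g x))
    + ((α + beta lam : ℝ) : ℂ) * (c * starRingEnd ℂ d)

/-- `u ∈ H¹_α(ℝ²)` and `(-Δ_α + λ) u - |u|^{p-1} u = 0` in the dual of `H¹_α(ℝ²)`: for every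
`v ∈ H¹_α(ℝ²)` one has `⟨(-Δ_α + λ) u, v⟩ = ∫ |u|^{p-1} u v̄`. -/
def IsSolution (p α lam : ℝ) (u : Plane → ℂ) : Prop :=
  ∃ (f : Plane → ℂ) (F : Fin 2 → Plane → ℂ) (c : ℂ), HasFormDecomposition lam u f F c ∧
    ∀ (v g : Plane → ℂ) (G : Fin 2 → Plane → ℂ) (d : ℂ), HasFormDecomposition lam v g G d →
      shiftedForm α lam f F c g G d
        = ∫ x, ((‖u x‖ ^ (p - 1) : ℝ) : ℂ) * u x * starRingEnd ℂ (v x)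

/-- `u` is real and positive almost everywhere. -/
def IsPositive (u : Plane → ℂ) : Prop :=
  ∀ᵐ x ∂(volume : Measure Plane), (u x).im = 0 ∧ 0 < (u x).re

/-- `u` coincides almost everywhere with a function of `|x|`. -/
def IsRadial (u : Plane → ℂ) : Prop :=
  ∃ φ : ℝ → ℂ, u =ᵐ[volume] fun x => φ ‖x‖

end PointInteraction

end

/-! In the variable `s = |x|²` the radial Laplacian is `4 (s U')'`, so a positive radial solution
becomes a positive solution on the half-line of `4 D' = λ U - U ^ p` with flux `D = s U'`. The
origin is singular: `U` may grow like `-log s`, and the point interaction is a boundary condition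
there. Two solutions are compared through `w = V / U` and the Wronskian `W = s (U V' - U' V)`.

The boundary condition is never made explicit. The form is Hermitian, so testing each equation with
the other solution gives `∫ U ^ p V = ∫ V ^ p U`. Up to the factor `1/4`, the difference of the
integrands is `W'`, and `W → 0` at infinity; hence `W → 0` at the origin
(`tendsto_wronskian_nhdsGT`). Then `W = O(√s)`, and `w` has a positive limit `l` at `0`.

If `l = 1`, the pair `(w - 1, W)` solves a singular linear system with zero data, so `U = V`
(`exists_forall_eq_zero_of_singular_system`, `eq_of_tendsto_div_one`). The case `l < 1` becomes `l >
1` when the solutions are exchanged. The case `l > 1` is excluded by the functional `J` of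
`pohozaev`: it satisfies `J' = -weight · U ^ 2` with positive weight and tends to `0` at infinity,
so `J > 0`. Put `X = w ^ 2 J(U) - J(V)`. Then `X' = 2 w w' J(U)` has the sign of `W`, and `X → 0` at
the origin. Since `W' = U ^ (p + 1) (w - w ^ p) / 4`, `W` is negative near `0`. Either `W` stays
negative, and `X` decreases from `0` yet tends to `0` at infinity; or at the first zero `R` of `W`
one has `w(R) < 1`, where the formula for `X` gives `X(R) ≥ 0` although `X` has decreased. Both are
absurd (`not_one_lt_of_tendsto_div`).

The remaining work is to pass from the weak formulation to classical profiles (`exists_isProfile`).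
This requires regularity of weak solutions, and integrability of the nonlinear pairing, which the
weak formulation does not assert. -/

noncomputable section

namespace PointInteraction

open Set Filter Topology

/-! ### One-sided calculus on the half-line -/

section HalfLine

/-- Comparison form of the mean value inequality, with limits at the left endpoint. -/
lemma abs_sub_le_of_deriv_le {a b f₀ g₀ : ℝ} {f f' g g' : ℝ → ℝ}
    (hf : ∀ s ∈ Ioo a b, HasDerivAt f (f' s) s) (hg : ∀ s ∈ Ioo a b, HasDerivAt g (g' s) s)
    (hle : ∀ s ∈ Ioo a b, |f' s| ≤ g' s) (hf₀ : Tendsto f (𝓝[>] a) (𝓝 f₀))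
    (hg₀ : Tendsto g (𝓝[>] a) (𝓝 g₀)) {s : ℝ} (hs : s ∈ Ioo a b) :
    |f s - f₀| ≤ g s - g₀ := by
  have key : ∀ h h' : ℝ → ℝ, ∀ h₀ : ℝ, (∀ s ∈ Ioo a b, HasDerivAt h (h' s) s) →
      (∀ s ∈ Ioo a b, 0 ≤ h' s) → Tendsto h (𝓝[>] a) (𝓝 h₀) → h₀ ≤ h s := by
    intro h h' h₀ hh hh' hlim
    have hmono : MonotoneOn h (Ioo a b) := by
      refine monotoneOn_of_deriv_nonneg (convex_Ioo a b)
        (fun x hx => (hh x hx).continuousAt.continuousWithinAt) ?_ ?_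
      · rw [interior_Ioo]
        exact fun x hx => (hh x hx).differentiableAt.differentiableWithinAt
      · rw [interior_Ioo]
        exact fun x hx => by rw [(hh x hx).deriv]; exact hh' x hx
    refine le_of_tendsto hlim ?_
    filter_upwards [Ioo_mem_nhdsGT hs.1] with t ht
    exact hmono ⟨ht.1, ht.2.trans hs.2⟩ hs ht.2.le
  have h1 := key (fun x => g x - f x) (fun x => g' x - f' x) (g₀ - f₀)
    (fun x hx => (hg x hx).sub (hf x hx))
    (fun x hx => by have := (abs_le.1 (hle x hx)).2; linarith) (hg₀.sub hf₀)
  have h2 := key (fun x => g x + f x) (fun x => g' x + f' x) (g₀ + f₀)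
    (fun x hx => (hg x hx).add (hf x hx))
    (fun x hx => by have := (abs_le.1 (hle x hx)).1; linarith) (hg₀.add hf₀)
  rw [abs_le]
  constructor <;> linarith

/-- A function with integrable derivative has a limit at the left endpoint. -/
lemma exists_tendsto_nhdsGT_of_integrableOn {a b : ℝ} (hab : a < b) {f f' : ℝ → ℝ}
    (hf : ∀ s ∈ Ioc a b, HasDerivAt f (f' s) s) (hint : IntegrableOn f' (Ioc a b)) :
    ∃ l, Tendsto f (𝓝[>] a) (𝓝 l) := by
  have hIcc : IntegrableOn f' (uIcc a b) := by
    rw [uIcc_of_le hab.le, integrableOn_Icc_iff_integrableOn_Ioc]; exact hint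
  have hc := intervalIntegral.continuousOn_primitive_interval_left hIcc
  have hca : Tendsto (fun x => ∫ t in x..b, f' t) (𝓝[>] a) (𝓝 (∫ t in a..b, f' t)) := by
    have := hc a left_mem_uIcc
    refine (this.mono_left ?_)
    rw [uIcc_of_le hab.le]
    rw [← nhdsWithin_Ioc_eq_nhdsGT hab]
    exact nhdsWithin_mono _ Ioc_subset_Icc_self
  refine ⟨f b - ∫ t in a..b, f' t, (hca.const_sub (f b)).congr' ?_⟩
  filter_upwards [Ioo_mem_nhdsGT hab] with x hx
  have : ∫ t in x..b, f' t = f b - f x := by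
    refine intervalIntegral.integral_eq_sub_of_hasDerivAt ?_ ?_
    · intro t ht
      rw [uIcc_of_le hx.2.le] at ht
      exact hf t ⟨hx.1.trans_le ht.1, ht.2⟩
    · rw [intervalIntegrable_iff_integrableOn_Ioc_of_le hx.2.le]
      exact hint.mono_set (Ioc_subset_Ioc_left hx.1.le)
  rw [this]; ring

/-- The value `f a` is irrelevant; replacing it by the limit `l` makes `f` continuous at the
endpoint. -/
lemma integral_Ioi_of_hasDerivAt_of_tendsto_nhdsGT {a l m : ℝ} {f f' : ℝ → ℝ}
    (hf : ∀ s ∈ Ioi a, HasDerivAt f (f' s) s) (hint : IntegrableOn f' (Ioi a))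
    (hl : Tendsto f (𝓝[>] a) (𝓝 l)) (hm : Tendsto f atTop (𝓝 m)) :
    ∫ s in Ioi a, f' s = m - l := by
  have h := integral_Ioi_of_hasDerivAt_of_tendsto (f := Function.update f a l) (f' := f')
    (a := a) (m := m) ?_ ?_ hint ?_
  · rw [h, Function.update_self]
  · rw [continuousWithinAt_update_same]
    convert hl using 2
    ext x; simp
  · intro x hx
    refine (hf x hx).congr_of_eventuallyEq ?_
    filter_upwards [isOpen_ne.mem_nhds (ne_of_gt hx)] with y hy
    exact Function.update_of_ne hy _ _
  · refine hm.congr' ?_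
    filter_upwards [Ioi_mem_atTop a] with y hy
    exact (Function.update_of_ne (ne_of_gt hy) _ _).symm

/-- If `f → L` at infinity and `f s / s` is integrable there, then `L = 0`. -/
lemma eq_zero_of_tendsto_of_integrableOn_div {f : ℝ → ℝ} {L : ℝ} (hf : Tendsto f atTop (𝓝 L))
    (hint : IntegrableOn (fun s => f s / s) (Ioi 1)) : L = 0 := by
  by_contra hL
  have hpos : 0 < |L| := abs_pos.2 hL
  have hev : ∀ᶠ s in atTop, |L| / 2 < |f s| :=
    (hf.abs).eventually (lt_mem_nhds (by linarith))
  obtain ⟨N, hN⟩ := (hev.and (eventually_ge_atTop 1)).exists_forall_of_atTop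
  have hN1 : 1 ≤ N := (hN N le_rfl).2
  apply not_integrableOn_Ioi_inv (a := N)
  have h1 : IntegrableOn (fun s => (2 / |L|) * |f s / s|) (Ioi N) :=
    (hint.mono_set (Ioi_subset_Ioi hN1)).abs.const_mul _
  refine h1.mono' (by fun_prop) ?_
  refine (ae_restrict_mem measurableSet_Ioi).mono fun s hs => ?_
  have hs0 : 0 < s := by linarith [mem_Ioi.1 hs]
  have h2 := (hN s (le_of_lt hs)).1
  rw [Real.norm_eq_abs, abs_inv, abs_div, abs_of_pos hs0, ← mul_div_assoc, inv_eq_one_div]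
  gcongr
  rw [div_mul_eq_mul_div, le_div_iff₀ hpos]
  linarith

/-- A continuation-type uniqueness statement for a singular linear differential inequality. -/
lemma exists_forall_eq_zero_of_singular_system {R b C : ℝ} (hR : 0 ≤ R) (hRb : R < b) (hC : 0 ≤ C)
    {y y' q q' : ℝ → ℝ} (hy : ∀ s ∈ Ioo R b, HasDerivAt y (y' s) s)
    (hq : ∀ s ∈ Ioo R b, HasDerivAt q (q' s) s)
    (hy' : ∀ s ∈ Ioo R b, |y' s| ≤ C * |q s| / s)
    (hq' : ∀ s ∈ Ioo R b, |q' s| ≤ C * |y s| / √s)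
    (hy0 : Tendsto y (𝓝[>] R) (𝓝 0)) (hq0 : Tendsto q (𝓝[>] R) (𝓝 0)) :
    ∃ r > R, ∀ s ∈ Ioo R r, y s = 0 := by
  have hsqrt : ∀ K : ℝ, Tendsto (fun s => K * √s) (𝓝[>] R) (𝓝 (K * √R)) := fun K =>
    ((Real.continuous_sqrt.tendsto R).mono_left nhdsWithin_le_nhds).const_mul K
  have hd : ∀ K s : ℝ, 0 < s → HasDerivAt (fun s => 2 * K * √s) (K / √s) s := by
    intro K s hs
    convert! (Real.hasDerivAt_sqrt hs.ne').const_mul (2 * K) using 1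
    have := Real.sqrt_pos.2 hs
    field_simp
  obtain ⟨r₀, hr₀, hb0⟩ : ∃ r₀ > R, ∀ s ∈ Ioo R r₀, |y s| ≤ 1 := by
    have : ∀ᶠ s in 𝓝[>] R, |y s| ≤ 1 := by
      have := hy0.abs
      rw [abs_zero] at this
      exact (this.eventually (gt_mem_nhds one_pos)).mono fun s hs => hs.le
    obtain ⟨u, hu, hu'⟩ := (mem_nhdsGT_iff_exists_Ioo_subset).1 this
    exact ⟨u, hu, fun s hs => hu' hs⟩
  -- The constant is chosen so that `4 C ^ 2 √ε ≤ 1/2`, while `√s - √R ≤ √ε` for `s ≤ R + ε`,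
  -- uniformly in `R ≥ 0`.
  set ε : ℝ := (1 / (8 * C ^ 2 + 1)) ^ 2 with hε
  have hεpos : 0 < ε := by positivity
  set r := min (min b r₀) (R + ε) with hr
  have hRr : R < r := by
    simp only [hr, lt_min_iff]; exact ⟨⟨hRb, hr₀⟩, by linarith⟩
  have hrb : r ≤ b := (min_le_left _ _).trans (min_le_left _ _)
  have hsub : ∀ s ∈ Ioo R r, s ∈ Ioo R b := fun s hs => ⟨hs.1, hs.2.trans_le hrb⟩
  -- A Picard-type contraction: `|y| ≤ M` gives `|q| ≤ 2 C M √s`, hence `|y'| ≤ 2 C ^ 2 M / √s`.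
  -- This singularity is integrable even when `R = 0`.
  have step : ∀ M : ℝ, 0 ≤ M → (∀ s ∈ Ioo R r, |y s| ≤ M) → ∀ s ∈ Ioo R r, |y s| ≤ M / 2 := by
    intro M hM hyM s hs
    have hq1 : ∀ t ∈ Ioo R r, |q t| ≤ 2 * (C * M) * √t := by
      intro t ht
      have := abs_sub_le_of_deriv_le (a := R) (b := r) (f := q) (g := fun s => 2 * (C * M) * √s)
        (f' := q') (g' := fun s => C * M / √s) (fun s hs => hq s (hsub s hs))
        (fun s hs => hd _ s (hR.trans_lt hs.1)) (fun s hs => (hq' s (hsub s hs)).trans (by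
          have := hyM s hs
          gcongr)) hq0 (hsqrt _) ht
      have h2 : 0 ≤ 2 * (C * M) * √R := by positivity
      rw [sub_zero] at this
      linarith
    have := abs_sub_le_of_deriv_le (a := R) (b := r) (f := y)
      (g := fun s => 2 * (C * (2 * (C * M))) * √s)
      (f' := y') (g' := fun s => C * (2 * (C * M)) / √s) (fun s hs => hy s (hsub s hs))
      (fun s hs => hd _ s (hR.trans_lt hs.1)) (fun s hs => (hy' s (hsub s hs)).trans (by
        have h1 := hq1 s hs
        have hs0 : 0 < s := hR.trans_lt hs.1
        have h2 := Real.sqrt_pos.2 hs0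
        have h3 := Real.mul_self_sqrt hs0.le
        rw [div_le_div_iff₀ hs0 h2]
        calc C * |q s| * √s ≤ C * (2 * (C * M) * √s) * √s := by gcongr
          _ = C * (2 * (C * M)) * s := by rw [← h3]; ring_nf; rw [Real.sqrt_sq h2.le])) hy0 (hsqrt _) hs
    rw [sub_zero] at this
    have h4 : √s - √R ≤ √ε := by
      have h5 : √s ≤ √(R + ε) := Real.sqrt_le_sqrt (hs.2.le.trans (min_le_right _ _))
      have h6 : √(R + ε) ≤ √R + √ε := by
        rw [Real.sqrt_le_left (by positivity)]
        nlinarith [Real.sq_sqrt hR, Real.sq_sqrt hεpos.le, Real.sqrt_nonneg R, Real.sqrt_nonneg ε]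
      linarith
    have h7 : √ε = 1 / (8 * C ^ 2 + 1) := Real.sqrt_sq (by positivity)
    calc |y s| ≤ 4 * C ^ 2 * M * (√s - √R) := by linarith
      _ ≤ 4 * C ^ 2 * M * (1 / (8 * C ^ 2 + 1)) := by
          rw [← h7]; gcongr
      _ ≤ M / 2 := by
          rw [mul_one_div, div_le_iff₀ (by positivity)]
          nlinarith
  have iter : ∀ n : ℕ, ∀ s ∈ Ioo R r, |y s| ≤ (1 / 2) ^ n := by
    intro n
    induction n with
    | zero =>
      intro s hs
      simpa using hb0 s ⟨hs.1, hs.2.trans_le ((min_le_left _ _).trans (min_le_right _ _))⟩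
    | succ n ih =>
      intro s hs
      have := step _ (by positivity) ih s hs
      rw [pow_succ]; linarith
  refine ⟨r, hRr, fun s hs => ?_⟩
  have hlim : Tendsto (fun n : ℕ => ((1 : ℝ) / 2) ^ n) atTop (𝓝 0) :=
    tendsto_pow_atTop_nhds_zero_of_lt_one (by norm_num) (by norm_num)
  have := ge_of_tendsto' hlim fun n => iter n s hs
  exact abs_eq_zero.1 (le_antisymm this (abs_nonneg _))

end HalfLine

/-! ### Positive radial profiles in the variable `s = |x|²` -/

section Profile

/-- A positive solution `U` of `4 (s U')' = λ U - U ^ p` on `(0, ∞)`, with flux `D = s U'`, that is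
square integrable and has `U ^ p` integrable at the origin. -/
structure IsProfile (p lam : ℝ) (U D : ℝ → ℝ) : Prop where
  pos : ∀ s > 0, 0 < U s
  hasDerivAt : ∀ s > 0, HasDerivAt U (D s / s) s
  hasDerivAt_flux : ∀ s > 0, HasDerivAt D ((lam * U s - U s ^ p) / 4) s
  integrableOn_sq : IntegrableOn (fun s => U s ^ 2) (Ioi 0)
  integrableOn_rpow : IntegrableOn (fun s => U s ^ p) (Ioc 0 1)

/-! ### Behaviour of a single profile at the origin. -/

lemma exists_forall_Ioc_abs_le {f : ℝ → ℝ} {l : ℝ} (hf : ContinuousOn f (Ioi 0))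
    (hl : Tendsto f (𝓝[>] 0) (𝓝 l)) : ∃ C > 0, ∀ s ∈ Ioc (0 : ℝ) 1, |f s| ≤ C := by
  have h1 : ∀ᶠ s in 𝓝[>] (0 : ℝ), |f s| ≤ |l| + 1 :=
    (hl.abs.eventually (gt_mem_nhds (lt_add_one _))).mono fun s hs => hs.le
  obtain ⟨r, hr, hr'⟩ := (mem_nhdsGT_iff_exists_Ioo_subset).1 h1
  have hr : 0 < r := hr
  obtain ⟨C, hC⟩ := (isCompact_Icc (a := r) (b := 1)).exists_bound_of_continuousOn
    (hf.mono fun x hx => hr.trans_le hx.1)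
  refine ⟨max (|l| + 1) C, lt_max_of_lt_left (by positivity), fun s hs => ?_⟩
  rcases lt_or_ge s r with h | h
  · exact (hr' ⟨hs.1, h⟩).trans (le_max_left _ _)
  · exact (hC s ⟨h, hs.2⟩).trans (le_max_right _ _)

lemma exists_forall_Ioc_le_of_pos {f : ℝ → ℝ} {d : ℝ} (hf : ContinuousOn f (Ioi 0))
    (hpos : ∀ s > 0, 0 < f s) (hd : 0 < d) (hev : ∀ᶠ s in 𝓝[>] (0 : ℝ), d ≤ f s) :
    ∃ C > 0, ∀ s ∈ Ioc (0 : ℝ) 1, C ≤ f s := by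
  obtain ⟨r, hr, hr'⟩ := (mem_nhdsGT_iff_exists_Ioo_subset).1 hev
  have hr : 0 < r := hr
  rcases lt_or_ge 1 r with h1 | h1
  · exact ⟨d, hd, fun s hs => hr' ⟨hs.1, hs.2.trans_lt h1⟩⟩
  obtain ⟨x, hx, hmin⟩ := (isCompact_Icc (a := r) (b := 1)).exists_isMinOn
    (nonempty_Icc.2 h1) (hf.mono fun x hx => hr.trans_le hx.1)
  refine ⟨min d (f x), lt_min hd (hpos x (hr.trans_le hx.1)), fun s hs => ?_⟩
  rcases lt_or_ge s r with h | h
  · exact (min_le_left _ _).trans (hr' ⟨hs.1, h⟩)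
  · exact (min_le_right _ _).trans (hmin ⟨h, hs.2⟩)

variable {p lam : ℝ} {U D V E : ℝ → ℝ}

namespace IsProfile

lemma continuousOn (h : IsProfile p lam U D) : ContinuousOn U (Ioi 0) :=
  fun s hs => (h.hasDerivAt s hs).continuousAt.continuousWithinAt

lemma continuousOn_flux (h : IsProfile p lam U D) : ContinuousOn D (Ioi 0) :=
  fun s hs => (h.hasDerivAt_flux s hs).continuousAt.continuousWithinAt

lemma continuousOn_rpow (h : IsProfile p lam U D) (q : ℝ) :
    ContinuousOn (fun s => U s ^ q) (Ioi 0) :=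
  h.continuousOn.rpow_const fun s hs => Or.inl (h.pos s hs).ne'

/-- `D'` is integrable at the origin, since `U ≤ 1 + U ^ 2`. The limit is the coefficient of `log s`
in `U`. -/
lemma exists_tendsto_flux (h : IsProfile p lam U D) : ∃ l, Tendsto D (𝓝[>] 0) (𝓝 l) := by
  refine exists_tendsto_nhdsGT_of_integrableOn one_pos (fun s hs => h.hasDerivAt_flux s hs.1) ?_
  have hU : IntegrableOn U (Ioc 0 1) := by
    have h1 : IntegrableOn (fun s => 1 + U s ^ 2) (Ioc 0 1) :=
      (integrableOn_const (by simp)).add (h.integrableOn_sq.mono_set Ioc_subset_Ioi_self)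
    refine h1.mono' ((h.continuousOn.mono Ioc_subset_Ioi_self).aestronglyMeasurable
      measurableSet_Ioc) (Eventually.of_forall fun s => ?_)
    rw [Real.norm_eq_abs, abs_le]
    constructor <;> nlinarith [sq_nonneg (U s - 1), sq_nonneg (U s + 1)]
  exact ((hU.const_mul lam).sub h.integrableOn_rpow).div_const 4

/-- A bounded flux makes `U + C log s` increasing for some `C`, so `U` grows at most
logarithmically, which any negative power dominates. -/
lemma exists_le_rpow_neg (h : IsProfile p lam U D) {e : ℝ} (he : 0 < e) :
    ∃ C > 0, ∀ s ∈ Ioc (0 : ℝ) 1, U s ≤ C * s ^ (-e) := by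
  obtain ⟨l, hl⟩ := h.exists_tendsto_flux
  obtain ⟨C, hC, hD⟩ := exists_forall_Ioc_abs_le h.continuousOn_flux hl
  have hd : ∀ s > 0, HasDerivAt (fun s => U s + C * Real.log s) (D s / s + C * s⁻¹) s :=
    fun s hs => (h.hasDerivAt s hs).add ((Real.hasDerivAt_log hs.ne').const_mul C)
  have hmono : MonotoneOn (fun s => U s + C * Real.log s) (Ioc 0 1) := by
    refine monotoneOn_of_deriv_nonneg (convex_Ioc 0 1)
      (fun x hx => (hd x hx.1).continuousAt.continuousWithinAt) ?_ ?_
    · rw [interior_Ioc]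
      exact fun x hx => (hd x hx.1).differentiableAt.differentiableWithinAt
    · rw [interior_Ioc]
      intro x hx
      rw [(hd x hx.1).deriv, div_eq_mul_inv, ← add_mul]
      have := (abs_le.1 (hD x ⟨hx.1, hx.2.le⟩)).1
      exact mul_nonneg (by linarith) (inv_nonneg.2 hx.1.le)
  have hU1 := h.pos 1 one_pos
  refine ⟨U 1 + C / e, by positivity, fun s hs => ?_⟩
  have h1 := hmono hs ⟨one_pos, le_rfl⟩ hs.2
  simp only [Real.log_one, mul_zero, add_zero] at h1
  have h2 : -Real.log s ≤ s ^ (-e) / e := by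
    have := Real.log_le_rpow_div (inv_nonneg.2 hs.1.le) he
    rwa [Real.log_inv, Real.inv_rpow hs.1.le, ← Real.rpow_neg hs.1.le] at this
  have h3 : 1 ≤ s ^ (-e) := Real.one_le_rpow_of_pos_of_le_one_of_nonpos hs.1 hs.2 (by linarith)
  calc U s ≤ U 1 + C * (-Real.log s) := by linarith
    _ ≤ U 1 * s ^ (-e) + C * (s ^ (-e) / e) := by
        gcongr
        exact le_mul_of_one_le_right hU1.le h3
    _ = _ := by ring

/-- Logarithmic growth in the form used later: `1 / √s` is integrable at `0`, with primitive `2 √s`.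
-/
lemma exists_rpow_le (h : IsProfile p lam U D) {q : ℝ} (hq : 0 < q) :
    ∃ C > 0, ∀ s ∈ Ioc (0 : ℝ) 1, U s ^ q ≤ C / √s := by
  obtain ⟨C, hC, hU⟩ := h.exists_le_rpow_neg (e := 1 / (2 * q)) (by positivity)
  refine ⟨C ^ q, by positivity, fun s hs => ?_⟩
  calc U s ^ q ≤ (C * s ^ (-(1 / (2 * q)))) ^ q :=
        Real.rpow_le_rpow (h.pos s hs.1).le (hU s hs) hq.le
    _ = C ^ q * s ^ (-(1 / 2) : ℝ) := by
        rw [Real.mul_rpow hC.le (Real.rpow_nonneg hs.1.le _), ← Real.rpow_mul hs.1.le]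
        congr 2
        field_simp
    _ = C ^ q / √s := by
        rw [Real.sqrt_eq_rpow, Real.rpow_neg hs.1.le, div_eq_mul_inv (C ^ q)]

/-- A positive profile stays away from zero near the origin. -/
lemma exists_pos_le (h : IsProfile p lam U D) (hp : 1 < p) :
    ∃ d > 0, ∀ s ∈ Ioc (0 : ℝ) 1, d ≤ U s := by
  suffices ∃ d > 0, ∀ᶠ s in 𝓝[>] (0 : ℝ), d ≤ U s by
    obtain ⟨d, hd, hev⟩ := this
    exact exists_forall_Ioc_le_of_pos h.continuousOn h.pos hd hev
  obtain ⟨l, hl⟩ := h.exists_tendsto_flux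
  -- For `l < 0` the profile decreases near the origin. For `l = 0` it has a finite limit. For `l >
  -- 0` the function `U - (l/2) log s` increases, so `U` would tend to `-∞` at the origin.
  rcases lt_trichotomy l 0 with hl0 | rfl | hl0
  · obtain ⟨r, hr, hr'⟩ := (mem_nhdsGT_iff_exists_Ioo_subset).1
      (hl.eventually (gt_mem_nhds hl0))
    have hr : 0 < r := hr
    have hanti : AntitoneOn U (Ioo 0 r) := by
      refine antitoneOn_of_deriv_nonpos (convex_Ioo 0 r)
        (h.continuousOn.mono Ioo_subset_Ioi_self) ?_ ?_
      · rw [interior_Ioo]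
        exact fun x hx => (h.hasDerivAt x hx.1).differentiableAt.differentiableWithinAt
      · rw [interior_Ioo]
        intro x hx
        rw [(h.hasDerivAt x hx.1).deriv]
        exact div_nonpos_of_nonpos_of_nonneg (le_of_lt (hr' hx)) hx.1.le
    refine ⟨U (r / 2), h.pos _ (by linarith), ?_⟩
    filter_upwards [Ioo_mem_nhdsGT (show (0 : ℝ) < r / 2 by linarith)] with s hs
    exact hanti ⟨hs.1, by linarith [hs.2]⟩ ⟨by linarith, by linarith⟩ hs.2.le
  · obtain ⟨C, hC, hUp⟩ := h.exists_rpow_le (q := p) (by linarith)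
    obtain ⟨C', hC', hU1⟩ := h.exists_rpow_le (q := 1) one_pos
    set K := |lam| * C' + C with hK
    have hK0 : 0 ≤ K := by positivity
    have hsq : ∀ M : ℝ, Tendsto (fun s => 2 * M * √s) (𝓝[>] 0) (𝓝 0) := fun M => by
      have := ((Real.continuous_sqrt.tendsto 0).mono_left
        (nhdsWithin_le_nhds (s := Ioi 0))).const_mul (2 * M)
      simpa using this
    have hd : ∀ M s : ℝ, 0 < s → HasDerivAt (fun s => 2 * M * √s) (M / √s) s := by
      intro M s hs
      convert! (Real.hasDerivAt_sqrt hs.ne').const_mul (2 * M) using 1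
      have := Real.sqrt_pos.2 hs
      field_simp
    have hD : ∀ s ∈ Ioo (0 : ℝ) 1, |D s| ≤ 2 * K * √s := by
      intro s hs
      have := abs_sub_le_of_deriv_le (fun s hs => h.hasDerivAt_flux s hs.1)
        (fun s hs => hd K s hs.1) (a := 0) (b := 1) ?_ hl (hsq K) hs
      · simpa using this
      · intro t ht
        have h1 := hUp t ⟨ht.1, ht.2.le⟩
        have h2 := hU1 t ⟨ht.1, ht.2.le⟩
        have hUt := h.pos t ht.1
        have hst := Real.sqrt_pos.2 ht.1
        rw [Real.rpow_one] at h2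
        have h3 : |lam| * U t ≤ |lam| * (C' / √t) := by gcongr
        have h4 : 0 ≤ U t ^ p := by positivity
        have h5 : |lam * U t| = |lam| * U t := by rw [abs_mul, abs_of_pos hUt]
        have h6 : K / √t = |lam| * (C' / √t) + C / √t := by rw [hK]; ring
        have h7 := abs_sub (lam * U t) (U t ^ p)
        rw [abs_of_nonneg h4, h5] at h7
        rw [abs_div, h6, abs_of_pos (by norm_num : (0 : ℝ) < 4)]
        linarith [abs_nonneg (lam * U t - U t ^ p)]
    obtain ⟨u, hu⟩ : ∃ u, Tendsto U (𝓝[>] 0) (𝓝 u) := by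
      refine exists_tendsto_nhdsGT_of_integrableOn (b := 1 / 2) (by norm_num)
        (fun s hs => h.hasDerivAt s hs.1) ?_
      have h1 : IntegrableOn (fun s : ℝ => 2 * K * s ^ (-(1 / 2) : ℝ)) (Ioc 0 (1 / 2)) := by
        have := (intervalIntegral.intervalIntegrable_rpow' (a := 0) (b := 1 / 2)
          (r := -(1 / 2)) (by norm_num)).const_mul (2 * K)
        rwa [intervalIntegrable_iff_integrableOn_Ioc_of_le (by norm_num)] at this
      refine h1.mono' (((h.continuousOn_flux.div continuousOn_id
        fun x hx => (ne_of_gt hx)).mono Ioc_subset_Ioi_self).aestronglyMeasurable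
          measurableSet_Ioc) ?_
      refine (ae_restrict_mem measurableSet_Ioc).mono fun s hs => ?_
      have h2 := hD s ⟨hs.1, hs.2.trans_lt (by norm_num)⟩
      have h3 := Real.sqrt_pos.2 hs.1
      rw [Real.norm_eq_abs, abs_div, abs_of_pos hs.1, Real.rpow_neg hs.1.le,
        ← Real.sqrt_eq_rpow, div_le_iff₀ hs.1]
      calc |D s| ≤ 2 * K * √s := h2
        _ = 2 * K * (√s)⁻¹ * (√s * √s) := by field_simp
        _ = _ := by rw [Real.mul_self_sqrt hs.1.le]
    have hu0 : 0 ≤ u := ge_of_tendsto hu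
      (eventually_mem_nhdsWithin.mono fun s hs => (h.pos s hs).le)
    -- If the limit were `0`, both `U` and `D` would start from zero, and the singular system would
    -- force `U = 0` on an interval.
    rcases hu0.eq_or_lt with rfl | hu0
    · exfalso
      obtain ⟨C, hC, hUp⟩ := h.exists_rpow_le (q := p - 1) (by linarith)
      have hzero := exists_forall_eq_zero_of_singular_system (R := 0) (b := 1)
        (C := |lam| + C + 1) le_rfl one_pos (by positivity) (y := U) (q := D)
        (fun s hs => h.hasDerivAt s hs.1) (fun s hs => h.hasDerivAt_flux s hs.1) ?_ ?_ hu hl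
      · obtain ⟨r, hr, hr0⟩ := hzero
        have := hr0 (r / 2) ⟨by linarith, by linarith⟩
        have h2 := h.pos (r / 2) (by linarith)
        linarith
      · intro s hs
        rw [abs_div, abs_of_pos hs.1]
        gcongr
        · exact hs.1.le
        · exact le_mul_of_one_le_left (abs_nonneg _) (by linarith [abs_nonneg lam])
      · intro s hs
        have h1 := hUp s ⟨hs.1, hs.2.le⟩
        have hUs := h.pos s hs.1
        have hst := Real.sqrt_pos.2 hs.1
        have hs1 : √s ≤ 1 := Real.sqrt_le_one.2 hs.2.le
        have h2 : U s ^ p = U s ^ (p - 1) * U s := by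
          rw [← Real.rpow_add_one hUs.ne']; congr 1; ring
        have h3 : lam * U s - U s ^ p = (lam - U s ^ (p - 1)) * U s := by rw [h2]; ring
        have h4 : 0 ≤ U s ^ (p - 1) := by positivity
        have h5 := abs_sub lam (U s ^ (p - 1))
        rw [abs_of_nonneg h4] at h5
        have h6 : |lam| ≤ |lam| / √s := by
          rw [le_div_iff₀ hst]; nlinarith [abs_nonneg lam]
        have h7 : 0 ≤ 1 / √s := by positivity
        have h8 : (|lam| + C + 1) * |U s| / √s = (|lam| / √s + C / √s + 1 / √s) * |U s| := by
          ring
        rw [h3, abs_div, abs_mul, h8, abs_of_pos (by norm_num : (0 : ℝ) < 4)]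
        have h9 : |lam - U s ^ (p - 1)| * |U s| ≤
            (|lam| / √s + C / √s + 1 / √s) * |U s| := by
          gcongr
          linarith
        have h10 : 0 ≤ |lam - U s ^ (p - 1)| * |U s| := by positivity
        linarith
    · exact ⟨u / 2, by linarith, (hu.eventually (lt_mem_nhds (half_lt_self hu0))).mono
        fun s hs => hs.le⟩
  · exfalso
    obtain ⟨r, hr, hr'⟩ := (mem_nhdsGT_iff_exists_Ioo_subset).1
      (hl.eventually (lt_mem_nhds (half_lt_self hl0)))
    have hr : 0 < r := hr
    have hd : ∀ s > 0, HasDerivAt (fun s => U s - l / 2 * Real.log s)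
        (D s / s - l / 2 * s⁻¹) s :=
      fun s hs => (h.hasDerivAt s hs).sub ((Real.hasDerivAt_log hs.ne').const_mul _)
    have hmono : MonotoneOn (fun s => U s - l / 2 * Real.log s) (Ioo 0 r) := by
      refine monotoneOn_of_deriv_nonneg (convex_Ioo 0 r)
        (fun x hx => (hd x hx.1).continuousAt.continuousWithinAt) ?_ ?_
      · rw [interior_Ioo]
        exact fun x hx => (hd x hx.1).differentiableAt.differentiableWithinAt
      · rw [interior_Ioo]
        intro x hx
        rw [(hd x hx.1).deriv, div_eq_mul_inv, ← sub_mul]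
        have : l / 2 < D x := hr' hx
        exact mul_nonneg (by linarith) (inv_nonneg.2 hx.1.le)
    have hlog : ∀ᶠ s in 𝓝[>] (0 : ℝ),
        l / 2 * Real.log s < l / 2 * Real.log (r / 2) - U (r / 2) :=
      (Real.tendsto_log_nhdsGT_zero.const_mul_atBot (half_pos hl0)).eventually
        (eventually_lt_atBot _)
    obtain ⟨s, hs1, hs2⟩ := (hlog.and
      (Ioo_mem_nhdsGT (show (0 : ℝ) < r / 2 by linarith))).exists
    have h1 := hmono ⟨hs2.1, by linarith [hs2.2]⟩ ⟨by linarith, by linarith⟩ hs2.2.le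
    have h2 := h.pos s hs2.1
    simp only at h1
    linarith

end IsProfile

/-! ### The Pohozaev functional and decay at infinity. -/

/-- The Pohozaev-type functional of Shioji and Watanabe in the variable `s = |x|²`. -/
def pohozaev (p lam : ℝ) (U D : ℝ → ℝ) (s : ℝ) : ℝ :=
  s ^ (-(2 / (p + 3))) * (2 * D s ^ 2 + 2 * (2 / (p + 3)) * D s * U s + (2 / (p + 3)) ^ 2 * U s ^ 2
    + s * (U s ^ (p + 1) / (p + 1) - lam / 2 * U s ^ 2))

/-- The weight in the derivative of `pohozaev`. -/
def pohozaevWeight (p lam s : ℝ) : ℝ :=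
  s ^ (-(2 / (p + 3))) * ((2 / (p + 3)) ^ 3 / s + lam * ((p - 1) / (2 * (p + 3))))

namespace IsProfile

lemma hasDerivAt_rpow_add_one (h : IsProfile p lam U D) {s : ℝ} (hs : 0 < s) :
    HasDerivAt (fun s => U s ^ (p + 1)) ((p + 1) * U s ^ p * (D s / s)) s := by
  convert! (h.hasDerivAt s hs).rpow_const (p := p + 1) (Or.inl (h.pos s hs).ne') using 1
  rw [add_sub_cancel_right]; ring

/-- Boundedness at infinity, from the monotonicity of the energy. -/
lemma exists_rpow_le_atTop (h : IsProfile p lam U D) (hp : 1 < p) :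
    ∃ B > 0, ∀ s ≥ 1, U s ^ (p - 1) ≤ B := by
  -- This is the mechanical energy of the radial equation: with `r = √s`, the first term is half the
  -- square of the `r`-derivative. It is dissipated, and the power `p + 1 > 2` dominates the
  -- negative quadratic term.
  set E : ℝ → ℝ := fun s => 2 * D s ^ 2 / s - lam / 2 * U s ^ 2 + U s ^ (p + 1) / (p + 1) with hE
  have hd : ∀ s > 0, HasDerivAt E (-(2 * D s ^ 2 / s ^ 2)) s := by
    intro s hs
    have h1 := h.hasDerivAt s hs
    have h2 := h.hasDerivAt_flux s hs
    have h3 := h.hasDerivAt_rpow_add_one hs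
    convert! ((((h2.fun_pow 2).const_mul 2).div (hasDerivAt_id s) hs.ne').sub
      ((h1.fun_pow 2).const_mul (lam / 2))).add (h3.div_const (p + 1)) using 1
    simp only [id]
    field_simp
    ring
  have hanti : AntitoneOn E (Ici 1) := by
    refine antitoneOn_of_deriv_nonpos (convex_Ici 1)
      (fun x hx => (hd x (one_pos.trans_le hx)).continuousAt.continuousWithinAt) ?_ ?_
    · rw [interior_Ici]
      exact fun x hx => (hd x (one_pos.trans hx)).differentiableAt.differentiableWithinAt
    · rw [interior_Ici]
      intro x hx
      rw [(hd x (one_pos.trans hx)).deriv, neg_nonpos]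
      positivity
  refine ⟨max 1 ((p + 1) * (|E 1| + lam / 2)), by positivity, fun s hs => ?_⟩
  have hs0 : 0 < s := by linarith
  have hU := h.pos s hs0
  rcases le_or_gt (U s) 1 with h1 | h1
  · exact (Real.rpow_le_one hU.le h1 (by linarith)).trans (le_max_left _ _)
  · refine le_trans ?_ (le_max_right _ _)
    have h2 : E s ≤ E 1 := hanti (by simp) hs hs
    have h3 : 0 ≤ 2 * D s ^ 2 / s := by positivity
    have h4 : U s ^ (p + 1) = U s ^ (p - 1) * U s ^ 2 := by
      rw [← Real.rpow_natCast, ← Real.rpow_add hU]; congr 1; push_cast; ring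
    have h5 : U s ^ (p + 1) / (p + 1) ≤ |E 1| + lam / 2 * U s ^ 2 := by
      have : E s = 2 * D s ^ 2 / s - lam / 2 * U s ^ 2 + U s ^ (p + 1) / (p + 1) := rfl
      linarith [le_abs_self (E 1)]
    have h6 : 1 ≤ U s ^ 2 := by nlinarith
    rw [div_le_iff₀ (by linarith), h4] at h5
    have h7 : U s ^ (p - 1) * U s ^ 2 ≤ (p + 1) * (|E 1| + lam / 2) * U s ^ 2 := by
      refine h5.trans ?_
      have : |E 1| ≤ |E 1| * U s ^ 2 := le_mul_of_one_le_right (abs_nonneg _) h6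
      have h8 : 0 ≤ p + 1 := by linarith
      nlinarith [mul_le_mul_of_nonneg_left this h8]
    exact le_of_mul_le_mul_right h7 (by positivity)

lemma rpow_add_one_eq (h : IsProfile p lam U D) {s : ℝ} (hs : 0 < s) :
    U s ^ (p + 1) = U s ^ (p - 1) * U s ^ 2 := by
  rw [← Real.rpow_natCast, ← Real.rpow_add (h.pos s hs)]; congr 1; push_cast; ring

lemma integrableOn_rpow_add_one (h : IsProfile p lam U D) (hp : 1 < p) :
    IntegrableOn (fun s => U s ^ (p + 1)) (Ioi 1) := by
  obtain ⟨B, hB, hBU⟩ := h.exists_rpow_le_atTop hp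
  have hsub : Ioi (1 : ℝ) ⊆ Ioi 0 := Ioi_subset_Ioi zero_le_one
  refine ((h.integrableOn_sq.mono_set hsub).const_mul B).mono'
    (((h.continuousOn_rpow _).mono hsub).aestronglyMeasurable measurableSet_Ioi) ?_
  refine (ae_restrict_mem measurableSet_Ioi).mono fun s hs => ?_
  have hs0 : 0 < s := hsub hs
  have hU := h.pos s hs0
  rw [Real.norm_eq_abs, abs_of_nonneg (by positivity), h.rpow_add_one_eq hs0]
  have := hBU s (le_of_lt hs)
  gcongr

/-- The Dirichlet energy of a profile is finite at infinity. -/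
lemma integrableOn_flux_sq_div (h : IsProfile p lam U D) (hp : 1 < p) :
    IntegrableOn (fun s => D s ^ 2 / s) (Ioi 1) := by
  have hsub : Ioi (1 : ℝ) ⊆ Ioi 0 := Ioi_subset_Ioi zero_le_one
  -- Multiplying the equation by `U` gives `(U D)' = D ^ 2 / s + k` with `k` integrable, so only the
  -- upper boundary term `U D` needs control.
  set k : ℝ → ℝ := fun s => (lam * U s ^ 2 - U s ^ (p + 1)) / 4 with hk
  have hkint : IntegrableOn k (Ioi 1) :=
    (((h.integrableOn_sq.mono_set hsub).const_mul lam).sub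
      (h.integrableOn_rpow_add_one hp)).div_const 4
  have hd : ∀ s > 0, HasDerivAt (fun s => U s * D s) (D s ^ 2 / s + k s) s := by
    intro s hs
    convert! (h.hasDerivAt s hs).mul (h.hasDerivAt_flux s hs) using 1
    rw [hk]
    simp only
    rw [Real.rpow_add_one (h.pos s hs).ne']
    field_simp
  -- Otherwise `U` would eventually increase and could not be square integrable. At points with `D ≤
  -- 0` the boundary term has the good sign.
  have hfreq : ∃ᶠ s in atTop, D s ≤ 0 := by
    intro hev
    simp only [not_le] at hev
    obtain ⟨N, hN⟩ := (hev.and (eventually_ge_atTop 1)).exists_forall_of_atTop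
    have hN1 : 1 ≤ N := (hN N le_rfl).2
    have hmono : MonotoneOn U (Ici N) := by
      refine monotoneOn_of_deriv_nonneg (convex_Ici N)
        (h.continuousOn.mono fun x hx => one_pos.trans_le (hN1.trans hx)) ?_ ?_
      · rw [interior_Ici]
        intro x hx
        have hx0 : 0 < x := by linarith [mem_Ioi.1 hx]
        exact (h.hasDerivAt x hx0).differentiableAt.differentiableWithinAt
      · rw [interior_Ici]
        intro x hx
        have hx0 : 0 < x := by linarith [mem_Ioi.1 hx]
        rw [(h.hasDerivAt x hx0).deriv]
        exact div_nonneg (hN x (le_of_lt hx)).1.le hx0.le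
    have hUN := h.pos N (by linarith)
    have hconst : IntegrableOn (fun _ : ℝ => U N ^ 2) (Ioi N) := by
      refine (h.integrableOn_sq.mono_set (Ioi_subset_Ioi (by linarith))).mono'
        aestronglyMeasurable_const ?_
      refine (ae_restrict_mem measurableSet_Ioi).mono fun s hs => ?_
      have := hmono self_mem_Ici (le_of_lt (mem_Ioi.1 hs) : N ≤ s) (le_of_lt hs)
      rw [Real.norm_eq_abs, abs_of_nonneg (by positivity)]
      gcongr
    rw [integrableOn_const_iff] at hconst
    simp [hUN.ne'] at hconst
  have hcont : ContinuousOn (fun s => D s ^ 2 / s) (Ioi 0) :=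
    (h.continuousOn_flux.pow 2).div continuousOn_id fun x hx => ne_of_gt hx
  have hkc : ContinuousOn k (Ioi 0) :=
    (((h.continuousOn.pow 2).const_smul lam).sub (h.continuousOn_rpow _)).div_const 4
  have hii : ∀ f : ℝ → ℝ, ContinuousOn f (Ioi 0) → ∀ x ≥ 1,
      IntervalIntegrable f volume 1 x := fun f hf x hx => by
    refine (hf.mono ?_).intervalIntegrable
    rw [uIcc_of_le hx]
    exact fun y hy => one_pos.trans_le hy.1
  refine integrableOn_Ioi_of_intervalIntegral_norm_bounded
    ((∫ s in Ioi 1, ‖k s‖) + |U 1 * D 1|) 1 (l := atTop) (b := id) ?_ tendsto_id ?_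
  · intro x
    rcases le_or_gt 1 x with hx | hx
    · exact (intervalIntegrable_iff_integrableOn_Ioc_of_le hx).1 (hii _ hcont x hx)
    · simp [Ioc_eq_empty (not_lt.2 hx.le)]
  · filter_upwards [eventually_ge_atTop 1] with x hx
    obtain ⟨y, hy, hDy⟩ := (hfreq.and_eventually (eventually_ge_atTop x)).exists.imp
      fun y hy => And.symm hy
    have hy1 : 1 ≤ y := hx.trans hy
    have hnn : ∀ s ∈ Ioc (1 : ℝ) y, ‖D s ^ 2 / s‖ = D s ^ 2 / s := fun s hs => by
      have : 0 < s := one_pos.trans hs.1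
      exact Real.norm_of_nonneg (by positivity)
    have h1 : ∫ s in (1 : ℝ)..x, ‖D s ^ 2 / s‖ ≤ ∫ s in (1 : ℝ)..y, ‖D s ^ 2 / s‖ :=
      intervalIntegral.integral_mono_interval le_rfl hx hy
        (Eventually.of_forall fun s => norm_nonneg _) (hii _ hcont y hy1).norm
    have h2 : ∫ s in (1 : ℝ)..y, (D s ^ 2 / s + k s) = U y * D y - U 1 * D 1 := by
      refine intervalIntegral.integral_eq_sub_of_hasDerivAt (f := fun s => U s * D s) ?_
        ((hii _ hcont y hy1).add (hii _ hkc y hy1))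
      intro s hs
      rw [uIcc_of_le hy1] at hs
      exact hd s (one_pos.trans_le hs.1)
    rw [intervalIntegral.integral_add (hii _ hcont y hy1) (hii _ hkc y hy1)] at h2
    have h3 : ∫ s in (1 : ℝ)..y, ‖D s ^ 2 / s‖ = ∫ s in (1 : ℝ)..y, D s ^ 2 / s := by
      rw [intervalIntegral.integral_of_le hy1, intervalIntegral.integral_of_le hy1]
      exact setIntegral_congr_fun measurableSet_Ioc hnn
    have h4 : -(∫ s in (1 : ℝ)..y, k s) ≤ ∫ s in Ioi 1, ‖k s‖ := by
      rw [intervalIntegral.integral_of_le hy1]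
      refine ((neg_le_abs _).trans_eq (Real.norm_eq_abs _).symm).trans
        ((norm_integral_le_integral_norm _).trans ?_)
      exact setIntegral_mono_set hkint.norm (Eventually.of_forall fun s => norm_nonneg _)
        Ioc_subset_Ioi_self.eventuallyLE
    have h5 : U y * D y ≤ 0 :=
      mul_nonpos_of_nonneg_of_nonpos (h.pos y (one_pos.trans_le hy1)).le hDy
    simp only [id]
    linarith [neg_abs_le (U 1 * D 1)]

/-- The Pohozaev functional is decreasing. -/
lemma hasDerivAt_pohozaev (h : IsProfile p lam U D) (hp : 1 < p) {s : ℝ} (hs : 0 < s) :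
    HasDerivAt (pohozaev p lam U D) (-(pohozaevWeight p lam s * U s ^ 2)) s := by
  have h1 := h.hasDerivAt s hs
  have h2 := h.hasDerivAt_flux s hs
  have h3 := h.hasDerivAt_rpow_add_one hs
  have h0 : HasDerivAt (fun s : ℝ => s ^ (-(2 / (p + 3))))
      (-(2 / (p + 3)) * (s ^ (-(2 / (p + 3))) / s)) s := by
    convert! Real.hasDerivAt_rpow_const (p := -(2 / (p + 3))) (Or.inl hs.ne') using 2
    rw [Real.rpow_sub_one hs.ne']
  convert! h0.mul ((((h2.fun_pow 2).const_mul 2).add ((h2.const_mul (2 * (2 / (p + 3)))).mul h1)).add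
    ((h1.fun_pow 2).const_mul ((2 / (p + 3)) ^ 2)) |>.add
    ((hasDerivAt_id s).mul ((h3.div_const (p + 1)).sub ((h1.fun_pow 2).const_mul (lam / 2)))))
    using 1
  simp only [id, pohozaevWeight, Pi.add_apply, Pi.mul_apply, Pi.sub_apply]
  rw [Real.rpow_add_one (h.pos s hs).ne']
  -- Writing `k` for the exponent, the terms in `D ^ 2`, `D U` and `D U ^ p` cancel for every `k`.
  -- The coefficient of `U ^ (p + 1)` is `-k / 2 + (1 - k) / (p + 1)`, which vanishes exactly for `k
  -- = 2 / (p + 3)`. Only a multiple of `U ^ 2` remains.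
  generalize s ^ (-(2 / (p + 3))) = a
  generalize U s ^ p = b
  have hp3 : p + 3 ≠ 0 := by linarith
  have hp1 : p + 1 ≠ 0 := by linarith
  field_simp
  ring

lemma pohozaevWeight_nonneg (hp : 1 < p) (hlam : 0 < lam) {s : ℝ} (hs : 0 < s) :
    0 ≤ pohozaevWeight p lam s := by
  have : 0 < p - 1 := by linarith
  have : 0 < p + 3 := by linarith
  unfold pohozaevWeight
  positivity

lemma pohozaevWeight_pos (hp : 1 < p) (hlam : 0 < lam) {s : ℝ} (hs : 0 < s) :
    0 < pohozaevWeight p lam s := by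
  have : 0 < p - 1 := by linarith
  have : 0 < p + 3 := by linarith
  unfold pohozaevWeight
  positivity

lemma integrableOn_flux_mul_div {V E : ℝ → ℝ} (h : IsProfile p lam U D)
    (h' : IsProfile p lam V E) (hp : 1 < p) :
    IntegrableOn (fun s => U s * E s / s) (Ioi 1) := by
  have hsub : Ioi (1 : ℝ) ⊆ Ioi 0 := Ioi_subset_Ioi zero_le_one
  refine ((h.integrableOn_sq.mono_set hsub).add (h'.integrableOn_flux_sq_div hp)).mono'
    ((((h.continuousOn.mul h'.continuousOn_flux).div continuousOn_id
      fun x hx => ne_of_gt hx).mono hsub).aestronglyMeasurable measurableSet_Ioi) ?_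
  refine (ae_restrict_mem measurableSet_Ioi).mono fun s hs => ?_
  have hs1 : 1 < s := hs
  have hs0 : 0 < s := by linarith
  have h1 : |U s * E s| ≤ U s ^ 2 + E s ^ 2 := by
    rw [abs_le]
    constructor <;> nlinarith [sq_nonneg (U s + E s), sq_nonneg (U s - E s), sq_nonneg (U s),
      sq_nonneg (E s)]
  rw [Real.norm_eq_abs, abs_div, abs_of_pos hs0, div_le_iff₀ hs0, Pi.add_apply, add_mul,
    div_mul_cancel₀ _ hs0.ne']
  nlinarith [sq_nonneg (U s)]

/-- No pointwise decay is needed: the derivative is integrable at infinity, so a limit exists, and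
integrability of the functional divided by `s` makes it zero. -/
lemma tendsto_pohozaev_atTop (h : IsProfile p lam U D) (hp : 1 < p) (hlam : 0 < lam) :
    Tendsto (pohozaev p lam U D) atTop (𝓝 0) := by
  have hsub : Ioi (1 : ℝ) ⊆ Ioi 0 := Ioi_subset_Ioi zero_le_one
  have hsq := h.integrableOn_sq.mono_set hsub
  have hp3 : 0 < p + 3 := by linarith
  have hpw : ∀ s ∈ Ioi (1 : ℝ), 0 ≤ s ^ (-(2 / (p + 3))) ∧ s ^ (-(2 / (p + 3))) ≤ 1 := by
    intro s hs
    have hs1 : 1 < s := hs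
    refine ⟨by positivity, Real.rpow_le_one_of_one_le_of_nonpos hs1.le ?_⟩
    have : 0 < 2 / (p + 3) := by positivity
    linarith
  have hcontp : ContinuousOn (fun s : ℝ => s ^ (-(2 / (p + 3)))) (Ioi 0) :=
    continuousOn_id.rpow_const fun s hs => Or.inl (ne_of_gt hs)
  have hcontw : ContinuousOn (pohozaevWeight p lam) (Ioi 0) :=
    hcontp.mul ((continuousOn_const.div continuousOn_id fun s hs => ne_of_gt hs).add
      continuousOn_const)
  have hd : IntegrableOn (fun s => -(pohozaevWeight p lam s * U s ^ 2)) (Ioi 1) := by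
    refine (hsq.const_mul ((2 / (p + 3)) ^ 3 + lam * ((p - 1) / (2 * (p + 3))))).mono'
      (((hcontw.mul (h.continuousOn.pow 2)).neg.mono hsub).aestronglyMeasurable
        measurableSet_Ioi) ?_
    refine (ae_restrict_mem measurableSet_Ioi).mono fun s hs => ?_
    have hs1 : 1 < s := hs
    have hp1 : 0 < p - 1 := by linarith
    rw [norm_neg, Real.norm_of_nonneg
      (mul_nonneg (pohozaevWeight_nonneg hp hlam (hsub hs)) (sq_nonneg _))]
    refine mul_le_mul_of_nonneg_right ?_ (sq_nonneg _)
    unfold pohozaevWeight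
    calc _ ≤ 1 * ((2 / (p + 3)) ^ 3 / s + lam * ((p - 1) / (2 * (p + 3)))) := by
          have := (hpw s hs).2
          gcongr
      _ ≤ _ := by
          rw [one_mul]
          gcongr
          exact div_le_self (by positivity) hs1.le
  have hlim := tendsto_limUnder_of_hasDerivAt_of_integrableOn_Ioi
    (fun s hs => h.hasDerivAt_pohozaev hp (hsub hs)) hd
  have hzero := eq_zero_of_tendsto_of_integrableOn_div hlim ?_
  · rwa [hzero] at hlim
  have h1 : IntegrableOn (fun s => 2 * (D s ^ 2 / s) + 2 * (2 / (p + 3)) * (U s * D s / s)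
      + (2 / (p + 3)) ^ 2 * (U s ^ 2 / s)
      + (1 / (p + 1) * U s ^ (p + 1) - lam / 2 * U s ^ 2)) (Ioi 1) := by
    have h2 : IntegrableOn (fun s => U s ^ 2 / s) (Ioi 1) := by
      refine hsq.mono' ((((h.continuousOn.pow 2).div continuousOn_id
        fun x hx => ne_of_gt hx).mono hsub).aestronglyMeasurable measurableSet_Ioi) ?_
      refine (ae_restrict_mem measurableSet_Ioi).mono fun s hs => ?_
      have hs1 : 1 < s := hs
      rw [Real.norm_of_nonneg (by positivity)]
      exact div_le_self (by positivity) hs1.le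
    exact ((((h.integrableOn_flux_sq_div hp).const_mul 2).add
      ((h.integrableOn_flux_mul_div h hp).const_mul _)).add (h2.const_mul _)).add
      (((h.integrableOn_rpow_add_one hp).const_mul _).sub (hsq.const_mul _))
  refine h1.norm.mono' ?_ ?_
  · refine ContinuousOn.aestronglyMeasurable (ContinuousOn.mono ?_ hsub) measurableSet_Ioi
    exact ContinuousOn.div (fun s hs =>
      (h.hasDerivAt_pohozaev hp hs).continuousAt.continuousWithinAt) continuousOn_id
      fun x hx => ne_of_gt hx
  · refine (ae_restrict_mem measurableSet_Ioi).mono fun s hs => ?_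
    have hs0 : s ≠ 0 := (hsub hs : 0 < s).ne'
    have : pohozaev p lam U D s / s = s ^ (-(2 / (p + 3))) *
        (2 * (D s ^ 2 / s) + 2 * (2 / (p + 3)) * (U s * D s / s)
      + (2 / (p + 3)) ^ 2 * (U s ^ 2 / s)
      + (1 / (p + 1) * U s ^ (p + 1) - lam / 2 * U s ^ 2)) := by
      unfold pohozaev
      field_simp
    rw [this, norm_mul, Real.norm_of_nonneg (hpw s hs).1]
    exact mul_le_of_le_one_left (norm_nonneg _) (hpw s hs).2

/-- A strictly decreasing function with limit zero at infinity is positive. -/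
lemma pohozaev_pos (h : IsProfile p lam U D) (hp : 1 < p) (hlam : 0 < lam) {s : ℝ} (hs : 0 < s) :
    0 < pohozaev p lam U D s := by
  have hanti : StrictAntiOn (pohozaev p lam U D) (Ioi 0) := by
    refine strictAntiOn_of_deriv_neg (convex_Ioi 0)
      (fun s hs => (h.hasDerivAt_pohozaev hp hs).continuousAt.continuousWithinAt) ?_
    rw [interior_Ioi]
    intro x hx
    rw [(h.hasDerivAt_pohozaev hp hx).deriv, neg_lt_zero]
    have := h.pos x hx
    exact mul_pos (pohozaevWeight_pos hp hlam hx) (by positivity)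
  have h1 : pohozaev p lam U D (s + 1) < pohozaev p lam U D s :=
    hanti hs (by simp; linarith) (by linarith)
  refine lt_of_le_of_lt (le_of_tendsto (h.tendsto_pohozaev_atTop hp hlam) ?_) h1
  filter_upwards [eventually_ge_atTop (s + 1)] with t ht
  exact hanti.antitoneOn (by simp; linarith) (by simp; linarith) ht

end IsProfile

/-! ### Wronskian and quotient of two profiles. -/

lemma neg_of_deriv_neg_of_tendsto {f f' : ℝ → ℝ} {r : ℝ} (hf : ∀ s > 0, HasDerivAt f (f' s) s)
    (hf' : ∀ s ∈ Ioo 0 r, f' s < 0) (hlim : Tendsto f (𝓝[>] 0) (𝓝 0)) {s : ℝ}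
    (hs : s ∈ Ioc 0 r) : f s < 0 := by
  have hanti : StrictAntiOn f (Ioc 0 r) := by
    refine strictAntiOn_of_deriv_neg (convex_Ioc 0 r)
      (fun x hx => (hf x hx.1).continuousAt.continuousWithinAt) ?_
    rw [interior_Ioc]
    intro x hx
    rw [(hf x hx.1).deriv]
    exact hf' x hx
  have hs0 := hs.1
  have h2 : s / 2 ∈ Ioc 0 r := ⟨by linarith, by linarith [hs.2]⟩
  refine (hanti h2 hs (by linarith)).trans_le (ge_of_tendsto hlim ?_)
  filter_upwards [Ioo_mem_nhdsGT h2.1] with t ht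
  exact hanti.antitoneOn ⟨ht.1, ht.2.le.trans h2.2⟩ h2 ht.2.le

lemma exists_pos_tendsto_of_tendsto_inv {f : ℝ → ℝ} {a b : ℝ} {l : Filter ℝ} [l.NeBot]
    (hf : Tendsto f l (𝓝 a)) (hinv : Tendsto (fun s => (f s)⁻¹) l (𝓝 b))
    (hpos : ∀ᶠ s in l, 0 < f s) : 0 < a := by
  have h1 : Tendsto (fun s => f s * (f s)⁻¹) l (𝓝 1) :=
    tendsto_const_nhds.congr' (hpos.mono fun s hs => (mul_inv_cancel₀ hs.ne').symm)
  have h2 := tendsto_nhds_unique h1 (hf.mul hinv)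
  refine lt_of_le_of_ne (ge_of_tendsto hf (hpos.mono fun s hs => hs.le)) ?_
  rintro rfl
  simp at h2

/-- The Wronskian `s (U V' - U' V)` of two profiles with fluxes `D`, `E`. -/
def wronskian (U D V E : ℝ → ℝ) (s : ℝ) : ℝ := U s * E s - V s * D s

namespace IsProfile

lemma hasDerivAt_wronskian (h : IsProfile p lam U D) (h' : IsProfile p lam V E) {s : ℝ}
    (hs : 0 < s) : HasDerivAt (wronskian U D V E) ((V s * U s ^ p - U s * V s ^ p) / 4) s := by
  convert! ((h.hasDerivAt s hs).mul (h'.hasDerivAt_flux s hs)).sub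
    ((h'.hasDerivAt s hs).mul (h.hasDerivAt_flux s hs)) using 1
  ring

lemma hasDerivAt_div (h : IsProfile p lam U D) (h' : IsProfile p lam V E) {s : ℝ}
    (hs : 0 < s) : HasDerivAt (fun s => V s / U s) (wronskian U D V E s / (s * U s ^ 2)) s := by
  have hU := (h.pos s hs).ne'
  convert! (h'.hasDerivAt s hs).div (h.hasDerivAt s hs) hU using 1
  unfold wronskian
  field_simp

lemma rpow_eq_div_mul (h : IsProfile p lam U D) (h' : IsProfile p lam V E) {s : ℝ} (hs : 0 < s)
    (q : ℝ) : V s ^ q = (V s / U s) ^ q * U s ^ q := by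
  have hU := h.pos s hs
  have hV := h'.pos s hs
  rw [← Real.mul_rpow (by positivity) hU.le, div_mul_cancel₀ _ hU.ne']

/-- In this form the sign is visible: for `p > 1`, the derivative is negative exactly where `V > U`.
-/
lemma wronskian_deriv_eq (h : IsProfile p lam U D) (h' : IsProfile p lam V E) {s : ℝ}
    (hs : 0 < s) : (V s * U s ^ p - U s * V s ^ p) / 4 =
      U s ^ (p + 1) * (V s / U s - (V s / U s) ^ p) / 4 := by
  have hU := h.pos s hs
  rw [h.rpow_eq_div_mul h' hs p, Real.rpow_add_one hU.ne']
  field_simp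

lemma mul_rpow_le_add (h : IsProfile p lam U D) (h' : IsProfile p lam V E) (hp : 1 < p) {s : ℝ}
    (hs : 0 < s) : V s * U s ^ p ≤ U s ^ (p + 1) + V s ^ (p + 1) := by
  have hU := h.pos s hs
  have hV := h'.pos s hs
  rcases le_total (V s) (U s) with hle | hle
  · have : V s * U s ^ p ≤ U s ^ (p + 1) := by
      rw [Real.rpow_add_one hU.ne', mul_comm]; gcongr
    have h2 : 0 ≤ V s ^ (p + 1) := by positivity
    linarith
  · have : V s * U s ^ p ≤ V s ^ (p + 1) := by
      rw [Real.rpow_add_one hV.ne', mul_comm]; gcongr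
    have h2 : 0 ≤ U s ^ (p + 1) := by positivity
    linarith

/-- The integrable derivative gives a limit. Finite Dirichlet energy and square integrability make
the Wronskian divided by `s` integrable, so the limit is zero. -/
lemma exists_tendsto_wronskian_atTop (h : IsProfile p lam U D) (h' : IsProfile p lam V E)
    (hp : 1 < p)
    (hint : IntegrableOn (fun s => V s * U s ^ p) (Ioi 0))
    (hint' : IntegrableOn (fun s => U s * V s ^ p) (Ioi 0)) :
    Tendsto (wronskian U D V E) atTop (𝓝 0) := by
  have hsub : Ioi (1 : ℝ) ⊆ Ioi 0 := Ioi_subset_Ioi zero_le_one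
  have hlim := tendsto_limUnder_of_hasDerivAt_of_integrableOn_Ioi
    (fun s hs => h.hasDerivAt_wronskian h' (hsub hs))
    (IntegrableOn.mono_set ((hint.sub hint').div_const 4) hsub)
  have hzero := eq_zero_of_tendsto_of_integrableOn_div hlim ?_
  · rwa [hzero] at hlim
  refine ((h.integrableOn_flux_mul_div h' hp).sub (h'.integrableOn_flux_mul_div h hp)).congr ?_
  exact Eventually.of_forall fun s => (sub_div _ _ _).symm

/-- The symmetry of the weak formulation makes the Wronskian vanish at the origin. -/
lemma tendsto_wronskian_nhdsGT (h : IsProfile p lam U D) (h' : IsProfile p lam V E)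
    (hp : 1 < p)
    (hint : IntegrableOn (fun s => V s * U s ^ p) (Ioi 0))
    (hint' : IntegrableOn (fun s => U s * V s ^ p) (Ioi 0))
    (heq : ∫ s in Ioi 0, V s * U s ^ p = ∫ s in Ioi 0, U s * V s ^ p) :
    Tendsto (wronskian U D V E) (𝓝[>] 0) (𝓝 0) := by
  have hd := (hint.sub hint').div_const 4
  obtain ⟨l, hl⟩ := exists_tendsto_nhdsGT_of_integrableOn one_pos
    (fun s hs => h.hasDerivAt_wronskian h' hs.1) (IntegrableOn.mono_set hd Ioc_subset_Ioi_self)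
  -- The total variation `W(∞) - W(0+)` is the integral of `W'`, which the pairing identity makes
  -- zero. This takes the place of comparing the two boundary conditions at the origin.
  have h1 := integral_Ioi_of_hasDerivAt_of_tendsto_nhdsGT
    (fun s hs => h.hasDerivAt_wronskian h' hs) hd hl
    (h.exists_tendsto_wronskian_atTop h' hp hint hint')
  have h2 : ∫ s in Ioi 0, (V s * U s ^ p - U s * V s ^ p) / 4 = 0 := by
    rw [integral_div, integral_sub hint hint', heq, sub_self, zero_div]
  have : l = 0 := by linarith
  rwa [this] at hl

/-- The derivative is `O(1 / √s)` and the Wronskian starts from zero. -/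
lemma exists_abs_wronskian_le (h : IsProfile p lam U D) (h' : IsProfile p lam V E)
    (hp : 1 < p) (hw : Tendsto (wronskian U D V E) (𝓝[>] 0) (𝓝 0)) :
    ∃ C > 0, ∀ s ∈ Ioc (0 : ℝ) 1, |wronskian U D V E s| ≤ C * √s := by
  obtain ⟨C, hC, hU⟩ := h.exists_rpow_le (q := p + 1) (by linarith)
  obtain ⟨C', hC', hV⟩ := h'.exists_rpow_le (q := p + 1) (by linarith)
  have hsq : Tendsto (fun s => 2 * (C + C') * √s) (𝓝[>] 0) (𝓝 0) := by
    have := ((Real.continuous_sqrt.tendsto 0).mono_left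
      (nhdsWithin_le_nhds (s := Ioi 0))).const_mul (2 * (C + C'))
    simpa using this
  have hd : ∀ s : ℝ, 0 < s → HasDerivAt (fun s => 2 * (C + C') * √s) ((C + C') / √s) s := by
    intro s hs
    convert! (Real.hasDerivAt_sqrt hs.ne').const_mul (2 * (C + C')) using 1
    have := Real.sqrt_pos.2 hs
    field_simp
  have key : ∀ s ∈ Ioo (0 : ℝ) 1, |wronskian U D V E s| ≤ 2 * (C + C') * √s := by
    intro s hs
    have := abs_sub_le_of_deriv_le (a := 0) (b := 1)
      (fun s hs => h.hasDerivAt_wronskian h' hs.1) (fun s hs => hd s hs.1) ?_ hw hsq hs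
    · simpa using this
    · intro t ht
      have h1 := h.mul_rpow_le_add h' hp ht.1
      have h2 := h'.mul_rpow_le_add h hp ht.1
      have h3 := hU t ⟨ht.1, ht.2.le⟩
      have h4 := hV t ⟨ht.1, ht.2.le⟩
      have hUt := h.pos t ht.1
      have hVt := h'.pos t ht.1
      have h5 : 0 ≤ V t * U t ^ p := by positivity
      have h6 : 0 ≤ U t * V t ^ p := by positivity
      rw [abs_le, add_div]
      constructor <;> linarith
  refine ⟨2 * (C + C'), by positivity, fun s hs => ?_⟩
  rcases hs.2.lt_or_eq with h1 | rfl
  · exact key s ⟨hs.1, h1⟩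
  · refine le_of_tendsto_of_tendsto (b := 𝓝[<] (1 : ℝ)) (f := fun s => |wronskian U D V E s|)
      (g := fun s => 2 * (C + C') * √s) ?_ ?_ ?_
    · exact ((h.hasDerivAt_wronskian h' one_pos).continuousAt.abs.tendsto).mono_left
        nhdsWithin_le_nhds
    · exact ((hd 1 one_pos).continuousAt.tendsto).mono_left nhdsWithin_le_nhds
    · filter_upwards [Ioo_mem_nhdsLT one_pos] with s hs using key s hs

/-- The derivative `W / (s U ^ 2)` is `O(1 / √s)`, because `W = O(√s)` and `U` is bounded below near
the origin. -/
lemma exists_tendsto_div (h : IsProfile p lam U D) (h' : IsProfile p lam V E)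
    (hp : 1 < p) (hw : Tendsto (wronskian U D V E) (𝓝[>] 0) (𝓝 0)) :
    ∃ l, Tendsto (fun s => V s / U s) (𝓝[>] 0) (𝓝 l) := by
  obtain ⟨C, hC, hCw⟩ := h.exists_abs_wronskian_le h' hp hw
  obtain ⟨d, hd, hdU⟩ := h.exists_pos_le hp
  refine exists_tendsto_nhdsGT_of_integrableOn one_pos
    (fun s hs => h.hasDerivAt_div h' hs.1) ?_
  have h1 : IntegrableOn (fun s : ℝ => C / d ^ 2 * s ^ (-(1 / 2) : ℝ)) (Ioc 0 1) := by
    have := (intervalIntegral.intervalIntegrable_rpow' (a := 0) (b := 1)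
      (r := -(1 / 2)) (by norm_num)).const_mul (C / d ^ 2)
    rwa [intervalIntegrable_iff_integrableOn_Ioc_of_le (by norm_num)] at this
  refine h1.mono' (ContinuousOn.aestronglyMeasurable ?_ measurableSet_Ioc) ?_
  · refine ContinuousOn.div (fun s hs =>
      (h.hasDerivAt_wronskian h' hs.1).continuousAt.continuousWithinAt)
      (continuousOn_id.mul ((h.continuousOn.mono Ioc_subset_Ioi_self).pow 2)) fun s hs => ?_
    exact mul_ne_zero hs.1.ne' (pow_ne_zero 2 (h.pos s hs.1).ne')
  · refine (ae_restrict_mem measurableSet_Ioc).mono fun s hs => ?_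
    have hs0 := hs.1
    have h3 := Real.sqrt_pos.2 hs.1
    have h4 := hdU s hs
    rw [Real.norm_eq_abs, abs_div, abs_of_nonneg (by positivity : 0 ≤ s * U s ^ 2),
      Real.rpow_neg hs.1.le, ← Real.sqrt_eq_rpow]
    calc |wronskian U D V E s| / (s * U s ^ 2) ≤ C * √s / (s * d ^ 2) := by
          have := hCw s hs
          gcongr
      _ = C * √s / (√s * √s * d ^ 2) := by rw [Real.mul_self_sqrt hs.1.le]
      _ = _ := by field_simp

lemma wronskian_comm (s : ℝ) : wronskian V E U D s = -wronskian U D V E s := by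
  unfold wronskian; ring

/-- By symmetry `U / V` has a limit too, and the product of the two limits is `1`. -/
lemma exists_pos_tendsto_div (h : IsProfile p lam U D) (h' : IsProfile p lam V E)
    (hp : 1 < p) (hw : Tendsto (wronskian U D V E) (𝓝[>] 0) (𝓝 0)) :
    ∃ l > 0, Tendsto (fun s => V s / U s) (𝓝[>] 0) (𝓝 l) := by
  obtain ⟨l, hl⟩ := h.exists_tendsto_div h' hp hw
  obtain ⟨m, hm⟩ := h'.exists_tendsto_div h hp (by
    have := hw.neg
    rw [neg_zero] at this
    exact this.congr fun s => (wronskian_comm s).symm)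
  refine ⟨l, exists_pos_tendsto_of_tendsto_inv hl (hm.congr fun s => (inv_div _ _).symm) ?_, hl⟩
  exact eventually_mem_nhdsWithin.mono fun s hs => div_pos (h'.pos s hs) (h.pos s hs)

/-- Local uniqueness to the right of a point `R ≥ 0` at which the Cauchy data agree. -/
lemma exists_forall_div_eq_one (h : IsProfile p lam U D) (h' : IsProfile p lam V E)
    (hp : 1 < p) {R : ℝ} (hR : 0 ≤ R)
    (hw : Tendsto (wronskian U D V E) (𝓝[>] R) (𝓝 0))
    (hq : Tendsto (fun s => V s / U s) (𝓝[>] R) (𝓝 1)) :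
    ∃ r > R, ∀ s ∈ Ioo R r, V s / U s = 1 := by
  obtain ⟨d, hd, hdU⟩ : ∃ d > 0, ∀ᶠ s in 𝓝[>] R, d ≤ U s := by
    rcases hR.eq_or_lt with rfl | hR
    · obtain ⟨d, hd, hdU⟩ := h.exists_pos_le hp
      exact ⟨d, hd, Filter.mem_of_superset (Ioc_mem_nhdsGT one_pos) hdU⟩
    · refine ⟨U R / 2, half_pos (h.pos R hR), ?_⟩
      exact (((h.hasDerivAt R hR).continuousAt.tendsto.mono_left nhdsWithin_le_nhds).eventually
        (lt_mem_nhds (half_lt_self (h.pos R hR)))).mono fun s hs => hs.le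
  obtain ⟨C, hC, hCU⟩ : ∃ C > 0, ∀ᶠ s in 𝓝[>] R, U s ^ (p + 1) ≤ C / √s := by
    rcases hR.eq_or_lt with rfl | hR
    · obtain ⟨C, hC, hCU⟩ := h.exists_rpow_le (q := p + 1) (by linarith)
      exact ⟨C, hC, Filter.mem_of_superset (Ioc_mem_nhdsGT one_pos) hCU⟩
    · have hUR := h.pos R hR
      refine ⟨U R ^ (p + 1) * √R + 1, by positivity, ?_⟩
      have h1 : ContinuousAt (fun s => U s ^ (p + 1) * √s) R :=
        (h.hasDerivAt_rpow_add_one hR).continuousAt.mul Real.continuous_sqrt.continuousAt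
      filter_upwards [(h1.tendsto.mono_left nhdsWithin_le_nhds).eventually
        (gt_mem_nhds (lt_add_one _)), self_mem_nhdsWithin] with s hs hs'
      rw [le_div_iff₀ (Real.sqrt_pos.2 (hR.trans hs'))]
      exact hs.le
  -- Differentiability of `w - w ^ p` at its zero `w = 1` linearizes `W'`, so that `w - 1` and `W`
  -- satisfy the singular linear system.
  obtain ⟨K, hK, hKw⟩ : ∃ K > 0, ∀ᶠ w in 𝓝 (1 : ℝ), |w - w ^ p| ≤ K * |w - 1| := by
    have h1 : HasDerivAt (fun w : ℝ => w - w ^ p) (1 - p * 1 ^ (p - 1)) 1 :=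
      (hasDerivAt_id (1 : ℝ)).sub (Real.hasDerivAt_rpow_const (Or.inl one_ne_zero))
    obtain ⟨K, hK, hb⟩ := h1.isBigO_sub.exists_pos
    refine ⟨K, hK, hb.bound.mono fun w hw => ?_⟩
    simpa using hw
  obtain ⟨b, hb, hb'⟩ := (mem_nhdsGT_iff_exists_Ioo_subset).1
    (hdU.and (hCU.and (hq.eventually hKw)))
  have hpos : ∀ s ∈ Ioo R b, 0 < s := fun s hs => hR.trans_lt hs.1
  have hzero := exists_forall_eq_zero_of_singular_system (R := R) (b := b)
    (C := 1 / d ^ 2 + C * K) hR hb (by positivity) (y := fun s => V s / U s - 1)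
    (q := wronskian U D V E)
    (fun s hs => (h.hasDerivAt_div h' (hpos s hs)).sub_const 1)
    (fun s hs => h.hasDerivAt_wronskian h' (hpos s hs)) ?_ ?_ ?_ hw
  · obtain ⟨r, hr, hr'⟩ := hzero
    exact ⟨r, hr, fun s hs => sub_eq_zero.1 (hr' s hs)⟩
  · intro s hs
    have hs0 := hpos s hs
    have h1 : d ≤ U s := (hb' hs).1
    rw [abs_div, abs_of_nonneg (by positivity : 0 ≤ s * U s ^ 2)]
    calc |wronskian U D V E s| / (s * U s ^ 2) ≤ |wronskian U D V E s| / (s * d ^ 2) := by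
          gcongr
      _ = 1 / d ^ 2 * |wronskian U D V E s| / s := by field_simp
      _ ≤ _ := by
          gcongr
          have : 0 < C * K := by positivity
          linarith
  · intro s hs
    have hs0 := hpos s hs
    have hU := h.pos s hs0
    have h1 : U s ^ (p + 1) ≤ C / √s := (hb' hs).2.1
    have h2 : |V s / U s - (V s / U s) ^ p| ≤ K * |V s / U s - 1| := (hb' hs).2.2
    have hsq := Real.sqrt_pos.2 hs0
    rw [h.wronskian_deriv_eq h' hs0, abs_div, abs_mul, abs_of_pos (by norm_num : (0 : ℝ) < 4),
      abs_of_nonneg (by positivity : 0 ≤ U s ^ (p + 1))]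
    calc U s ^ (p + 1) * |V s / U s - (V s / U s) ^ p| / 4
        ≤ C / √s * (K * |V s / U s - 1|) / 4 := by gcongr
      _ ≤ C / √s * (K * |V s / U s - 1|) := div_le_self (by positivity) (by norm_num)
      _ = C * K * |V s / U s - 1| / √s := by ring
      _ ≤ _ := by
          gcongr
          have : 0 < 1 / d ^ 2 := by positivity
          linarith
  · have := hq.sub_const 1
    rwa [sub_self] at this

/-- Continuation: at a finite supremum of the intervals of equality, the quotient is still `1` and
the Wronskian still `0`, so local uniqueness extends the interval. -/
lemma eq_of_tendsto_div_one (h : IsProfile p lam U D) (h' : IsProfile p lam V E)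
    (hp : 1 < p) (hw : Tendsto (wronskian U D V E) (𝓝[>] 0) (𝓝 0))
    (hq : Tendsto (fun s => V s / U s) (𝓝[>] 0) (𝓝 1)) : ∀ s > 0, U s = V s := by
  set S : Set ℝ := {r | 0 < r ∧ ∀ s ∈ Ioo 0 r, V s / U s = 1} with hS
  have hne : S.Nonempty := by
    obtain ⟨r, hr, hr'⟩ := h.exists_forall_div_eq_one h' hp le_rfl hw hq
    exact ⟨r, hr, hr'⟩
  have hunbdd : ¬ BddAbove S := by
    intro hbdd
    set R := sSup S with hRdef
    have hRpos : 0 < R := by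
      obtain ⟨r, hr⟩ := hne
      exact hr.1.trans_le (le_csSup hbdd hr)
    have hone : ∀ s ∈ Ioo 0 R, V s / U s = 1 := by
      intro s hs
      obtain ⟨r, hr, hsr⟩ := exists_lt_of_lt_csSup hne hs.2
      exact hr.2 s ⟨hs.1, hsr⟩
    have hwz : ∀ s ∈ Ioo 0 R, wronskian U D V E s = 0 := by
      intro s hs
      have h1 : HasDerivAt (fun s => V s / U s) 0 s :=
        (hasDerivAt_const s (1 : ℝ)).congr_of_eventuallyEq (by
          filter_upwards [Ioo_mem_nhds hs.1 hs.2] with t ht using hone t ht)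
      have h2 := h1.unique (h.hasDerivAt_div h' hs.1)
      have h3 : s * U s ^ 2 ≠ 0 := mul_ne_zero hs.1.ne' (pow_ne_zero 2 (h.pos s hs.1).ne')
      exact (div_eq_zero_iff.1 h2.symm).resolve_right h3
    have hlim : ∀ f : ℝ → ℝ, ∀ c : ℝ, ContinuousAt f R → (∀ s ∈ Ioo 0 R, f s = c) →
        Tendsto f (𝓝[>] R) (𝓝 c) := by
      intro f c hf hc
      have h1 : Tendsto f (𝓝[<] R) (𝓝 c) := tendsto_const_nhds.congr' (by
        filter_upwards [Ioo_mem_nhdsLT hRpos] with s hs using (hc s hs).symm)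
      rw [tendsto_nhds_unique h1 (hf.tendsto.mono_left nhdsWithin_le_nhds)]
      exact hf.tendsto.mono_left nhdsWithin_le_nhds
    have hcq := (h.hasDerivAt_div h' hRpos).continuousAt
    obtain ⟨r, hr, hr'⟩ := h.exists_forall_div_eq_one h' hp hRpos.le
      (hlim _ 0 (h.hasDerivAt_wronskian h' hRpos).continuousAt hwz) (hlim _ 1 hcq hone)
    have hR1 : V R / U R = 1 := tendsto_nhds_unique
      (hcq.tendsto.mono_left nhdsWithin_le_nhds) (hlim _ 1 hcq hone)
    have hrS : r ∈ S := by
      refine ⟨hRpos.trans hr, fun s hs => ?_⟩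
      rcases lt_trichotomy s R with h1 | rfl | h1
      · exact hone s ⟨hs.1, h1⟩
      · exact hR1
      · exact hr' s ⟨h1, hs.2⟩
    exact absurd (le_csSup hbdd hrS) (not_le.2 hr)
  intro s hs
  rw [not_bddAbove_iff] at hunbdd
  obtain ⟨r, hr, hsr⟩ := hunbdd s
  exact ((div_eq_one_iff_eq (h.pos s hs).ne').1 (hr.2 s ⟨hs, hsr⟩)).symm

/-! ### Comparison of the Pohozaev functionals of two profiles. -/

/-- The difference `(V/U)² J(U) - J(V)` of two Pohozaev functionals in terms of the Wronskian. -/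
lemma pohozaev_comparison_eq (h : IsProfile p lam U D) (h' : IsProfile p lam V E)
    {s : ℝ} (hs : 0 < s) :
    (V s / U s) ^ 2 * pohozaev p lam U D s - pohozaev p lam V E s =
      s ^ (-(2 / (p + 3))) * (-(2 * wronskian U D V E s ^ 2 / U s ^ 2)
        - 4 * (V s / U s) * wronskian U D V E s * D s / U s
        - 2 * (2 / (p + 3)) * (V s / U s) * wronskian U D V E s
        + s / (p + 1) * ((V s / U s) ^ 2 * U s ^ (p + 1) - V s ^ (p + 1))) := by
  have hU := (h.pos s hs).ne'
  have hV := (h'.pos s hs).ne'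
  unfold pohozaev wronskian
  generalize s ^ (-(2 / (p + 3))) = a
  generalize 2 / (p + 3) = k
  generalize U s ^ (p + 1) = b
  generalize V s ^ (p + 1) = c
  rw [div_eq_mul_inv b, div_eq_mul_inv c, div_eq_mul_inv s]
  generalize (p + 1)⁻¹ = m
  field_simp
  ring

/-- The factor `(V / U) ^ 2` turns `weight · U ^ 2` into `weight · V ^ 2`, so the derivatives of the
two functionals cancel and only the derivative of the factor survives. -/
lemma hasDerivAt_pohozaev_comparison (h : IsProfile p lam U D) (h' : IsProfile p lam V E)
    (hp : 1 < p) {s : ℝ} (hs : 0 < s) :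
    HasDerivAt (fun s => (V s / U s) ^ 2 * pohozaev p lam U D s - pohozaev p lam V E s)
      (2 * (V s / U s) * (wronskian U D V E s / (s * U s ^ 2)) * pohozaev p lam U D s) s := by
  have hU := (h.pos s hs).ne'
  convert! (((h.hasDerivAt_div h' hs).fun_pow 2).mul (h.hasDerivAt_pohozaev hp hs)).sub
    (h'.hasDerivAt_pohozaev hp hs) using 1
  generalize pohozaev p lam U D s = a
  generalize pohozaevWeight p lam s = b
  generalize wronskian U D V E s = c
  simp only [Nat.cast_ofNat, Nat.add_one_sub_one, pow_one]
  field_simp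
  ring

/-- Each functional blows up at the origin. In the difference, every term contains `W = O(√s)` or
`s` times a power that is `O(1 / √s)`, so the bracket is `O(√s)`. -/
lemma tendsto_pohozaev_comparison_nhdsGT (h : IsProfile p lam U D) (h' : IsProfile p lam V E)
    (hp : 1 < p) (hw : Tendsto (wronskian U D V E) (𝓝[>] 0) (𝓝 0)) :
    Tendsto (fun s => (V s / U s) ^ 2 * pohozaev p lam U D s - pohozaev p lam V E s)
      (𝓝[>] 0) (𝓝 0) := by
  obtain ⟨A, hA, hwA⟩ := h.exists_abs_wronskian_le h' hp hw
  obtain ⟨d, hd, hdU⟩ := h.exists_pos_le hp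
  obtain ⟨l, hl⟩ := h.exists_tendsto_flux
  obtain ⟨B, hB, hDB⟩ := exists_forall_Ioc_abs_le h.continuousOn_flux hl
  obtain ⟨m, hm⟩ := h.exists_tendsto_div h' hp hw
  obtain ⟨W, hW, hVW⟩ := exists_forall_Ioc_abs_le (h'.continuousOn.div h.continuousOn
    fun s hs => (h.pos s hs).ne') hm
  obtain ⟨C, hC, hUC⟩ := h.exists_rpow_le (q := p + 1) (by linarith)
  obtain ⟨C', hC', hVC⟩ := h'.exists_rpow_le (q := p + 1) (by linarith)
  have hp3 : 0 < p + 3 := by linarith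
  have hp1 : 0 < p + 1 := by linarith
  set k := 2 / (p + 3) with hk
  have hk0 : 0 < k := by positivity
  -- Equivalent to `p > 1`; this is what lets `√s` beat the prefactor `s ^ (-k)`.
  have hk1 : k < 1 / 2 := by rw [hk, div_lt_div_iff₀ hp3 two_pos]; linarith
  set M := 2 * A ^ 2 / d ^ 2 + 4 * W * A * B / d + 2 * k * W * A
    + 1 / (p + 1) * (W ^ 2 * C + C') with hM
  have hlim : Tendsto (fun s : ℝ => M * s ^ (1 / 2 - k)) (𝓝[>] 0) (𝓝 0) := by
    have h1 : Tendsto (fun s : ℝ => s ^ (1 / 2 - k)) (𝓝[>] 0) (𝓝 0) := by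
      have := (Real.continuousAt_rpow_const 0 (1 / 2 - k) (Or.inr (by linarith))).tendsto
      rw [Real.zero_rpow (by linarith)] at this
      exact this.mono_left nhdsWithin_le_nhds
    simpa using h1.const_mul M
  refine squeeze_zero_norm' ?_ hlim
  filter_upwards [Ioc_mem_nhdsGT one_pos] with s hs
  have hs0 : 0 < s := hs.1
  have hsq := Real.sqrt_pos.2 hs0
  have hsq1 : √s ≤ 1 := Real.sqrt_le_one.2 hs.2
  have hss := Real.mul_self_sqrt hs0.le
  have hUs := h.pos s hs0
  have hVs := h'.pos s hs0
  have b1 := hwA s hs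
  have b2 := hdU s hs
  have b3 := hDB s hs
  have b4 : V s / U s ≤ W := (le_abs_self _).trans (hVW s hs)
  have b5 := hUC s hs
  have b6 := hVC s hs
  have hq : 0 < V s / U s := by positivity
  rw [h.pohozaev_comparison_eq h' hs0, Real.norm_eq_abs, abs_mul,
    abs_of_nonneg (Real.rpow_nonneg hs0.le _), ← hk]
  have e1 : |2 * wronskian U D V E s ^ 2 / U s ^ 2| ≤ 2 * A ^ 2 / d ^ 2 * √s := by
    rw [abs_div, abs_mul, abs_pow, abs_of_pos (by norm_num : (0 : ℝ) < 2),
      abs_of_pos (by positivity : 0 < U s ^ 2)]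
    calc 2 * |wronskian U D V E s| ^ 2 / U s ^ 2 ≤ 2 * (A * √s) ^ 2 / d ^ 2 := by gcongr
      _ = 2 * A ^ 2 / d ^ 2 * √s * √s := by ring
      _ ≤ 2 * A ^ 2 / d ^ 2 * √s := mul_le_of_le_one_right (by positivity) hsq1
  have e2 : |4 * (V s / U s) * wronskian U D V E s * D s / U s| ≤ 4 * W * A * B / d * √s := by
    rw [abs_div, abs_mul, abs_mul, abs_mul, abs_of_pos (by norm_num : (0 : ℝ) < 4),
      abs_of_pos hq, abs_of_pos hUs]
    calc 4 * (V s / U s) * |wronskian U D V E s| * |D s| / U s ≤ 4 * W * (A * √s) * B / d := by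
          gcongr
      _ = _ := by ring
  have e3 : |2 * k * (V s / U s) * wronskian U D V E s| ≤ 2 * k * W * A * √s := by
    rw [abs_mul, abs_of_pos (by positivity : 0 < 2 * k * (V s / U s))]
    calc 2 * k * (V s / U s) * |wronskian U D V E s| ≤ 2 * k * W * (A * √s) := by gcongr
      _ = _ := by ring
  have e4 : |s / (p + 1) * ((V s / U s) ^ 2 * U s ^ (p + 1) - V s ^ (p + 1))| ≤
      1 / (p + 1) * (W ^ 2 * C + C') * √s := by
    rw [abs_mul, abs_of_pos (by positivity : 0 < s / (p + 1))]
    have f1 : (V s / U s) ^ 2 * U s ^ (p + 1) ≤ W ^ 2 * (C / √s) := by gcongr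
    have f2 : 0 ≤ (V s / U s) ^ 2 * U s ^ (p + 1) := by positivity
    have f3 : 0 ≤ V s ^ (p + 1) := by positivity
    have f4 : |(V s / U s) ^ 2 * U s ^ (p + 1) - V s ^ (p + 1)| ≤ (W ^ 2 * C + C') / √s := by
      rw [add_div, mul_div_assoc, abs_le]
      constructor <;> linarith
    calc _ ≤ s / (p + 1) * ((W ^ 2 * C + C') / √s) := by gcongr
      _ = √s * √s / (p + 1) * ((W ^ 2 * C + C') / √s) := by rw [hss]
      _ = _ := by field_simp
  have hsplit : s ^ (1 / 2 - k) = s ^ (-k) * √s := by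
    rw [Real.sqrt_eq_rpow, ← Real.rpow_add hs0]; congr 1; ring
  rw [hsplit, mul_left_comm M]
  refine mul_le_mul_of_nonneg_left ?_ (Real.rpow_nonneg hs0.le _)
  rw [hM]
  simp only [add_mul]
  rw [abs_le] at e1 e2 e3 e4 ⊢
  constructor <;> linarith [e1.1, e1.2, e2.1, e2.2, e3.1, e3.2, e4.1, e4.2]

/-- A negative Wronskian makes `V / U` decreasing, hence bounded at infinity, where both functionals
vanish. -/
lemma tendsto_pohozaev_comparison_atTop (h : IsProfile p lam U D) (h' : IsProfile p lam V E)
    (hp : 1 < p) (hlam : 0 < lam) (hneg : ∀ s > 0, wronskian U D V E s < 0) :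
    Tendsto (fun s => (V s / U s) ^ 2 * pohozaev p lam U D s - pohozaev p lam V E s)
      atTop (𝓝 0) := by
  have hanti : AntitoneOn (fun s => V s / U s) (Ioi 0) := by
    refine antitoneOn_of_deriv_nonpos (convex_Ioi 0)
      (fun s hs => (h.hasDerivAt_div h' hs).continuousAt.continuousWithinAt) ?_ ?_
    · rw [interior_Ioi]
      exact fun x hx => (h.hasDerivAt_div h' hx).differentiableAt.differentiableWithinAt
    · rw [interior_Ioi]
      intro x hx
      have hx0 : 0 < x := hx
      rw [(h.hasDerivAt_div h' hx).deriv]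
      exact div_nonpos_of_nonpos_of_nonneg (hneg x hx).le (by positivity)
  have h1 := (h.tendsto_pohozaev_atTop hp hlam).const_mul ((V 1 / U 1) ^ 2)
  rw [mul_zero] at h1
  have h2 : Tendsto (fun s => (V s / U s) ^ 2 * pohozaev p lam U D s) atTop (𝓝 0) := by
    refine squeeze_zero' ?_ ?_ h1
    · filter_upwards [eventually_gt_atTop 0] with s hs
      exact mul_nonneg (sq_nonneg _) (h.pohozaev_pos hp hlam hs).le
    · filter_upwards [eventually_ge_atTop 1] with s hs
      have hs0 : 0 < s := by linarith
      have h3 := hanti (mem_Ioi.2 one_pos) (mem_Ioi.2 hs0) hs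
      have h4 := h.pos s hs0
      have h5 := h'.pos s hs0
      have h6 := (h.pohozaev_pos hp hlam hs0).le
      simp only at h3
      gcongr
  simpa using h2.sub (h'.tendsto_pohozaev_atTop hp hlam)

/-- The heart of uniqueness: as long as `W < 0`, the comparison functional decreases from `0`, which
is impossible both if this lasts forever and if it ends at a first zero of `W`. -/
lemma not_one_lt_of_tendsto_div (h : IsProfile p lam U D) (h' : IsProfile p lam V E)
    (hp : 1 < p) (hlam : 0 < lam) (hw : Tendsto (wronskian U D V E) (𝓝[>] 0) (𝓝 0))
    {l : ℝ} (hq : Tendsto (fun s => V s / U s) (𝓝[>] 0) (𝓝 l)) : ¬ 1 < l := by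
  intro hl
  have hX := fun s (hs : 0 < s) => h.hasDerivAt_pohozaev_comparison h' hp hs
  have hX0 := h.tendsto_pohozaev_comparison_nhdsGT h' hp hw
  have hX' : ∀ s > 0, wronskian U D V E s < 0 →
      2 * (V s / U s) * (wronskian U D V E s / (s * U s ^ 2)) * pohozaev p lam U D s < 0 := by
    intro s hs hneg
    have h1 := h.pos s hs
    have h2 := h'.pos s hs
    have h3 := h.pohozaev_pos hp hlam hs
    refine mul_neg_of_neg_of_pos (mul_neg_of_pos_of_neg (by positivity) ?_) h3
    exact div_neg_of_neg_of_pos hneg (by positivity)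
  have hwneg : ∀ s > 0, 1 < V s / U s → (V s * U s ^ p - U s * V s ^ p) / 4 < 0 := by
    intro s hs hgt
    have h1 := h.pos s hs
    rw [h.wronskian_deriv_eq h' hs]
    have h2 : V s / U s < (V s / U s) ^ p := Real.self_lt_rpow_of_one_lt hgt hp
    have h3 : 0 < U s ^ (p + 1) := by positivity
    nlinarith
  have hdw := fun s (hs : 0 < s) => h.hasDerivAt_wronskian h' hs
  obtain ⟨r, hr, hr'⟩ := (mem_nhdsGT_iff_exists_Ioo_subset).1 (hq.eventually (lt_mem_nhds hl))
  have hr : 0 < r := hr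
  have hnear : ∀ s ∈ Ioc 0 r, wronskian U D V E s < 0 := fun s hs =>
    neg_of_deriv_neg_of_tendsto hdw (fun t ht => hwneg t ht.1 (hr' ht)) hw hs
  by_cases hall : ∀ s > 0, wronskian U D V E s < 0
  · have hneg : ∀ s > 0, (V s / U s) ^ 2 * pohozaev p lam U D s - pohozaev p lam V E s < 0 :=
      fun s hs => neg_of_deriv_neg_of_tendsto (r := s) hX
        (fun t ht => hX' t ht.1 (hall t ht.1)) hX0 ⟨hs, le_rfl⟩
    have hanti : AntitoneOn
        (fun s => (V s / U s) ^ 2 * pohozaev p lam U D s - pohozaev p lam V E s) (Ioi 0) := by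
      refine antitoneOn_of_deriv_nonpos (convex_Ioi 0)
        (fun s hs => (hX s hs).continuousAt.continuousWithinAt) ?_ ?_
      · rw [interior_Ioi]
        exact fun x hx => (hX x hx).differentiableAt.differentiableWithinAt
      · rw [interior_Ioi]
        intro x hx
        rw [(hX x hx).deriv]
        exact (hX' x hx (hall x hx)).le
    have h1 := ge_of_tendsto (h.tendsto_pohozaev_comparison_atTop h' hp hlam hall).neg (b :=
      -((V 1 / U 1) ^ 2 * pohozaev p lam U D 1 - pohozaev p lam V E 1)) (by
        filter_upwards [eventually_ge_atTop 1] with s hs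
        have := hanti (mem_Ioi.2 one_pos) (mem_Ioi.2 (one_pos.trans_le hs)) hs
        simp only at this ⊢
        linarith)
    have := hneg 1 one_pos
    linarith
  · push Not at hall
    set T : Set ℝ := {s | 0 < s ∧ 0 ≤ wronskian U D V E s} with hT
    have hTne : T.Nonempty := hall.imp fun s hs => hs
    have hTr : ∀ s ∈ T, r < s := fun s hs => by
      by_contra hle
      exact absurd (hnear s ⟨hs.1, not_lt.1 hle⟩) (not_lt.2 hs.2)
    have hTbdd : BddBelow T := ⟨r, fun s hs => (hTr s hs).le⟩
    set R := sInf T with hR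
    have hR0 : 0 < R := hr.trans_le (le_csInf hTne fun s hs => (hTr s hs).le)
    have hbelow : ∀ s ∈ Ioo 0 R, wronskian U D V E s < 0 := fun s hs => by
      by_contra hle
      exact absurd (csInf_le hTbdd (show s ∈ T from ⟨hs.1, not_lt.1 hle⟩)) (not_le.2 hs.2)
    have hcR := (hdw R hR0).continuousAt
    have hwR : wronskian U D V E R = 0 := by
      refine le_antisymm (le_of_tendsto (hcR.tendsto.mono_left (nhdsWithin_le_nhds (s := Iio R)))
        ?_) ?_
      · filter_upwards [Ioo_mem_nhdsLT hR0] with s hs using (hbelow s hs).le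
      · by_contra hlt
        obtain ⟨ε, hε, hball⟩ := Metric.eventually_nhds_iff.1
          (hcR.eventually (gt_mem_nhds (not_le.1 hlt)))
        obtain ⟨t, ht, htR⟩ := exists_lt_of_csInf_lt hTne (show sInf T < R + ε by linarith)
        have h1 : R ≤ t := csInf_le hTbdd ht
        have := hball (y := t) (by rw [Real.dist_eq, abs_lt]; constructor <;> linarith)
        exact absurd ht.2 (not_le.2 this)
    -- The quotient decreases up to `R`. Were it still at least `1` at `R`, `W` would decrease on
    -- all of `(0, R)` and could not return to zero.
    have hqR : V R / U R < 1 := by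
      by_contra hge
      have hanti : StrictAntiOn (fun s => V s / U s) (Ioc 0 R) := by
        refine strictAntiOn_of_deriv_neg (convex_Ioc 0 R)
          (fun s hs => (h.hasDerivAt_div h' hs.1).continuousAt.continuousWithinAt) ?_
        rw [interior_Ioc]
        intro x hx
        have h1 := h.pos x hx.1
        have hx0 := hx.1
        rw [(h.hasDerivAt_div h' hx.1).deriv]
        exact div_neg_of_neg_of_pos (hbelow x hx) (by positivity)
      have := neg_of_deriv_neg_of_tendsto hdw (r := R) (fun t ht => hwneg t ht.1
        ((not_lt.1 hge).trans_lt (hanti ⟨ht.1, ht.2.le⟩ ⟨hR0, le_rfl⟩ ht.2))) hw ⟨hR0, le_rfl⟩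
      linarith
    have hXneg := neg_of_deriv_neg_of_tendsto (r := R) hX
        (fun t ht => hX' t ht.1 (hbelow t ht)) hX0 ⟨hR0, le_rfl⟩
    rw [h.pohozaev_comparison_eq h' hR0, hwR] at hXneg
    have hUR := h.pos R hR0
    have hVR := h'.pos R hR0
    -- Since `p + 1 ≥ 2` and the quotient is below `1`, the one term that survives at a zero of `W`
    -- is nonnegative, against `hXneg`.
    have h1 : (V R / U R) ^ (p + 1) ≤ (V R / U R) ^ (2 : ℝ) :=
      Real.rpow_le_rpow_of_exponent_ge (by positivity) hqR.le (by linarith)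
    rw [Real.rpow_two] at h1
    have h2 : V R ^ (p + 1) ≤ (V R / U R) ^ 2 * U R ^ (p + 1) := by
      rw [h.rpow_eq_div_mul h' hR0 (p + 1)]
      gcongr
    have h3 : 0 ≤ R ^ (-(2 / (p + 3))) *
        (R / (p + 1) * ((V R / U R) ^ 2 * U R ^ (p + 1) - V R ^ (p + 1))) := by
      have : 0 ≤ (V R / U R) ^ 2 * U R ^ (p + 1) - V R ^ (p + 1) := by linarith
      have : 0 < p + 1 := by linarith
      positivity
    simp only [ne_eq, OfNat.ofNat_ne_zero, not_false_eq_true, zero_pow, mul_zero, zero_div,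
      neg_zero, zero_mul, sub_zero, zero_add] at hXneg
    linarith

/-- Two positive profiles satisfying the symmetric pairing identity coincide. -/
theorem eq_of_integral_eq (h : IsProfile p lam U D) (h' : IsProfile p lam V E)
    (hp : 1 < p) (hlam : 0 < lam)
    (hint : IntegrableOn (fun s => V s * U s ^ p) (Ioi 0))
    (hint' : IntegrableOn (fun s => U s * V s ^ p) (Ioi 0))
    (heq : ∫ s in Ioi 0, V s * U s ^ p = ∫ s in Ioi 0, U s * V s ^ p) :
    ∀ s > 0, U s = V s := by
  have hw := h.tendsto_wronskian_nhdsGT h' hp hint hint' heq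
  have hw' := h'.tendsto_wronskian_nhdsGT h hp hint' hint heq.symm
  obtain ⟨l, hl0, hl⟩ := h.exists_pos_tendsto_div h' hp hw
  have hinv : Tendsto (fun s => U s / V s) (𝓝[>] 0) (𝓝 l⁻¹) :=
    (hl.inv₀ hl0.ne').congr fun s => inv_div _ _
  rcases lt_trichotomy l 1 with h1 | rfl | h1
  · exact absurd ((one_lt_inv₀ hl0).2 h1) (h'.not_one_lt_of_tendsto_div h hp hlam hw' hinv)
  · exact h.eq_of_tendsto_div_one h' hp hw hl
  · exact absurd h1 (h.not_one_lt_of_tendsto_div h' hp hlam hw hl)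

end IsProfile

end Profile

/-! ### The Macdonald function -/

section Macdonald

lemma le_cosh (t : ℝ) : t ≤ Real.cosh t := by
  rcases le_total 0 t with h | h
  · exact (Real.self_le_sinh_iff.2 h).trans (Real.sinh_lt_cosh t).le
  · exact h.trans (Real.cosh_pos t).le

/-- The moment `∫₀^∞ coshⁿ t exp (-z cosh t) dt`. -/
def coshMoment (n : ℕ) (z : ℝ) : ℝ :=
  ∫ t in Ioi (0 : ℝ), Real.cosh t ^ n * Real.exp (-z * Real.cosh t)

lemma coshMoment_zero (z : ℝ) : coshMoment 0 z = besselK0 z := by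
  simp [coshMoment, besselK0]

/-- Half of the exponent absorbs the power of `cosh`; the other half decays exponentially because
`cosh t ≥ t`. -/
lemma cosh_pow_mul_exp_le (n : ℕ) {z : ℝ} (hz : 0 < z) (t : ℝ) :
    Real.cosh t ^ n * Real.exp (-z * Real.cosh t) ≤
      n.factorial * (2 / z) ^ n * Real.exp (-(z / 2) * t) := by
  have hc := Real.cosh_pos t
  have h1 := Real.pow_div_factorial_le_exp (x := z / 2 * Real.cosh t) (by positivity) n
  rw [div_le_iff₀ (by positivity)] at h1
  have h2 : Real.cosh t ^ n = (2 / z) ^ n * (z / 2 * Real.cosh t) ^ n := by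
    rw [← mul_pow]; congr 1; field_simp
  have h3 : Real.exp (-z * Real.cosh t) =
      Real.exp (-(z / 2 * Real.cosh t)) * Real.exp (-(z / 2) * Real.cosh t) := by
    rw [← Real.exp_add]; congr 1; ring
  have h4 : Real.exp (-(z / 2) * Real.cosh t) ≤ Real.exp (-(z / 2) * t) := by
    apply Real.exp_le_exp.2
    nlinarith [le_cosh t]
  calc Real.cosh t ^ n * Real.exp (-z * Real.cosh t)
      ≤ (2 / z) ^ n * (Real.exp (z / 2 * Real.cosh t) * n.factorial) *
        (Real.exp (-(z / 2 * Real.cosh t)) * Real.exp (-(z / 2) * t)) := by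
        rw [h2, h3]; gcongr
    _ = n.factorial * (2 / z) ^ n * Real.exp (-(z / 2) * t) *
        (Real.exp (z / 2 * Real.cosh t) * Real.exp (-(z / 2 * Real.cosh t))) := by ring
    _ = _ := by rw [← Real.exp_add, add_neg_cancel, Real.exp_zero, mul_one]

lemma integrableOn_cosh_pow_mul_exp (n : ℕ) {z : ℝ} (hz : 0 < z) :
    IntegrableOn (fun t => Real.cosh t ^ n * Real.exp (-z * Real.cosh t)) (Ioi 0) := by
  refine ((exp_neg_integrableOn_Ioi 0 (half_pos hz)).const_mul
    (n.factorial * (2 / z) ^ n)).mono' (by fun_prop) (Eventually.of_forall fun t => ?_)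
  have := Real.cosh_pos t
  rw [Real.norm_of_nonneg (by positivity)]
  exact cosh_pow_mul_exp_le n hz t

lemma hasDerivAt_coshMoment (n : ℕ) {z : ℝ} (hz : 0 < z) :
    HasDerivAt (coshMoment n) (-coshMoment (n + 1) z) z := by
  have := (hasDerivAt_integral_of_dominated_loc_of_deriv_le (μ := volume.restrict (Ioi 0))
    (F := fun z t => Real.cosh t ^ n * Real.exp (-z * Real.cosh t))
    (F' := fun z t => -(Real.cosh t ^ (n + 1) * Real.exp (-z * Real.cosh t)))
    (bound := fun t => Real.cosh t ^ (n + 1) * Real.exp (-(z / 2) * Real.cosh t))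
    (x₀ := z) (s := Ioi (z / 2)) (Ioi_mem_nhds (by linarith))
    (Eventually.of_forall fun z => by fun_prop) (integrableOn_cosh_pow_mul_exp n hz)
    (by fun_prop) (Eventually.of_forall fun t x hx => ?_)
    (integrableOn_cosh_pow_mul_exp (n + 1) (half_pos hz))
    (Eventually.of_forall fun t x hx => ?_)).2
  · rw [integral_neg] at this
    exact this
  · have h1 := Real.cosh_pos t
    have hx : z / 2 < x := hx
    rw [norm_neg, Real.norm_of_nonneg (by positivity)]
    gcongr
  · have h1 : HasDerivAt (fun x : ℝ => -x * Real.cosh t) (-1 * Real.cosh t) x :=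
      (hasDerivAt_neg x).mul_const _
    convert! (h1.exp.const_mul (Real.cosh t ^ n)) using 1
    ring

lemma hasDerivAt_besselK0 {z : ℝ} (hz : 0 < z) :
    HasDerivAt besselK0 (-coshMoment 1 z) z := by
  have : besselK0 = coshMoment 0 := funext fun z => (coshMoment_zero z).symm
  rw [this]
  exact hasDerivAt_coshMoment 0 hz

/-- Bessel's equation `z K₀'' + K₀' = z K₀`, since the moments of order one and two are `-K₀'` and
`K₀''`. It comes from integrating the derivative of `sinh t exp (-z cosh t)`, whose boundary values
vanish. -/
lemma coshMoment_identity {z : ℝ} (hz : 0 < z) :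
    coshMoment 1 z = z * (coshMoment 2 z - coshMoment 0 z) := by
  have h0 := integrableOn_cosh_pow_mul_exp 0 hz
  have h1 := integrableOn_cosh_pow_mul_exp 1 hz
  have h2 := integrableOn_cosh_pow_mul_exp 2 hz
  have hd : ∀ t ∈ Ici (0 : ℝ), HasDerivAt (fun t => Real.sinh t * Real.exp (-z * Real.cosh t))
      (Real.cosh t ^ 1 * Real.exp (-z * Real.cosh t)
        - z * (Real.cosh t ^ 2 * Real.exp (-z * Real.cosh t)
          - Real.cosh t ^ 0 * Real.exp (-z * Real.cosh t))) t := by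
    intro t _
    convert! (Real.hasDerivAt_sinh t).mul (((Real.hasDerivAt_cosh t).const_mul (-z)).exp) using 1
    have := Real.cosh_sq t
    rw [pow_one, pow_zero, this]
    ring
  have hlim : Tendsto (fun t => Real.sinh t * Real.exp (-z * Real.cosh t)) atTop (𝓝 0) := by
    have h3 : Tendsto (fun t : ℝ => Nat.factorial 1 * (2 / z) ^ 1 * Real.exp (-(z / 2) * t))
        atTop (𝓝 0) := by
      have : Tendsto (fun t : ℝ => -(z / 2) * t) atTop atBot :=
        tendsto_id.const_mul_atTop_of_neg (by linarith)
      have h4 := (Real.tendsto_exp_atBot.comp this).const_mul (Nat.factorial 1 * (2 / z) ^ 1)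
      rwa [mul_zero] at h4
    refine squeeze_zero' ?_ (Eventually.of_forall fun t => ?_) h3
    · filter_upwards [eventually_ge_atTop 0] with t ht
      have := Real.sinh_nonneg_iff.2 ht
      positivity
    · refine le_trans ?_ (cosh_pow_mul_exp_le 1 hz t)
      rw [pow_one]
      have := Real.sinh_lt_cosh t
      gcongr
  have := integral_Ioi_of_hasDerivAt_of_tendsto' hd (h1.sub ((h2.sub h0).const_mul z)) hlim
  have h20 : IntegrableOn (fun t => Real.cosh t ^ 2 * Real.exp (-z * Real.cosh t)
      - Real.cosh t ^ 0 * Real.exp (-z * Real.cosh t)) (Ioi 0) := h2.sub h0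
  rw [integral_sub h1 (h20.const_mul z), integral_const_mul, integral_sub h2 h0] at this
  simp only [Real.sinh_zero, zero_mul, sub_zero] at this
  unfold coshMoment
  linarith

lemma hasDerivAt_mul_coshMoment_one {z : ℝ} (hz : 0 < z) :
    HasDerivAt (fun z => -(z * coshMoment 1 z)) (z * besselK0 z) z := by
  convert! ((hasDerivAt_id z).mul (hasDerivAt_coshMoment 1 hz)).neg using 1
  have := coshMoment_identity hz
  rw [← coshMoment_zero]
  simp only [id]
  linarith

lemma besselK0_nonneg (z : ℝ) : 0 ≤ besselK0 z :=
  integral_nonneg fun _ => (Real.exp_pos _).le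

/-- Split the exponent in two: `cosh t ≥ 1` yields the decay in `z`, while `exp (-x) ≤ 1 / √x` and
`cosh t ≥ exp t / 2` yield the factor `1 / √z` and integrability in `t`. -/
lemma exists_besselK0_le : ∃ C > 0, ∀ z > 0, besselK0 z ≤ C / √z * Real.exp (-z / 2) := by
  have hint : IntegrableOn (fun t => √2 * Real.exp (-(1 / 2) * t)) (Ioi 0) :=
    (exp_neg_integrableOn_Ioi 0 (by norm_num : (0 : ℝ) < 1 / 2)).const_mul _
  have hnn : 0 ≤ ∫ t in Ioi (0 : ℝ), √2 * Real.exp (-(1 / 2) * t) :=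
    integral_nonneg fun t => by positivity
  refine ⟨√2 * (∫ t in Ioi (0 : ℝ), √2 * Real.exp (-(1 / 2) * t)) + 1, by positivity,
    fun z hz => ?_⟩
  have hsz := Real.sqrt_pos.2 hz
  have hpt : ∀ t, Real.exp (-z * Real.cosh t) ≤
      √2 / √z * Real.exp (-z / 2) * (√2 * Real.exp (-(1 / 2) * t)) := by
    intro t
    have hc := Real.one_le_cosh t
    have h1 : Real.exp (-z * Real.cosh t) ≤
        Real.exp (-z / 2) * Real.exp (-(z / 2 * Real.cosh t)) := by
      rw [← Real.exp_add]
      apply Real.exp_le_exp.2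
      nlinarith
    have h2 : Real.exp (-(z / 2 * Real.cosh t)) ≤ 1 / √(z / 2 * Real.cosh t) := by
      have hx : 0 < z / 2 * Real.cosh t := by positivity
      have h3 := Real.sqrt_pos.2 hx
      rw [Real.exp_neg, inv_eq_one_div]
      refine one_div_le_one_div_of_le h3 ?_
      have h4 := Real.add_one_le_exp (z / 2 * Real.cosh t)
      nlinarith [Real.sq_sqrt hx.le, sq_nonneg (√(z / 2 * Real.cosh t) - 1)]
    have h5 : √(z / 2 * (Real.exp t / 2)) ≤ √(z / 2 * Real.cosh t) := by
      apply Real.sqrt_le_sqrt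
      rw [Real.cosh_eq]
      have := Real.exp_pos (-t)
      gcongr
      linarith
    have h6 : √(z / 2 * (Real.exp t / 2)) = √z * Real.exp (1 / 2 * t) / (√2 * √2) := by
      have : Real.exp t = Real.exp (1 / 2 * t) ^ 2 := by
        rw [← Real.exp_nat_mul]; congr 1; push_cast; ring
      rw [Real.mul_self_sqrt zero_le_two, this, show z / 2 * (Real.exp (1 / 2 * t) ^ 2 / 2) =
        z * (Real.exp (1 / 2 * t) / 2) ^ 2 by ring, Real.sqrt_mul hz.le,
        Real.sqrt_sq (by positivity)]
      ring
    have h7 : 0 < √z * Real.exp (1 / 2 * t) / (√2 * √2) := by positivity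
    calc Real.exp (-z * Real.cosh t)
        ≤ Real.exp (-z / 2) * (1 / √(z / 2 * Real.cosh t)) := h1.trans (by gcongr)
      _ ≤ Real.exp (-z / 2) * (1 / (√z * Real.exp (1 / 2 * t) / (√2 * √2))) := by
          rw [h6] at h5; gcongr
      _ = _ := by
          rw [neg_mul, Real.exp_neg (1 / 2 * t)]
          field_simp
  calc besselK0 z ≤ ∫ t in Ioi (0 : ℝ),
        √2 / √z * Real.exp (-z / 2) * (√2 * Real.exp (-(1 / 2) * t)) := by
        refine integral_mono ?_ (hint.const_mul _) hpt
        have := integrableOn_cosh_pow_mul_exp 0 hz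
        simp only [pow_zero, one_mul] at this
        exact this
    _ = √2 * (∫ t in Ioi (0 : ℝ), √2 * Real.exp (-(1 / 2) * t)) / √z * Real.exp (-z / 2) := by
        rw [integral_const_mul]; ring
    _ ≤ _ := by gcongr; linarith

/-- The profile of the Green function in the variable `s = |x|²`. -/
def greenProfile (lam s : ℝ) : ℝ := (2 * Real.pi)⁻¹ * besselK0 (√lam * √s)

/-- The flux `s Γ'(s)` of the profile of the Green function. -/
def greenFlux (lam s : ℝ) : ℝ :=
  (2 * Real.pi)⁻¹ * (-((√lam * √s) * coshMoment 1 (√lam * √s)) / 2)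

lemma green_eq_greenProfile (lam : ℝ) (x : Plane) : green lam x = greenProfile lam (‖x‖ ^ 2) := by
  rw [green, greenProfile, Real.sqrt_sq (norm_nonneg _)]

variable {lam : ℝ}

lemma hasDerivAt_greenProfile (hlam : 0 < lam) {s : ℝ} (hs : 0 < s) :
    HasDerivAt (greenProfile lam) (greenFlux lam s / s) s := by
  have h1 := Real.sqrt_pos.2 hlam
  have h2 := Real.sqrt_pos.2 hs
  have h3 := (Real.hasDerivAt_sqrt hs.ne').const_mul √lam
  convert! ((hasDerivAt_besselK0 (z := √lam * √s) (by positivity)).comp s h3).const_mul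
    (2 * Real.pi)⁻¹ using 1
  rw [greenFlux]
  nth_rewrite 3 [← Real.mul_self_sqrt hs.le]
  field_simp

lemma hasDerivAt_greenFlux (hlam : 0 < lam) {s : ℝ} (hs : 0 < s) :
    HasDerivAt (greenFlux lam) (lam * greenProfile lam s / 4) s := by
  have h1 := Real.sqrt_pos.2 hlam
  have h2 := Real.sqrt_pos.2 hs
  have h3 := (Real.hasDerivAt_sqrt hs.ne').const_mul √lam
  convert! (((hasDerivAt_mul_coshMoment_one (z := √lam * √s) (by positivity)).comp s h3).div_const
    2).const_mul (2 * Real.pi)⁻¹ using 1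
  rw [greenProfile]
  nth_rewrite 1 [← Real.mul_self_sqrt hlam.le]
  field_simp
  ring

lemma continuousOn_greenProfile (hlam : 0 < lam) : ContinuousOn (greenProfile lam) (Ioi 0) :=
  fun _ hs => (hasDerivAt_greenProfile hlam hs).continuousAt.continuousWithinAt

/-- The square of the bound on `besselK0` is, up to a constant, the derivative of `exp (-√λ √s)`. -/
lemma integrableOn_greenProfile_sq (hlam : 0 < lam) :
    IntegrableOn (fun s => greenProfile lam s ^ 2) (Ioi 0) := by
  obtain ⟨C, hC, hK⟩ := exists_besselK0_le
  have hl := Real.sqrt_pos.2 hlam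
  have hint : IntegrableOn (fun s => Real.exp (-(√lam * √s)) * (-(√lam * (1 / (2 * √s)))))
      (Ioi 0) := by
    refine integrableOn_Ioi_deriv_of_nonpos (g := fun s => Real.exp (-(√lam * √s))) (l := 0)
      ?_ ?_ ?_ ?_
    · exact Continuous.continuousWithinAt (by fun_prop)
    · intro _ hs
      exact ((Real.hasDerivAt_sqrt (ne_of_gt hs)).const_mul √lam).neg.exp
    · intro s hs
      have : 0 < √lam * (1 / (2 * √s)) := by
        have := Real.sqrt_pos.2 hs
        positivity
      exact mul_nonpos_of_nonneg_of_nonpos (Real.exp_pos _).le (by linarith)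
    · refine Real.tendsto_exp_neg_atTop_nhds_zero.comp ?_
      exact Real.tendsto_sqrt_atTop.const_mul_atTop hl
  refine (hint.const_mul (-((2 * Real.pi)⁻¹ ^ 2 * C ^ 2 * 2 / (√lam * √lam)))).mono'
    (((continuousOn_greenProfile hlam).pow 2).aestronglyMeasurable measurableSet_Ioi) ?_
  refine (ae_restrict_mem measurableSet_Ioi).mono fun s hs => ?_
  have h2 := Real.sqrt_pos.2 hs
  have h3 := hK (√lam * √s) (by positivity)
  have h4 := besselK0_nonneg (√lam * √s)
  have h5 : 0 < √lam * √s := by positivity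
  have h6 := Real.mul_self_sqrt h5.le
  have h7 : Real.exp (-(√lam * √s) / 2) ^ 2 = Real.exp (-(√lam * √s)) := by
    rw [← Real.exp_nat_mul]; congr 1; push_cast; ring
  rw [Real.norm_of_nonneg (by positivity), greenProfile, mul_pow]
  calc (2 * Real.pi)⁻¹ ^ 2 * besselK0 (√lam * √s) ^ 2
      ≤ (2 * Real.pi)⁻¹ ^ 2 * (C / √(√lam * √s) * Real.exp (-(√lam * √s) / 2)) ^ 2 := by gcongr
    _ = (2 * Real.pi)⁻¹ ^ 2 * (C ^ 2 / (√lam * √s) * Real.exp (-(√lam * √s))) := by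
        rw [mul_pow, div_pow, sq √(√lam * √s), h6, h7]
    _ = _ := by field_simp

end Macdonald

/-! ### Weak solutions on the half-line -/

section WeakSolution

/-- Smooth functions with compact support in the open half-line. -/
structure IsTest (θ : ℝ → ℝ) : Prop where
  contDiff : ContDiff ℝ (⊤ : ℕ∞) θ
  exists_eq_zero : ∃ a b : ℝ, 0 < a ∧ a < b ∧ ∀ s ∉ Icc a b, θ s = 0

namespace IsTest

variable {θ η : ℝ → ℝ}

lemma of_tsupport (hθ : ContDiff ℝ (⊤ : ℕ∞) θ) (hc : HasCompactSupport θ)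
    (hs : tsupport θ ⊆ Ioi 0) : IsTest θ := by
  refine ⟨hθ, ?_⟩
  rcases (tsupport θ).eq_empty_or_nonempty with he | hne
  · exact ⟨1, 2, one_pos, one_lt_two, fun s _ => image_eq_zero_of_notMem_tsupport (by simp [he])⟩
  · obtain ⟨a, ha, hmin⟩ := hc.exists_isMinOn hne continuousOn_id
    obtain ⟨b, hb, hmax⟩ := hc.exists_isMaxOn hne continuousOn_id
    have ha0 : 0 < a := hs ha
    have hab : a ≤ b := hmin hb
    refine ⟨a, b + 1, ha0, by linarith, fun s hs => ?_⟩
    refine image_eq_zero_of_notMem_tsupport fun h => hs ⟨hmin h, ?_⟩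
    have : s ≤ b := hmax h
    linarith

lemma deriv (hθ : IsTest θ) : IsTest (deriv θ) := by
  obtain ⟨a, b, ha, hab, h0⟩ := hθ.exists_eq_zero
  refine ⟨contDiff_infty_iff_deriv.1 hθ.contDiff |>.2, a, b, ha, hab, fun s hs => ?_⟩
  have : θ =ᶠ[𝓝 s] fun _ => 0 := by
    filter_upwards [isClosed_Icc.isOpen_compl.mem_nhds hs] with t ht using h0 t ht
  rw [this.deriv_eq, deriv_const]

lemma hasCompactSupport (hθ : IsTest θ) : HasCompactSupport θ := by
  obtain ⟨a, b, ha, hab, h0⟩ := hθ.exists_eq_zero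
  exact HasCompactSupport.intro isCompact_Icc h0

lemma hasDerivAt (hθ : IsTest θ) (s : ℝ) : HasDerivAt θ (_root_.deriv θ s) s :=
  (hθ.contDiff.differentiable (by simp) s).hasDerivAt

lemma continuous (hθ : IsTest θ) : Continuous θ := hθ.contDiff.continuous

lemma integrable (hθ : IsTest θ) : Integrable θ :=
  hθ.continuous.integrable_of_hasCompactSupport hθ.hasCompactSupport

lemma contDiff_mul (hθ : IsTest θ) {g : ℝ → ℝ} (hg : ContDiff ℝ (⊤ : ℕ∞) g) :
    IsTest (fun s => g s * θ s) := by
  obtain ⟨a, b, ha, hab, h0⟩ := hθ.exists_eq_zero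
  exact ⟨hg.mul hθ.contDiff, a, b, ha, hab, fun s hs => by rw [h0 s hs, mul_zero]⟩

lemma sub (hθ : IsTest θ) (hη : IsTest η) : IsTest (fun s => θ s - η s) := by
  obtain ⟨a, b, ha, hab, h0⟩ := hθ.exists_eq_zero
  obtain ⟨a', b', ha', hab', h0'⟩ := hη.exists_eq_zero
  refine ⟨hθ.contDiff.sub hη.contDiff, min a a', max b b', lt_min ha ha',
    (min_le_left _ _).trans_lt (hab.trans_le (le_max_left _ _)), fun s hs => ?_⟩
  rw [h0, h0', sub_zero]
  · exact fun h => hs ⟨(min_le_right _ _).trans h.1, h.2.trans (le_max_right _ _)⟩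
  · exact fun h => hs ⟨(min_le_left _ _).trans h.1, h.2.trans (le_max_left _ _)⟩

lemma div_id (hθ : IsTest θ) : IsTest (fun s => θ s / s) := by
  obtain ⟨a, b, ha, hab, h0⟩ := hθ.exists_eq_zero
  refine ⟨contDiff_iff_contDiffAt.2 fun s => ?_, a, b, ha, hab, fun s hs => by
    rw [h0 s hs, zero_div]⟩
  rcases lt_or_ge s a with hs | hs
  · refine (contDiffAt_const (c := (0 : ℝ))).congr_of_eventuallyEq ?_
    filter_upwards [Iio_mem_nhds hs] with t ht
    rw [h0 t fun h => absurd h.1 (not_le.2 ht), zero_div]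
  · exact hθ.contDiff.contDiffAt.div contDiffAt_id (ha.trans_le hs).ne'

/-- A test function of mean zero is the derivative of a test function. -/
lemma exists_deriv_eq (hθ : IsTest θ) (hint : ∫ s, θ s = 0) :
    ∃ η, IsTest η ∧ _root_.deriv η = θ := by
  obtain ⟨a, b, ha, hab, h0⟩ := hθ.exists_eq_zero
  have hd : ∀ s, HasDerivAt (fun s => ∫ t in (0 : ℝ)..s, θ t) (θ s) s := fun s =>
    hθ.continuous.integral_hasStrictDerivAt 0 s |>.hasDerivAt
  have hderiv : _root_.deriv (fun s => ∫ t in (0 : ℝ)..s, θ t) = θ :=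
    funext fun s => (hd s).deriv
  refine ⟨fun s => ∫ t in (0 : ℝ)..s, θ t, ⟨?_, a, b, ha, hab, fun s hs => ?_⟩, hderiv⟩
  · refine contDiff_infty_iff_deriv.2 ⟨fun s => (hd s).differentiableAt, ?_⟩
    rw [hderiv]; exact hθ.contDiff
  · rcases lt_or_ge s a with h1 | h1
    · refine intervalIntegral.integral_zero_ae (Eventually.of_forall fun t ht => h0 t fun h => ?_)
      exact absurd (h.1.trans ht.2) (not_le.2 (max_lt ha h1))
    · have h2 : b < s := not_le.1 fun h => hs ⟨h1, h⟩
      rw [intervalIntegral.integral_of_le (ha.le.trans h1)]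
      refine Eq.trans ?_ hint
      exact setIntegral_eq_integral_of_forall_compl_eq_zero fun t ht => h0 t fun h =>
        ht ⟨ha.trans_le h.1, h.2.trans h2.le⟩

lemma integrable_mul (hθ : IsTest θ) {k : ℝ → ℝ} (hk : LocallyIntegrableOn k (Ioi 0)) :
    Integrable (fun s => k s * θ s) := by
  obtain ⟨a, b, ha, hab, h0⟩ := hθ.exists_eq_zero
  have h1 : IntegrableOn (fun s => k s * θ s) (Icc a b) :=
    (hk.integrableOn_compact_subset (fun x hx => ha.trans_le hx.1) isCompact_Icc).mul_continuousOn
      hθ.continuous.continuousOn isCompact_Icc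
  refine (integrableOn_iff_integrable_of_support_subset fun s hs => ?_).1 h1
  by_contra h
  exact hs (by simp only [h0 s h, mul_zero])

end IsTest

lemma exists_isTest_integral_eq_one : ∃ χ, IsTest χ ∧ ∫ s, χ s = 1 := by
  let f : ContDiffBump (2 : ℝ) := ⟨1 / 2, 1, by norm_num, by norm_num⟩
  refine ⟨f.normed volume, IsTest.of_tsupport f.contDiff_normed f.hasCompactSupport_normed ?_,
    f.integral_normed⟩
  rw [f.tsupport_normed_eq]
  intro x hx
  rw [Metric.mem_closedBall, Real.dist_eq, abs_le] at hx
  have : f.rOut = 1 := rfl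
  rw [this] at hx
  exact mem_Ioi.2 (by linarith [hx.1])

/-- Integration by parts against the primitive of a locally integrable function. -/
lemma integral_primitive_mul_deriv {k : ℝ → ℝ} (hk : LocallyIntegrableOn k (Ioi 0))
    {η : ℝ → ℝ} (hη : IsTest η) :
    ∫ s, (∫ t in (1 : ℝ)..s, k t) * deriv η s = -∫ s, k s * η s := by
  obtain ⟨a, b, ha, hab, h0⟩ := hη.exists_eq_zero
  set A := min (a / 2) 1 with hA
  set B := max (b + 1) 1 with hB
  have hA0 : 0 < A := lt_min (half_pos ha) one_pos
  have hA1 : A < a := (min_le_left _ _).trans_lt (half_lt_self ha)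
  have hB1 : b < B := (lt_add_one b).trans_le (le_max_left _ _)
  have hAB : A ≤ B := by linarith
  have h1mem : (1 : ℝ) ∈ uIcc A B := by
    rw [uIcc_of_le hAB]; exact ⟨min_le_right _ _, le_max_right _ _⟩
  have hki : IntervalIntegrable k volume A B := by
    rw [intervalIntegrable_iff_integrableOn_Icc_of_le hAB]
    exact hk.integrableOn_compact_subset (fun x hx => hA0.trans_le hx.1) isCompact_Icc
  have hout : ∀ s ∉ Ioc A B, η s = 0 := fun s hs => h0 s fun h =>
    hs ⟨hA1.trans_le h.1, h.2.trans hB1.le⟩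
  have hout' : ∀ s ∉ Ioc A B, deriv η s = 0 := fun s hs => by
    have hs' : s ∉ Icc a b := fun h => hs ⟨hA1.trans_le h.1, h.2.trans hB1.le⟩
    have : η =ᶠ[𝓝 s] fun _ => 0 := by
      filter_upwards [isClosed_Icc.isOpen_compl.mem_nhds hs'] with t ht using h0 t ht
    rw [this.deriv_eq, deriv_const]
  have hconv : ∀ f g : ℝ → ℝ, (∀ s ∉ Ioc A B, g s = 0) →
      ∫ s, f s * g s = ∫ s in A..B, f s * g s := fun f g hg => by
    rw [intervalIntegral.integral_of_le hAB]
    exact (setIntegral_eq_integral_of_forall_compl_eq_zero fun s hs => by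
      rw [hg s hs, mul_zero]).symm
  have hac := hki.absolutelyContinuousOnInterval_intervalIntegral h1mem
  have hηac : AbsolutelyContinuousOnInterval η A B :=
    (hη.contDiff.of_le (by exact_mod_cast le_top)).contDiffOn.absolutelyContinuousOnInterval
  have h2 := hac.integral_mul_deriv_eq_deriv_mul hηac
  rw [hout A fun h => lt_irrefl _ h.1, h0 B fun h => absurd h.2 (not_le.2 hB1)] at h2
  rw [hconv _ _ hout', hconv _ _ hout, h2, mul_zero, mul_zero, sub_zero, zero_sub]
  congr 1
  refine intervalIntegral.integral_congr_ae ?_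
  filter_upwards [hki.ae_hasDerivAt_integral] with s hs hs'
  rw [(hs (uIoc_subset_uIcc hs') 1 h1mem).deriv]

/-- The du Bois-Reymond lemma: subtracting a multiple of a fixed bump `χ` of unit integral makes any
test function mean zero, and the constant is `∫ f χ`. -/
lemma ae_eq_const_of_integral_mul_eq_zero {f : ℝ → ℝ} (hf : LocallyIntegrableOn f (Ioi 0))
    (h : ∀ θ, IsTest θ → ∫ s, θ s = 0 → ∫ s, f s * θ s = 0) :
    ∃ A : ℝ, ∀ᵐ s, s ∈ Ioi (0 : ℝ) → f s = A := by
  obtain ⟨χ, hχ, hχ1⟩ := exists_isTest_integral_eq_one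
  refine ⟨∫ s, f s * χ s, ?_⟩
  set A := ∫ s, f s * χ s with hA
  have hc : LocallyIntegrableOn (fun _ : ℝ => A) (Ioi 0) :=
    (locallyIntegrable_const A).locallyIntegrableOn _
  have := isOpen_Ioi.ae_eq_zero_of_integral_contDiff_smul_eq_zero (hf.sub hc) (fun g hg hgc hgs => ?_)
  · filter_upwards [this] with s hs hs'
    have := hs hs'
    rwa [Pi.sub_apply, sub_eq_zero] at this
  · have hgt := IsTest.of_tsupport hg hgc hgs
    have h1 := h _ (hgt.sub (hχ.contDiff_mul (contDiff_const (c := ∫ s, g s)))) (by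
      rw [integral_sub hgt.integrable (hχ.integrable.const_mul _), integral_const_mul, hχ1, mul_one,
        sub_self])
    have h2 : ∀ s, f s * (g s - (∫ s, g s) * χ s) = f s * g s - (∫ s, g s) * (f s * χ s) :=
      fun s => by ring
    simp only [h2] at h1
    rw [integral_sub (hgt.integrable_mul hf) ((hχ.integrable_mul hf).const_mul _),
      integral_const_mul] at h1
    have h3 : ∀ s, g s • (f - fun _ : ℝ => A) s = f s * g s - A * g s := fun s => by
      simp only [smul_eq_mul, Pi.sub_apply]; ring
    simp only [h3]
    rw [integral_sub (hgt.integrable_mul hf) (hgt.integrable.const_mul _), integral_const_mul]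
    linarith

/-- Weak solutions of `4 (s U')' = k` are `C¹` with absolutely continuous flux. -/
lemma exists_flux_of_weak {U k : ℝ → ℝ} (hU : LocallyIntegrableOn U (Ioi 0))
    (hk : LocallyIntegrableOn k (Ioi 0))
    (h : ∀ θ, IsTest θ → ∫ s, U s * (4 * deriv (fun t => t * deriv θ t) s) = ∫ s, k s * θ s) :
    ∃ W D : ℝ → ℝ, (∀ᵐ s, s ∈ Ioi (0 : ℝ) → U s = W s) ∧
      (∀ s > 0, HasDerivAt W (D s / s) s) ∧
      ∃ B : ℝ, ∀ s > 0, D s = ((∫ t in (1 : ℝ)..s, k t) - B) / 4 := by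
  obtain ⟨χ, hχ, hχ1⟩ := exists_isTest_integral_eq_one
  set K : ℝ → ℝ := fun s => ∫ t in (1 : ℝ)..s, k t with hK
  have hKc : ContinuousOn K (Ioi 0) := by
    intro s hs
    have hs : 0 < s := hs
    have hA0 : 0 < min (s / 2) 1 := lt_min (half_pos hs) one_pos
    have hAs : min (s / 2) 1 < s := (min_le_left _ _).trans_lt (half_lt_self hs)
    have hsB : s < max (s + 1) 1 := (lt_add_one s).trans_le (le_max_left _ _)
    have hAB := (hAs.trans hsB).le
    have hki : IntervalIntegrable k volume (min (s / 2) 1) (max (s + 1) 1) := by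
      rw [intervalIntegrable_iff_integrableOn_Icc_of_le hAB]
      exact hk.integrableOn_compact_subset (fun x hx => hA0.trans_le hx.1) isCompact_Icc
    have hc := intervalIntegral.continuousOn_primitive_interval' hki (a := 1) (by
      rw [uIcc_of_le hAB]; exact ⟨min_le_right _ _, le_max_right _ _⟩)
    rw [uIcc_of_le hAB] at hc
    exact (hc.continuousAt (Icc_mem_nhds hAs hsB)).continuousWithinAt
  have hKl : LocallyIntegrableOn K (Ioi 0) := hKc.locallyIntegrableOn measurableSet_Ioi
  have hdt : ∀ ζ, IsTest ζ → IsTest (fun s => 4 * deriv (fun t => t * ζ t) s) := fun ζ hζ =>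
    (hζ.contDiff_mul contDiff_id).deriv.contDiff_mul contDiff_const
  have hint : ∀ ζ, IsTest ζ → Integrable (fun s => U s * (4 * deriv (fun t => t * ζ t) s)) :=
    fun ζ hζ => (hdt ζ hζ).integrable_mul hU
  have step : ∀ ζ, IsTest ζ → ∫ s, ζ s = 0 →
      ∫ s, U s * (4 * deriv (fun t => t * ζ t) s) = -∫ s, K s * ζ s := by
    intro ζ hζ hζ0
    obtain ⟨η, hη, rfl⟩ := hζ.exists_deriv_eq hζ0
    rw [h η hη, integral_primitive_mul_deriv hk hη, neg_neg]
  -- The constant of the first integration: it removes the mean-zero restriction in `step`, so that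
  -- `4 s U' = K - B` weakly.
  set B := (∫ s, U s * (4 * deriv (fun t => t * χ t) s)) + ∫ s, K s * χ s with hB
  have step2 : ∀ ζ, IsTest ζ → ∫ s, U s * (4 * deriv (fun t => t * ζ t) s) =
      -∫ s, (K s - B) * ζ s := by
    intro ζ hζ
    have hχc := hχ.contDiff_mul (contDiff_const (c := ∫ s, ζ s))
    have h1 := step _ (hζ.sub hχc) (by
      rw [integral_sub hζ.integrable (hχ.integrable.const_mul _), integral_const_mul, hχ1, mul_one,
        sub_self])
    have h2 : ∀ s, U s * (4 * deriv (fun t => t * (ζ t - (∫ s, ζ s) * χ t)) s) =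
        U s * (4 * deriv (fun t => t * ζ t) s)
          - (∫ s, ζ s) * (U s * (4 * deriv (fun t => t * χ t) s)) := by
      intro s
      have e1 := ((hζ.contDiff_mul contDiff_id).hasDerivAt s)
      have e2 := ((hχ.contDiff_mul contDiff_id).hasDerivAt s)
      have e3 := e1.sub (e2.const_mul (∫ s, ζ s))
      have e4 : (fun t => t * (ζ t - (∫ s, ζ s) * χ t)) =
          (fun t => id t * ζ t) - fun t => (∫ s, ζ s) * (id t * χ t) := by
        ext t; simp only [Pi.sub_apply, id]; ring
      rw [e4, e3.deriv]
      simp only [id]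
      ring
    have h3 : ∀ s, K s * (ζ s - (∫ s, ζ s) * χ s) = K s * ζ s - (∫ s, ζ s) * (K s * χ s) :=
      fun s => by ring
    simp only [h2, h3] at h1
    rw [integral_sub (hint ζ hζ) ((hint χ hχ).const_mul _), integral_const_mul,
      integral_sub (hζ.integrable_mul hKl) ((hχ.integrable_mul hKl).const_mul _),
      integral_const_mul] at h1
    have h4 : ∀ s, (K s - B) * ζ s = K s * ζ s - B * ζ s := fun s => by ring
    simp only [h4]
    rw [integral_sub (hζ.integrable_mul hKl) (hζ.integrable.const_mul _), integral_const_mul, hB]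
    linear_combination h1
  set m : ℝ → ℝ := fun s => (K s - B) / s with hm
  have hmc : ContinuousOn m (Ioi 0) :=
    (hKc.sub continuousOn_const).div continuousOn_id fun s hs => ne_of_gt hs
  have hml : LocallyIntegrableOn m (Ioi 0) := hmc.locallyIntegrableOn measurableSet_Ioi
  set Φ : ℝ → ℝ := fun s => ∫ t in (1 : ℝ)..s, m t with hΦ
  have hΦd : ∀ s > 0, HasDerivAt Φ (m s) s := by
    intro s hs
    refine intervalIntegral.integral_hasDerivAt_right ?_ ?_ (hmc.continuousAt (Ioi_mem_nhds hs))
    · refine (hmc.mono fun x hx => ?_).intervalIntegrable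
      exact (lt_min one_pos hs).trans_le hx.1
    · exact hmc.stronglyMeasurableAtFilter isOpen_Ioi s hs
  have hΦc : ContinuousOn Φ (Ioi 0) :=
    fun s hs => (hΦd s hs).continuousAt.continuousWithinAt
  have hΦl : LocallyIntegrableOn Φ (Ioi 0) := hΦc.locallyIntegrableOn measurableSet_Ioi
  have h4U : LocallyIntegrableOn (fun s => 4 * U s) (Ioi 0) := hU.smul (4 : ℝ)
  -- The second integration uses the test function `Ω s / s`, which is admissible because supports
  -- stay away from the origin.
  obtain ⟨A, hA⟩ := ae_eq_const_of_integral_mul_eq_zero (h4U.sub hΦl) (by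
    intro ω hω hω0
    obtain ⟨Ω, hΩ, rfl⟩ := hω.exists_deriv_eq hω0
    have h1 := step2 _ hΩ.div_id
    have h2 := integral_primitive_mul_deriv hml hΩ
    obtain ⟨a, b, ha, hab, h0⟩ := hΩ.exists_eq_zero
    have h3 : (fun t => t * (Ω t / t)) = Ω := by
      ext t
      rcases eq_or_ne t 0 with rfl | ht
      · rw [h0 0 fun h => absurd h.1 (not_le.2 ha), zero_mul]
      · field_simp
    rw [h3] at h1
    have h4 : ∀ s, (K s - B) * (Ω s / s) = m s * Ω s := fun s => by
      simp only [hm]; ring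
    simp only [h4] at h1
    have h5 : ∀ s, ((fun s => 4 * U s) - Φ) s * deriv Ω s =
        U s * (4 * deriv Ω s) - Φ s * deriv Ω s := fun s => by
      simp only [Pi.sub_apply]; ring
    simp only [h5]
    have h6 : Integrable (fun s => U s * (4 * deriv Ω s)) :=
      (hΩ.deriv.contDiff_mul contDiff_const).integrable_mul hU
    rw [integral_sub h6 (hΩ.deriv.integrable_mul hΦl), h1, h2]
    ring)
  refine ⟨fun s => (Φ s + A) / 4, fun s => (K s - B) / 4, ?_, fun s hs => ?_, B, fun s hs => rfl⟩
  · filter_upwards [hA] with s hs hs'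
    have := hs hs'
    simp only [Pi.sub_apply] at this
    linarith
  · convert! ((hΦd s hs).add_const A).div_const 4 using 1
    simp only [hm]; ring

end WeakSolution

/-! ### Radial functions on the plane -/

section Radial

variable {F : Type*} [NormedAddCommGroup F] [NormedSpace ℝ F]

/-- Polar coordinates with `2 π r dr = π ds`. -/
lemma integral_norm_sq (g : ℝ → F) :
    ∫ x : Plane, g (‖x‖ ^ 2) = Real.pi • ∫ s in Ioi (0 : ℝ), g s := by
  have h1 := integral_fun_norm_addHaar (volume : Measure Plane) (fun r => g (r ^ 2))
  have h2 := integral_comp_rpow_Ioi_of_pos (g := g) two_pos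
  have h3 : (volume : Measure Plane).real (Metric.ball 0 1) = Real.pi := by
    simp [Measure.real, Real.pi_pos.le]
  have h4 : ∫ r in Ioi (0 : ℝ), ((2 : ℝ) * r ^ ((2 : ℝ) - 1)) • g (r ^ (2 : ℝ)) =
      (2 : ℝ) • ∫ r in Ioi (0 : ℝ), r • g (r ^ 2) := by
    rw [← integral_smul]
    refine setIntegral_congr_fun measurableSet_Ioi fun r _ => ?_
    norm_num [mul_smul]
  rw [h1, h3, ← h2, h4]
  simp only [finrank_euclideanSpace, Fintype.card_fin, Nat.add_one_sub_one, pow_one]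
  rw [smul_comm, ← Nat.cast_smul_eq_nsmul ℝ 2]
  norm_num

lemma integrable_norm_sq_iff {g : ℝ → F} :
    Integrable (fun x : Plane => g (‖x‖ ^ 2)) ↔ IntegrableOn g (Ioi 0) := by
  rw [integrable_fun_norm_addHaar (volume : Measure Plane) (f := fun r => g (r ^ 2)),
    ← integrableOn_Ioi_comp_rpow_iff' g two_ne_zero]
  refine integrableOn_congr_fun (fun r _ => ?_) measurableSet_Ioi
  norm_num [finrank_euclideanSpace]

/-- The radial integral formula applied to the indicator of the set where `P` fails. -/
lemma ae_norm_sq_iff {P : ℝ → Prop} :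
    (∀ᵐ x : Plane, P (‖x‖ ^ 2)) ↔ ∀ᵐ s : ℝ, s ∈ Ioi 0 → P s := by
  classical
  set g : ℝ → ℝ := fun s => if P s then 0 else 1 with hg
  have hg0 : ∀ s, g s = 0 ↔ P s := fun s => by by_cases h : P s <;> simp [hg, h]
  have hnn : ∀ s, 0 ≤ g s := fun s => by by_cases h : P s <;> simp [hg, h]
  have h1 : (∀ᵐ x : Plane, P (‖x‖ ^ 2)) ↔ (fun x : Plane => g (‖x‖ ^ 2)) =ᵐ[volume] 0 :=
    eventually_congr (Eventually.of_forall fun x => (hg0 _).symm)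
  have h2 : (∀ᵐ s : ℝ, s ∈ Ioi 0 → P s) ↔ g =ᵐ[volume.restrict (Ioi 0)] 0 := by
    rw [← ae_restrict_iff' measurableSet_Ioi]
    exact eventually_congr (Eventually.of_forall fun x => (hg0 _).symm)
  rw [h1, h2]
  have hI := integral_norm_sq g
  have hi := integrable_norm_sq_iff (g := g)
  constructor
  · intro h
    have hint : Integrable (fun x : Plane => g (‖x‖ ^ 2)) := (integrable_zero _ _ _).congr h.symm
    have h0 : ∫ s in Ioi (0 : ℝ), g s = 0 := by
      rw [integral_congr_ae h] at hI
      simpa [Real.pi_ne_zero] using hI.symm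
    exact (integral_eq_zero_iff_of_nonneg hnn (hi.1 hint)).1 h0
  · intro h
    have hint : IntegrableOn g (Ioi 0) := (integrable_zero _ _ _).congr h.symm
    have h0 : ∫ s in Ioi (0 : ℝ), g s = 0 := by
      rw [integral_congr_ae h]; simp
    rw [h0, smul_zero] at hI
    exact (integral_eq_zero_iff_of_nonneg (fun x => hnn _) (hi.2 hint)).1 hI

lemma locallyIntegrableOn_of_norm_sq {g : ℝ → F}
    (h : LocallyIntegrable (fun x : Plane => g (‖x‖ ^ 2))) : LocallyIntegrableOn g (Ioi 0) := by
  have key : ∀ R > 0, IntegrableOn g (Ioc 0 R) := by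
    intro R hR
    have h1 := (h.integrableOn_isCompact (isCompact_closedBall (0 : Plane) √R))
    rw [← integrable_indicator_iff measurableSet_closedBall] at h1
    have h2 : (Metric.closedBall (0 : Plane) √R).indicator (fun x : Plane => g (‖x‖ ^ 2)) =
        fun x : Plane => (Iic R).indicator g (‖x‖ ^ 2) := by
      ext x
      have : x ∈ Metric.closedBall (0 : Plane) √R ↔ ‖x‖ ^ 2 ∈ Iic R := by
        rw [mem_closedBall_zero_iff, mem_Iic, Real.le_sqrt (norm_nonneg _) hR.le]
      by_cases hx : ‖x‖ ^ 2 ∈ Iic R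
      · rw [indicator_of_mem hx, indicator_of_mem (this.2 hx)]
      · rw [indicator_of_notMem hx, indicator_of_notMem fun h => hx (this.1 h)]
    rw [h2, integrable_norm_sq_iff, IntegrableOn, integrable_indicator_iff measurableSet_Iic,
      IntegrableOn, Measure.restrict_restrict measurableSet_Iic] at h1
    rwa [inter_comm, Ioi_inter_Iic] at h1
  intro s hs
  have hs : 0 < s := hs
  exact ⟨Ioc 0 (s + 1), mem_nhdsWithin_of_mem_nhds (Ioc_mem_nhds hs (lt_add_one s)),
    key _ (by linarith)⟩

end Radial

lemma continuousOn_green {lam : ℝ} (hlam : 0 < lam) : ContinuousOn (green lam) {0}ᶜ := by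
  have : green lam = fun x : Plane => greenProfile lam (‖x‖ ^ 2) :=
    funext fun x => green_eq_greenProfile lam x
  rw [this]
  refine (continuousOn_greenProfile hlam).comp (by fun_prop) fun x hx => ?_
  have : 0 < ‖x‖ := norm_pos_iff.2 hx
  exact pow_pos this 2

lemma memLp_green {lam : ℝ} (hlam : 0 < lam) : MemLp (green lam) 2 := by
  have hm : AEStronglyMeasurable (green lam) volume := by
    rw [← restrict_compl_singleton (μ := (volume : Measure Plane)) 0]
    exact (continuousOn_green hlam).aestronglyMeasurable (measurableSet_singleton _).compl
  rw [memLp_two_iff_integrable_sq hm]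
  have := integrable_norm_sq_iff.2 (integrableOn_greenProfile_sq hlam)
  simpa only [← green_eq_greenProfile] using this

/-! ### The form domain and radial test functions -/

section FormDomain

variable {lam α p : ℝ}

namespace HasH1Gradient

variable {f g : Plane → ℂ} {F G : Fin 2 → Plane → ℂ}

lemma integrable_test_mul {f : Plane → ℂ} (hf : MemLp f 2) {φ : Plane → ℝ} (hφ : Continuous φ)
    (hc : HasCompactSupport φ) : Integrable (fun x => (φ x : ℂ) * f x) := by
  have h1 : MemLp (fun x => (φ x : ℂ)) 2 :=
    (Complex.continuous_ofReal.comp hφ).memLp_of_hasCompactSupport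
      (hc.comp_left (g := fun r : ℝ => (r : ℂ)) Complex.ofReal_zero)
  exact h1.integrable_mul hf

lemma add (hf : HasH1Gradient f F) (hg : HasH1Gradient g G) :
    HasH1Gradient (fun x => f x + g x) (fun i x => F i x + G i x) where
  memLp := hf.memLp.add hg.memLp
  memLp_grad i := (hf.memLp_grad i).add (hg.memLp_grad i)
  integral_eq φ hφ hc i := by
    have hd : Continuous (fun x => fderiv ℝ φ x (EuclideanSpace.single i 1)) :=
      (hφ.continuous_fderiv (by simp)).clm_apply continuous_const
    have hdc : HasCompactSupport (fun x => fderiv ℝ φ x (EuclideanSpace.single i 1)) :=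
      (hc.fderiv ℝ).comp_left (g := fun L : Plane →L[ℝ] ℝ => L (EuclideanSpace.single i 1)) rfl
    simp only [mul_add]
    rw [integral_add (integrable_test_mul hf.memLp hd hdc)
      (integrable_test_mul hg.memLp hd hdc), integral_add
      (integrable_test_mul (hf.memLp_grad i) hφ.continuous hc)
      (integrable_test_mul (hg.memLp_grad i) hφ.continuous hc), hf.integral_eq φ hφ hc i,
      hg.integral_eq φ hφ hc i]
    ring

lemma of_contDiff {φ : Plane → ℝ} (hφ : ContDiff ℝ (⊤ : ℕ∞) φ) (hc : HasCompactSupport φ) :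
    HasH1Gradient (fun x => (φ x : ℂ))
      (fun i x => (fderiv ℝ φ x (EuclideanSpace.single i 1) : ℂ)) := by
  have hd : ∀ {φ : Plane → ℝ}, ContDiff ℝ (⊤ : ℕ∞) φ → ∀ i : Fin 2,
      Continuous (fun x => fderiv ℝ φ x (EuclideanSpace.single i 1)) := fun hφ i =>
    (hφ.continuous_fderiv (by simp)).clm_apply continuous_const
  have hdc : ∀ i : Fin 2,
      HasCompactSupport (fun x => fderiv ℝ φ x (EuclideanSpace.single i 1)) := fun i =>
    (hc.fderiv ℝ).comp_left (g := fun L : Plane →L[ℝ] ℝ => L (EuclideanSpace.single i 1)) rfl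
  have hmem : ∀ {φ : Plane → ℝ}, Continuous φ → HasCompactSupport φ →
      MemLp (fun x => (φ x : ℂ)) 2 := fun hφ hc =>
    (Complex.continuous_ofReal.comp hφ).memLp_of_hasCompactSupport
      (hc.comp_left (g := fun r : ℝ => (r : ℂ)) Complex.ofReal_zero)
  refine ⟨hmem hφ.continuous hc, fun i => hmem (hd hφ i) (hdc i), fun ψ hψ hψc i => ?_⟩
  simp only [← Complex.ofReal_mul]
  rw [integral_complex_ofReal, integral_complex_ofReal, ← Complex.ofReal_neg]
  congr 1
  have hψd : HasCompactSupport (fun x => fderiv ℝ ψ x (EuclideanSpace.single i 1)) :=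
    (hψc.fderiv ℝ).comp_left (g := fun L : Plane →L[ℝ] ℝ => L (EuclideanSpace.single i 1)) rfl
  have := integral_mul_fderiv_eq_neg_fderiv_mul_of_integrable (μ := (volume : Measure Plane))
    (f := ψ) (g := φ) (v := EuclideanSpace.single i 1)
    (((hd hψ i).mul hφ.continuous).integrable_of_hasCompactSupport hψd.mul_right)
    ((hψ.continuous.mul (hd hφ i)).integrable_of_hasCompactSupport hψc.mul_right)
    ((hψ.continuous.mul hφ.continuous).integrable_of_hasCompactSupport hψc.mul_right)
    (fun x _ => hψ.differentiable (by simp) x) (fun x _ => hφ.differentiable (by simp) x)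
  rw [this, neg_neg]

end HasH1Gradient

lemma HasFormDecomposition.add {v w f g : Plane → ℂ} {F G : Fin 2 → Plane → ℂ} {c d : ℂ}
    (hv : HasFormDecomposition lam v f F c) (hw : HasFormDecomposition lam w g G d) :
    HasFormDecomposition lam (fun x => v x + w x) (fun x => f x + g x)
      (fun i x => F i x + G i x) (c + d) where
  hasH1Gradient := hv.hasH1Gradient.add hw.hasH1Gradient
  ae_eq := by
    filter_upwards [hv.ae_eq, hw.ae_eq] with x h1 h2
    rw [h1, h2]; ring

lemma HasFormDecomposition.memLp (hlam : 0 < lam) {v f : Plane → ℂ} {F : Fin 2 → Plane → ℂ} {c : ℂ}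
    (hv : HasFormDecomposition lam v f F c) : MemLp v 2 := by
  refine MemLp.ae_eq hv.ae_eq.symm (hv.hasH1Gradient.memLp.add ?_)
  exact ((memLp_green hlam).ofReal (K := ℂ)).const_mul c

lemma memLp_star {f : Plane → ℂ} (hf : MemLp f 2) : MemLp (fun x => starRingEnd ℂ (f x)) 2 :=
  hf.star

lemma shiftedForm_add {f g h : Plane → ℂ} {F G H : Fin 2 → Plane → ℂ} {c d e : ℂ}
    (hf : HasH1Gradient f F) (hg : HasH1Gradient g G) (hh : HasH1Gradient h H) :
    shiftedForm α lam f F c (fun x => g x + h x) (fun i x => G i x + H i x) (d + e) =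
      shiftedForm α lam f F c g G d + shiftedForm α lam f F c h H e := by
  unfold shiftedForm
  simp only [map_add, mul_add]
  have h1 : ∫ x, (f x * starRingEnd ℂ (g x) + f x * starRingEnd ℂ (h x)) =
      (∫ x, f x * starRingEnd ℂ (g x)) + ∫ x, f x * starRingEnd ℂ (h x) :=
    integral_add (hf.memLp.integrable_mul (memLp_star hg.memLp))
      (hf.memLp.integrable_mul (memLp_star hh.memLp))
  have h2 : ∀ i, ∫ x, (F i x * starRingEnd ℂ (G i x) + F i x * starRingEnd ℂ (H i x)) =
      (∫ x, F i x * starRingEnd ℂ (G i x)) + ∫ x, F i x * starRingEnd ℂ (H i x) := fun i =>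
    integral_add ((hf.memLp_grad i).integrable_mul (memLp_star (hg.memLp_grad i)))
      ((hf.memLp_grad i).integrable_mul (memLp_star (hh.memLp_grad i)))
  simp only [h1, h2, Finset.sum_add_distrib]
  ring

/-- Hermitian symmetry, from real coefficients; it is the source of the pairing identity between two
solutions. -/
lemma shiftedForm_conj {f g : Plane → ℂ} {F G : Fin 2 → Plane → ℂ} {c d : ℂ} :
    starRingEnd ℂ (shiftedForm α lam f F c g G d) = shiftedForm α lam g G d f F c := by
  unfold shiftedForm
  simp only [map_add, map_mul, map_sum, ← integral_conj, Complex.conj_conj, Complex.conj_ofReal]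
  congr 2
  · exact Finset.sum_congr rfl fun i _ => integral_congr_ae (Eventually.of_forall fun x =>
      mul_comm _ _)
  · congr 1
    exact integral_congr_ae (Eventually.of_forall fun x => mul_comm _ _)
  · rw [mul_comm (starRingEnd ℂ c)]

/-- If the nonlinear pairing with one element of the form domain fails to be integrable, the form
vanishes on all elements for which it is integrable. -/
lemma integral_eq_zero_of_not_integrable {f : Plane → ℂ} {F : Fin 2 → Plane → ℂ} {c : ℂ}
    {h : Plane → ℂ} (hf : HasH1Gradient f F)
    (heq : ∀ (v g : Plane → ℂ) (G : Fin 2 → Plane → ℂ) (d : ℂ), HasFormDecomposition lam v g G d →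
      shiftedForm α lam f F c g G d = ∫ x, h x * starRingEnd ℂ (v x))
    {v w g k : Plane → ℂ} {G K : Fin 2 → Plane → ℂ} {d e : ℂ}
    (hv : HasFormDecomposition lam v g G d) (hw : HasFormDecomposition lam w k K e)
    (hni : ¬ Integrable (fun x => h x * starRingEnd ℂ (v x)))
    (hi : Integrable (fun x => h x * starRingEnd ℂ (w x))) :
    ∫ x, h x * starRingEnd ℂ (w x) = 0 := by
  have h1 := heq _ _ _ _ hv
  have h2 := heq _ _ _ _ hw
  have h3 := heq _ _ _ _ (hv.add hw)
  rw [shiftedForm_add hf hv.hasH1Gradient hw.hasH1Gradient, h1, h2, integral_undef hni] at h3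
  rw [zero_add] at h3
  rw [h3]
  -- The pairing with `v + w` cannot be integrable, so its integral has the default value `0`, as
  -- does the pairing with `v`; additivity of the form leaves `0` for `w`.
  refine integral_undef fun hcon => hni ?_
  refine (hcon.sub hi).congr (Eventually.of_forall fun x => ?_)
  simp only [Pi.sub_apply, map_add]
  ring

/-! ### Radial test functions -/

lemma hasFDerivAt_comp_norm_sq {θ : ℝ → ℝ} (hθ : Differentiable ℝ θ) (x v : Plane) :
    fderiv ℝ (fun x : Plane => θ (‖x‖ ^ 2)) x v = deriv θ (‖x‖ ^ 2) * (2 * inner ℝ x v) := by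
  have h1 : HasFDerivAt (fun x : Plane => ‖x‖ ^ 2) (2 • innerSL ℝ x) x :=
    (hasStrictFDerivAt_norm_sq x).hasFDerivAt
  have h2 := (hθ (‖x‖ ^ 2)).hasDerivAt.comp_hasFDerivAt x h1
  have h3 : fderiv ℝ (fun x : Plane => θ (‖x‖ ^ 2)) x = _ := h2.fderiv
  rw [h3]
  simp

lemma contDiff_comp_norm_sq {θ : ℝ → ℝ} (hθ : ContDiff ℝ (⊤ : ℕ∞) θ) :
    ContDiff ℝ (⊤ : ℕ∞) (fun x : Plane => θ (‖x‖ ^ 2)) :=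
  hθ.comp (contDiff_norm_sq ℝ)

lemma hasCompactSupport_comp_norm_sq {θ : ℝ → ℝ} (hc : HasCompactSupport θ) :
    HasCompactSupport (fun x : Plane => θ (‖x‖ ^ 2)) := by
  obtain ⟨R, hR⟩ := hc.isBounded.subset_closedBall 0
  refine HasCompactSupport.intro (isCompact_closedBall (0 : Plane) (|R| + 1)) fun x hx => ?_
  refine image_eq_zero_of_notMem_tsupport fun h => hx ?_
  have h1 := hR h
  rw [mem_closedBall_zero_iff, Real.norm_of_nonneg (by positivity)] at h1
  rw [mem_closedBall_zero_iff]
  nlinarith [le_abs_self R, abs_nonneg R, norm_nonneg x]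

/-- The Laplacian of `θ(|x|²)`, as a sum of iterated directional derivatives. -/
lemma sum_fderiv_fderiv_comp_norm_sq {θ : ℝ → ℝ} (hθ : ContDiff ℝ (⊤ : ℕ∞) θ) (x : Plane) :
    ∑ i : Fin 2, fderiv ℝ (fun y : Plane => fderiv ℝ (fun x : Plane => θ (‖x‖ ^ 2)) y
      (EuclideanSpace.single i 1)) x (EuclideanSpace.single i 1) =
      4 * deriv (fun t => t * deriv θ t) (‖x‖ ^ 2) := by
  have hθ' : ContDiff ℝ (⊤ : ℕ∞) (deriv θ) := (contDiff_infty_iff_deriv.1 hθ).2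
  have hd := hθ.differentiable (by simp)
  have hd' := hθ'.differentiable (by simp)
  have h1 : ∀ i : Fin 2, fderiv ℝ (fun y : Plane => fderiv ℝ (fun x : Plane => θ (‖x‖ ^ 2)) y
      (EuclideanSpace.single i 1)) x (EuclideanSpace.single i 1) =
      deriv (deriv θ) (‖x‖ ^ 2) * 4 * x i ^ 2 + 2 * deriv θ (‖x‖ ^ 2) := by
    intro i
    have e1 : (fun y : Plane => fderiv ℝ (fun x : Plane => θ (‖x‖ ^ 2)) y
        (EuclideanSpace.single i 1)) =
        fun y => (fun y : Plane => deriv θ (‖y‖ ^ 2)) y * (fun y : Plane => 2 * y i) y := by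
      ext y
      rw [hasFDerivAt_comp_norm_sq hd]
      simp [EuclideanSpace.inner_single_right]
    have e2 : DifferentiableAt ℝ (fun y : Plane => deriv θ (‖y‖ ^ 2)) x :=
      (contDiff_comp_norm_sq hθ').differentiable (by simp) x
    have e3 : HasFDerivAt (fun y : Plane => 2 * y i)
        ((2 : ℝ) • (EuclideanSpace.proj i : Plane →L[ℝ] ℝ)) x :=
      (EuclideanSpace.proj (𝕜 := ℝ) i : Plane →L[ℝ] ℝ).hasFDerivAt.const_smul (2 : ℝ)
    rw [e1, fderiv_fun_mul e2 e3.differentiableAt, e3.fderiv]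
    simp only [add_apply, smul_apply, smul_eq_mul]
    rw [hasFDerivAt_comp_norm_sq hd']
    simp [EuclideanSpace.inner_single_right]
    ring
  have h2 : deriv (fun t => t * deriv θ t) (‖x‖ ^ 2) =
      deriv θ (‖x‖ ^ 2) + ‖x‖ ^ 2 * deriv (deriv θ) (‖x‖ ^ 2) := by
    have := ((hasDerivAt_id (‖x‖ ^ 2)).mul (hd' (‖x‖ ^ 2)).hasDerivAt).deriv
    simp only [one_mul, id] at this
    exact this
  rw [h2]
  simp only [h1, Fin.sum_univ_two]
  generalize deriv (deriv θ) (‖x‖ ^ 2) = A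
  rw [EuclideanSpace.norm_sq_eq]
  simp only [Fin.sum_univ_two, Real.norm_eq_abs, sq_abs]
  ring

lemma hasFormDecomposition_test {θ : ℝ → ℝ} (hθ : ContDiff ℝ (⊤ : ℕ∞) θ)
    (hc : HasCompactSupport θ) :
    HasFormDecomposition lam (fun x => (θ (‖x‖ ^ 2) : ℂ)) (fun x => (θ (‖x‖ ^ 2) : ℂ))
      (fun i x => (fderiv ℝ (fun x : Plane => θ (‖x‖ ^ 2)) x (EuclideanSpace.single i 1) : ℂ)) 0 where
  hasH1Gradient := HasH1Gradient.of_contDiff (contDiff_comp_norm_sq hθ)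
    (hasCompactSupport_comp_norm_sq hc)
  ae_eq := Eventually.of_forall fun x => by simp

/-- The weak gradient is tested against the partial derivatives of the test function, so all
derivatives fall on it. The test function has zero charge, which removes the point interaction. -/
lemma shiftedForm_test {f : Plane → ℂ} {F : Fin 2 → Plane → ℂ} {c : ℂ} (hf : HasH1Gradient f F)
    {θ : ℝ → ℝ} (hθ : ContDiff ℝ (⊤ : ℕ∞) θ) (hc : HasCompactSupport θ) :
    shiftedForm α lam f F c (fun x => (θ (‖x‖ ^ 2) : ℂ))
      (fun i x => (fderiv ℝ (fun x : Plane => θ (‖x‖ ^ 2)) x (EuclideanSpace.single i 1) : ℂ)) 0 =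
      ∫ x, ((lam * θ (‖x‖ ^ 2) - 4 * deriv (fun t => t * deriv θ t) (‖x‖ ^ 2) : ℝ) : ℂ) * f x := by
  set g : Plane → ℝ := fun x => θ (‖x‖ ^ 2) with hg
  have hgd := contDiff_comp_norm_sq hθ
  have hgc := hasCompactSupport_comp_norm_sq hc
  set gd : Fin 2 → Plane → ℝ := fun i x => fderiv ℝ g x (EuclideanSpace.single i 1) with hgdd
  have hgi : ∀ i, ContDiff ℝ (⊤ : ℕ∞) (gd i) := fun i =>
    (hgd.fderiv_right (m := (⊤ : ℕ∞)) (by simp)).clm_apply contDiff_const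
  have hgic : ∀ i, HasCompactSupport (gd i) := fun i =>
    (hgc.fderiv ℝ).comp_left (g := fun L : Plane →L[ℝ] ℝ => L (EuclideanSpace.single i 1)) rfl
  have hgii : ∀ i, Integrable (fun x =>
      ((fderiv ℝ (gd i) x (EuclideanSpace.single i 1) : ℝ) : ℂ) * f x) := fun i => by
    refine HasH1Gradient.integrable_test_mul hf.memLp
      (((hgi i).continuous_fderiv (by simp)).clm_apply continuous_const) ?_
    exact ((hgic i).fderiv ℝ).comp_left
      (g := fun L : Plane →L[ℝ] ℝ => L (EuclideanSpace.single i 1)) rfl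
  have h1 : ∀ i, ∫ x, F i x * starRingEnd ℂ ((gd i x : ℝ) : ℂ) =
      -∫ x, ((fderiv ℝ (gd i) x (EuclideanSpace.single i 1) : ℝ) : ℂ) * f x := fun i => by
    rw [hf.integral_eq (gd i) (hgi i) (hgic i) i, neg_neg]
    simp only [Complex.conj_ofReal, mul_comm]
  have h2 : Integrable (fun x => (g x : ℂ) * f x) :=
    HasH1Gradient.integrable_test_mul hf.memLp hgd.continuous hgc
  unfold shiftedForm
  rw [map_zero, mul_zero, mul_zero, add_zero, Finset.sum_congr rfl fun i _ => h1 i,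
    Finset.sum_neg_distrib, ← integral_finsetSum _ fun i _ => hgii i]
  have h3 : ∀ x, ∑ i, ((fderiv ℝ (gd i) x (EuclideanSpace.single i 1) : ℝ) : ℂ) * f x =
      ((4 * deriv (fun t => t * deriv θ t) (‖x‖ ^ 2) : ℝ) : ℂ) * f x := fun x => by
    rw [← Finset.sum_mul, ← Complex.ofReal_sum, ← sum_fderiv_fderiv_comp_norm_sq hθ]
  have h4 : Integrable (fun x =>
      ((4 * deriv (fun t => t * deriv θ t) (‖x‖ ^ 2) : ℝ) : ℂ) * f x) := by
    refine (integrable_finsetSum Finset.univ fun i _ => hgii i).congr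
      (Eventually.of_forall fun x => ?_)
    exact h3 x
  simp only [h3]
  have h5 : ∫ x, f x * starRingEnd ℂ (g x : ℂ) = ∫ x, (g x : ℂ) * f x := by
    simp only [Complex.conj_ofReal, mul_comm]
  rw [h5, ← integral_const_mul, neg_add_eq_sub, ← integral_sub (h2.const_mul _) h4]
  refine integral_congr_ae (Eventually.of_forall fun x => ?_)
  simp only [hg]
  push_cast
  ring

/-- The Green profile is annihilated by the adjoint radial operator away from the origin. -/
lemma integral_greenProfile_test (hlam : 0 < lam) {θ : ℝ → ℝ} (hθ : IsTest θ) :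
    ∫ s, greenProfile lam s * (lam * θ s - 4 * deriv (fun t => t * deriv θ t) s) = 0 := by
  have byparts : ∀ W w η : ℝ → ℝ, (∀ s > 0, HasDerivAt W (w s) s) → ContinuousOn w (Ioi 0) →
      IsTest η → ∫ s, W s * deriv η s = -∫ s, w s * η s := by
    intro W w η hW hw hη
    have hWl : LocallyIntegrableOn W (Ioi 0) := ContinuousOn.locallyIntegrableOn
      (fun s hs => (hW s hs).continuousAt.continuousWithinAt) measurableSet_Ioi
    have hwl : LocallyIntegrableOn w (Ioi 0) := hw.locallyIntegrableOn measurableSet_Ioi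
    obtain ⟨a, b, ha, hab, h0⟩ := hη.exists_eq_zero
    have hd : ∀ s, HasDerivAt (fun s => W s * η s) (w s * η s + W s * deriv η s) s := by
      intro s
      rcases lt_or_ge s a with hs | hs
      · have h1 : ∀ t < a, η t = 0 := fun t ht => h0 t fun h => absurd h.1 (not_le.2 ht)
        have h2 : deriv η s = 0 := by
          have : η =ᶠ[𝓝 s] fun _ => 0 := by
            filter_upwards [Iio_mem_nhds hs] with t ht using h1 t ht
          rw [this.deriv_eq, deriv_const]
        rw [h1 s hs, h2, mul_zero, mul_zero, add_zero]
        refine (hasDerivAt_const s (0 : ℝ)).congr_of_eventuallyEq ?_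
        filter_upwards [Iio_mem_nhds hs] with t ht
        rw [h1 t ht, mul_zero]
      · exact (hW s (ha.trans_le hs)).mul (hη.hasDerivAt s)
    have := integral_eq_zero_of_hasDerivAt_of_integrable hd
      ((hη.integrable_mul hwl).add (hη.deriv.integrable_mul hWl)) (hη.integrable_mul hWl)
    rw [integral_add (hη.integrable_mul hwl) (hη.deriv.integrable_mul hWl)] at this
    linarith
  have hcf : ContinuousOn (greenFlux lam) (Ioi 0) :=
    fun s hs => (hasDerivAt_greenFlux hlam hs).continuousAt.continuousWithinAt
  have hcg := continuousOn_greenProfile hlam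
  have ht := hθ.deriv.contDiff_mul contDiff_id
  simp only [id] at ht
  have h1 := byparts (greenProfile lam) (fun s => greenFlux lam s / s) _
    (fun s hs => hasDerivAt_greenProfile hlam hs)
    (hcf.div continuousOn_id fun s hs => ne_of_gt hs) ht
  have h2 := byparts (greenFlux lam) (fun s => lam * greenProfile lam s / 4) θ
    (fun s hs => hasDerivAt_greenFlux hlam hs) ((hcg.const_smul lam).div_const 4) hθ
  have h3 : ∫ s, greenFlux lam s / s * (s * deriv θ s) = ∫ s, greenFlux lam s * deriv θ s := by
    refine integral_congr_ae ?_
    filter_upwards [compl_mem_ae_iff.2 (measure_singleton (0 : ℝ))] with s hs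
    have : s ≠ 0 := hs
    field_simp
  have hgl : LocallyIntegrableOn (greenProfile lam) (Ioi 0) :=
    hcg.locallyIntegrableOn measurableSet_Ioi
  have h4 : ∀ s, greenProfile lam s * (lam * θ s - 4 * deriv (fun t => t * deriv θ t) s) =
      lam * (greenProfile lam s * θ s)
        - 4 * (greenProfile lam s * deriv (fun t => t * deriv θ t) s) := fun s => by ring
  have h5 : ∀ s, lam * greenProfile lam s / 4 * θ s = lam / 4 * (greenProfile lam s * θ s) :=
    fun s => by ring
  simp only [h4]
  simp only [h5] at h2
  rw [integral_sub ((hθ.integrable_mul hgl).const_mul _) ((ht.deriv.integrable_mul hgl).const_mul _),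
    integral_const_mul, integral_const_mul, h1, h3, h2, integral_const_mul]
  ring

end FormDomain

/-! ### From weak solutions to profiles -/

section ProfileExistence

variable {lam α p : ℝ}

lemma exists_isTest_bump {s : ℝ} (hs : 0 < s) :
    ∃ χ, IsTest χ ∧ (∀ t, 0 ≤ χ t) ∧ ∀ t ∈ Ioo (s - s / 4) (s + s / 4), χ t = 1 := by
  let f : ContDiffBump s := ⟨s / 4, s / 2, by positivity, by linarith⟩
  refine ⟨f, IsTest.of_tsupport f.contDiff f.hasCompactSupport ?_, fun t => f.nonneg,
    fun t ht => f.one_of_mem_closedBall ?_⟩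
  · rw [f.tsupport_eq]
    intro x hx
    rw [Metric.mem_closedBall, Real.dist_eq, abs_le] at hx
    have : f.rOut = s / 2 := rfl
    rw [this] at hx
    exact mem_Ioi.2 (by linarith [hx.1])
  · have : f.rIn = s / 4 := rfl
    rw [Metric.mem_closedBall, Real.dist_eq, abs_le, this]
    constructor <;> linarith [ht.1, ht.2]

lemma IsTest.setIntegral_mul {θ : ℝ → ℝ} (hθ : IsTest θ) (k : ℝ → ℝ) :
    ∫ s in Ioi 0, k s * θ s = ∫ s, k s * θ s := by
  obtain ⟨a, b, ha, hab, h0⟩ := hθ.exists_eq_zero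
  refine setIntegral_eq_integral_of_forall_compl_eq_zero fun s hs => ?_
  rw [h0 s fun h => hs (ha.trans_le h.1), mul_zero]

lemma exists_radial_profile {u : Plane → ℂ} (hpos : IsPositive u) (hrad : IsRadial u) :
    ∃ U : ℝ → ℝ, (u =ᵐ[volume] fun x => (U (‖x‖ ^ 2) : ℂ)) ∧
      ∀ᵐ s : ℝ, s ∈ Ioi 0 → 0 < U s := by
  obtain ⟨φ, hφ⟩ := hrad
  have h1 : ∀ᵐ x : Plane, u x = ((φ √(‖x‖ ^ 2)).re : ℂ) ∧ 0 < (φ √(‖x‖ ^ 2)).re := by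
    filter_upwards [hpos, hφ] with x hx hx'
    rw [Real.sqrt_sq (norm_nonneg _), ← hx']
    exact ⟨Complex.ext (by simp) (by simp [hx.1]), hx.2⟩
  refine ⟨fun s => (φ √s).re, h1.mono fun x hx => hx.1, ?_⟩
  exact (ae_norm_sq_iff (P := fun s => 0 < (φ √s).re)).1 (h1.mono fun x hx => hx.2)

lemma integrable_ofReal_norm_sq_iff {g : ℝ → ℝ} :
    Integrable (fun x : Plane => (g (‖x‖ ^ 2) : ℂ)) ↔ IntegrableOn g (Ioi 0) := by
  rw [integrable_norm_sq_iff (g := fun s => (g s : ℂ))]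
  exact ⟨fun h => h.re, fun h => h.ofReal⟩

lemma integral_ofReal_norm_sq (g : ℝ → ℝ) :
    ∫ x : Plane, (g (‖x‖ ^ 2) : ℂ) = ((Real.pi * ∫ s in Ioi 0, g s : ℝ) : ℂ) := by
  rw [integral_complex_ofReal, integral_norm_sq g, smul_eq_mul]

lemma nonlinearity_ae_eq {u v : Plane → ℂ} {U V : ℝ → ℝ}
    (hU : u =ᵐ[volume] fun x => (U (‖x‖ ^ 2) : ℂ)) (hUpos : ∀ᵐ s : ℝ, s ∈ Ioi 0 → 0 < U s)
    (hV : v =ᵐ[volume] fun x => (V (‖x‖ ^ 2) : ℂ)) :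
    (fun x => ((‖u x‖ ^ (p - 1) : ℝ) : ℂ) * u x * starRingEnd ℂ (v x)) =ᵐ[volume]
      fun x => ((fun s => U s ^ p * V s) (‖x‖ ^ 2) : ℂ) := by
  filter_upwards [hU, (ae_norm_sq_iff (P := fun s => 0 < U s)).2 hUpos, hV] with x h1 h2 h3
  rw [h1, h3, Complex.conj_ofReal, Complex.norm_real, Real.norm_of_nonneg h2.le,
    ← Complex.ofReal_mul, ← Complex.ofReal_mul, ← Real.rpow_add_one h2.ne', sub_add_cancel]

/-- Away from the origin the Green function solves the homogeneous equation, so the regular part `f`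
can be replaced by `u` itself. -/
lemma shiftedForm_isTest (hlam : 0 < lam) {u f : Plane → ℂ} {F : Fin 2 → Plane → ℂ} {c : ℂ}
    (hdec : HasFormDecomposition lam u f F c) {U : ℝ → ℝ}
    (hU : u =ᵐ[volume] fun x => (U (‖x‖ ^ 2) : ℂ)) {θ : ℝ → ℝ} (hθ : IsTest θ) :
    shiftedForm α lam f F c (fun x => (θ (‖x‖ ^ 2) : ℂ))
      (fun i x => (fderiv ℝ (fun x : Plane => θ (‖x‖ ^ 2)) x (EuclideanSpace.single i 1) : ℂ)) 0 =
      ((Real.pi * ∫ s, U s * (lam * θ s - 4 * deriv (fun t => t * deriv θ t) s) : ℝ) : ℂ) := by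
  rw [shiftedForm_test hdec.hasH1Gradient hθ.contDiff hθ.hasCompactSupport]
  set τ : ℝ → ℝ := fun s => lam * θ s - 4 * deriv (fun t => t * deriv θ t) s with hτ
  have hτt : IsTest τ := (hθ.contDiff_mul contDiff_const).sub
    ((hθ.deriv.contDiff_mul contDiff_id).deriv.contDiff_mul contDiff_const)
  have hτc := (contDiff_comp_norm_sq hτt.contDiff).continuous
  have hτs := hasCompactSupport_comp_norm_sq hτt.hasCompactSupport
  have hi1 := HasH1Gradient.integrable_test_mul (hdec.memLp hlam) hτc hτs
  have hi2 : Integrable (fun x : Plane => (τ (‖x‖ ^ 2) : ℂ) * (green lam x : ℂ)) :=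
    HasH1Gradient.integrable_test_mul ((memLp_green hlam).ofReal (K := ℂ)) hτc hτs
  have h1 : (fun x : Plane => (τ (‖x‖ ^ 2) : ℂ) * f x) =ᵐ[volume] fun x =>
      (τ (‖x‖ ^ 2) : ℂ) * u x - c * ((τ (‖x‖ ^ 2) : ℂ) * (green lam x : ℂ)) := by
    filter_upwards [hdec.ae_eq] with x hx
    rw [hx]; ring
  have h2 : (fun x : Plane => (τ (‖x‖ ^ 2) : ℂ) * u x) =ᵐ[volume] fun x =>
      ((fun s => U s * τ s) (‖x‖ ^ 2) : ℂ) := by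
    filter_upwards [hU] with x hx
    rw [hx]; push_cast; ring
  have h3 : (fun x : Plane => (τ (‖x‖ ^ 2) : ℂ) * (green lam x : ℂ)) =ᵐ[volume] fun x =>
      ((fun s => greenProfile lam s * τ s) (‖x‖ ^ 2) : ℂ) :=
    Eventually.of_forall fun x => by
      simp only [green_eq_greenProfile]; push_cast; ring
  change ∫ x : Plane, (τ (‖x‖ ^ 2) : ℂ) * f x = _
  rw [integral_congr_ae h1, integral_sub hi1 (hi2.const_mul c), integral_const_mul,
    integral_congr_ae h2, integral_congr_ae h3,
    integral_ofReal_norm_sq (fun s => U s * τ s),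
    integral_ofReal_norm_sq (fun s => greenProfile lam s * τ s),
    hτt.setIntegral_mul, hτt.setIntegral_mul, integral_greenProfile_test hlam hθ]
  simp [hτ]

/-- A zero of a nonnegative solution is a minimum, so the flux vanishes there as well and the
singular system propagates the zero. This serves as the strong maximum principle. -/
lemma eq_zero_right_of_eq_zero {W D : ℝ → ℝ} (hp : 1 < p)
    (hW : ∀ s > 0, HasDerivAt W (D s / s) s)
    (hD : ∀ s > 0, HasDerivAt D ((lam * W s - W s ^ p) / 4) s) (hnn : ∀ s > 0, 0 ≤ W s)
    {R : ℝ} (hR : 0 < R) (hWR : W R = 0) : ∃ r > R, ∀ s ∈ Ioo R r, W s = 0 := by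
  have hDR : D R = 0 := by
    have hmin : IsLocalMin W R := by
      filter_upwards [Ioi_mem_nhds hR] with s hs
      rw [hWR]; exact hnn s hs
    have := hmin.hasDerivAt_eq_zero (hW R hR)
    exact (div_eq_zero_iff.1 this).resolve_right hR.ne'
  have hWc := (hW R hR).continuousAt
  have hlim : ∀ f : ℝ → ℝ, ContinuousAt f R → f R = 0 → Tendsto f (𝓝[>] R) (𝓝 0) :=
    fun f hf h0 => by
      have := hf.tendsto.mono_left (nhdsWithin_le_nhds (s := Ioi R))
      rwa [h0] at this
  have hW1 : ∀ᶠ s in 𝓝[>] R, W s < 1 :=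
    (hlim W hWc hWR).eventually (gt_mem_nhds one_pos)
  obtain ⟨b, hb, hb'⟩ := (mem_nhdsGT_iff_exists_Ioo_subset).1 hW1
  have hRb : R < min b (R + 1) := lt_min hb (lt_add_one R)
  have hpos : ∀ s ∈ Ioo R (min b (R + 1)), 0 < s := fun s hs => hR.trans hs.1
  refine exists_forall_eq_zero_of_singular_system (R := R) (b := min b (R + 1))
    (C := 1 + (|lam| + 1) * √(R + 1)) hR.le hRb (by positivity) (y := W) (q := D)
    (fun s hs => hW s (hpos s hs)) (fun s hs => hD s (hpos s hs)) ?_ ?_ (hlim W hWc hWR)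
    (hlim D (hD R hR).continuousAt hDR)
  · intro s hs
    have hs0 := hpos s hs
    rw [abs_div, abs_of_pos hs0]
    gcongr
    refine le_mul_of_one_le_left (abs_nonneg _) ?_
    have : 0 ≤ (|lam| + 1) * √(R + 1) := by positivity
    linarith
  · intro s hs
    have hs0 := hpos s hs
    have h1 : W s < 1 := hb' ⟨hs.1, hs.2.trans_le (min_le_left _ _)⟩
    have h0 := hnn s hs0
    have h2 : W s ^ p ≤ W s := by
      have := Real.rpow_le_rpow_of_exponent_ge' h0 h1.le zero_le_one hp.le
      rwa [Real.rpow_one] at this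
    have h3 : 0 ≤ W s ^ p := Real.rpow_nonneg h0 p
    have h4 := abs_sub (lam * W s) (W s ^ p)
    rw [abs_mul, abs_of_nonneg h0, abs_of_nonneg h3] at h4
    have h5 : √s ≤ √(R + 1) := Real.sqrt_le_sqrt (hs.2.le.trans (min_le_right _ _))
    have h6 := Real.sqrt_pos.2 hs0
    rw [abs_div, abs_of_pos (by norm_num : (0 : ℝ) < 4), abs_of_nonneg h0, le_div_iff₀ h6]
    have h7 : (|lam| + 1) * W s * √s ≤ (|lam| + 1) * W s * √(R + 1) := by gcongr
    have h8 : |lam * W s - W s ^ p| / 4 * √s ≤ (|lam| + 1) * W s * √s := by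
      refine mul_le_mul_of_nonneg_right ?_ h6.le
      have := abs_nonneg (lam * W s - W s ^ p)
      linarith
    calc _ ≤ (|lam| + 1) * W s * √(R + 1) := h8.trans h7
      _ ≤ (1 + (|lam| + 1) * √(R + 1)) * W s := by linarith

lemma nonneg_of_ae_pos {W : ℝ → ℝ} (hW : ContinuousOn W (Ioi 0))
    (hpos : ∀ᵐ s : ℝ, s ∈ Ioi 0 → 0 < W s) : ∀ s > 0, 0 ≤ W s := by
  intro s hs
  by_contra hneg
  have hev := ((hW.continuousAt (Ioi_mem_nhds hs)).eventually (gt_mem_nhds (not_le.1 hneg))).and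
    (Ioi_mem_nhds hs)
  have hfr : ∃ᶠ t in ae volume, W t < 0 ∧ t ∈ Ioi 0 :=
    frequently_ae_iff.2 fun h0 => (Measure.measure_pos_of_mem_nhds volume hev).ne' h0
  obtain ⟨t, ⟨ht1, ht2⟩, ht3⟩ := (hfr.and_eventually hpos).exists
  exact absurd (ht3 ht2) (not_lt.2 ht1.le)

/-- A positive radial solution is given by a positive profile, and its nonlinearity pairs
integrably with every element of the form domain. -/
theorem exists_isProfile (hp : 1 < p) (hlam : 0 < lam) {u f : Plane → ℂ}
    {F : Fin 2 → Plane → ℂ} {c : ℂ} (hdec : HasFormDecomposition lam u f F c)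
    (heq : ∀ (v g : Plane → ℂ) (G : Fin 2 → Plane → ℂ) (d : ℂ),
      HasFormDecomposition lam v g G d → shiftedForm α lam f F c g G d
        = ∫ x, ((‖u x‖ ^ (p - 1) : ℝ) : ℂ) * u x * starRingEnd ℂ (v x))
    (hpos : IsPositive u) (hrad : IsRadial u) :
    ∃ W D : ℝ → ℝ, IsProfile p lam W D ∧ (u =ᵐ[volume] fun x => (W (‖x‖ ^ 2) : ℂ)) ∧
      ∀ (v g : Plane → ℂ) (G : Fin 2 → Plane → ℂ) (d : ℂ), HasFormDecomposition lam v g G d →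
        Integrable (fun x => ((‖u x‖ ^ (p - 1) : ℝ) : ℂ) * u x * starRingEnd ℂ (v x)) := by
  obtain ⟨U, hU, hUpos⟩ := exists_radial_profile hpos hrad
  have hu2 := hdec.memLp hlam
  have hUloc : LocallyIntegrableOn U (Ioi 0) := by
    have h1 : LocallyIntegrable u := hu2.locallyIntegrable one_le_two
    have h2 : LocallyIntegrable (fun x : Plane => ((U (‖x‖ ^ 2) : ℝ) : ℂ)) := h1.congr hU
    have h3 := locallyIntegrableOn_of_norm_sq (g := fun s => (U s : ℂ)) h2
    intro s hs
    obtain ⟨t, ht, ht'⟩ := h3 s hs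
    exact ⟨t, ht, Integrable.re ht'⟩
  have hsq : IntegrableOn (fun s => U s ^ 2) (Ioi 0) := by
    rw [← integrable_norm_sq_iff]
    refine (hu2.integrable_norm_pow (by norm_num)).congr ?_
    filter_upwards [hU] with x hx
    rw [hx, Complex.norm_real, Real.norm_eq_abs]
    simp
  have hnonlin : ∀ θ : ℝ → ℝ, (fun x => ((‖u x‖ ^ (p - 1) : ℝ) : ℂ) * u x *
      starRingEnd ℂ (θ (‖x‖ ^ 2) : ℂ)) =ᵐ[volume]
      fun x => ((fun s => U s ^ p * θ s) (‖x‖ ^ 2) : ℂ) := fun θ =>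
    nonlinearity_ae_eq (v := fun x => (θ (‖x‖ ^ 2) : ℂ)) hU hUpos EventuallyEq.rfl
  have hintiff : ∀ θ : ℝ → ℝ, Integrable (fun x => ((‖u x‖ ^ (p - 1) : ℝ) : ℂ) * u x *
      starRingEnd ℂ (θ (‖x‖ ^ 2) : ℂ)) ↔ IntegrableOn (fun s => U s ^ p * θ s) (Ioi 0) := fun θ => by
    rw [integrable_congr (hnonlin θ)]
    exact integrable_ofReal_norm_sq_iff (g := fun s => U s ^ p * θ s)
  have hinteq : ∀ θ : ℝ → ℝ, ∫ x, ((‖u x‖ ^ (p - 1) : ℝ) : ℂ) * u x *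
      starRingEnd ℂ (θ (‖x‖ ^ 2) : ℂ) =
      ((Real.pi * ∫ s in Ioi 0, U s ^ p * θ s : ℝ) : ℂ) := fun θ =>
    (integral_congr_ae (hnonlin θ)).trans (integral_ofReal_norm_sq (fun s => U s ^ p * θ s))
  have hweak : ∀ θ, IsTest θ →
      ∫ s, U s * (4 * deriv (fun t => t * deriv θ t) s) =
        (∫ s, lam * U s * θ s) - ∫ s in Ioi 0, U s ^ p * θ s := by
    intro θ hθ
    have h1 := heq _ _ _ _ (hasFormDecomposition_test (lam := lam) hθ.contDiff hθ.hasCompactSupport)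
    rw [shiftedForm_isTest hlam hdec hU hθ, hinteq θ] at h1
    have h2 := mul_left_cancel₀ Real.pi_ne_zero (Complex.ofReal_injective h1)
    have h3 : IsTest (fun s => 4 * deriv (fun t => t * deriv θ t) s) :=
      (hθ.deriv.contDiff_mul contDiff_id).deriv.contDiff_mul contDiff_const
    have h4 : ∀ s, U s * (lam * θ s - 4 * deriv (fun t => t * deriv θ t) s) =
        lam * (U s * θ s) - U s * (4 * deriv (fun t => t * deriv θ t) s) := fun s => by ring
    simp only [h4] at h2
    rw [integral_sub ((hθ.integrable_mul hUloc).const_mul _) (h3.integrable_mul hUloc)] at h2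
    simp only [mul_assoc]
    linarith
  have hlamU : LocallyIntegrableOn (fun s => lam * U s) (Ioi 0) := hUloc.smul lam
  -- Local integrability of `U ^ p` is not yet known; a continuous representative provides it.
  have hcont : ∃ W : ℝ → ℝ, ContinuousOn W (Ioi 0) ∧ ∀ᵐ s, s ∈ Ioi (0 : ℝ) → U s = W s := by
    suffices ∃ k : ℝ → ℝ, LocallyIntegrableOn k (Ioi 0) ∧ ∀ θ, IsTest θ →
        ∫ s, U s * (4 * deriv (fun t => t * deriv θ t) s) = ∫ s, k s * θ s by
      obtain ⟨k, hk, hkθ⟩ := this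
      obtain ⟨W, D, hUW, hW, -⟩ := exists_flux_of_weak hUloc hk hkθ
      exact ⟨W, fun s hs => (hW s hs).continuousAt.continuousWithinAt, hUW⟩
    by_cases hall : ∀ θ, IsTest θ → IntegrableOn (fun s => U s ^ p * θ s) (Ioi 0)
    · have hUp : LocallyIntegrableOn (fun s => U s ^ p) (Ioi 0) := by
        intro s hs
        have hs : 0 < s := hs
        obtain ⟨χ, hχ, -, hχ1⟩ := exists_isTest_bump hs
        refine ⟨Ioo (s - s / 4) (s + s / 4), mem_nhdsWithin_of_mem_nhds
          (Ioo_mem_nhds (by linarith) (by linarith)), ?_⟩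
        refine IntegrableOn.congr_fun ((hall χ hχ).mono_set fun t ht => ?_) (fun t ht => ?_)
          measurableSet_Ioo
        · exact mem_Ioi.2 (by linarith [ht.1])
        · simp only [hχ1 t ht, mul_one]
      refine ⟨fun s => lam * U s - U s ^ p, hlamU.sub hUp, fun θ hθ => ?_⟩
      rw [hweak θ hθ, hθ.setIntegral_mul, ← integral_sub (hθ.integrable_mul hlamU)
        (hθ.integrable_mul hUp)]
      simp only [sub_mul]
    -- One non-integrable pairing makes the nonlinear term vanish on every test function, by
    -- additivity or by the default value, so `U` solves the linear equation weakly. That is enough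
    -- for continuity.
    · push Not at hall
      obtain ⟨θ₀, hθ₀, hni⟩ := hall
      refine ⟨fun s => lam * U s, hlamU, fun θ hθ => ?_⟩
      rw [hweak θ hθ]
      suffices ∫ s in Ioi 0, U s ^ p * θ s = 0 by rw [this, sub_zero]
      by_cases hi : IntegrableOn (fun s => U s ^ p * θ s) (Ioi 0)
      · have := integral_eq_zero_of_not_integrable hdec.hasH1Gradient heq
          (hasFormDecomposition_test hθ₀.contDiff hθ₀.hasCompactSupport)
          (hasFormDecomposition_test hθ.contDiff hθ.hasCompactSupport)
          (fun h => hni ((hintiff θ₀).1 h)) ((hintiff θ).2 hi)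
        rw [hinteq θ, Complex.ofReal_eq_zero] at this
        exact (mul_eq_zero.1 this).resolve_left Real.pi_ne_zero
      · exact integral_undef hi
  obtain ⟨W₀, hW₀c, hUW₀⟩ := hcont
  have hW₀pos : ∀ᵐ s : ℝ, s ∈ Ioi 0 → 0 < W₀ s := by
    filter_upwards [hUpos, hUW₀] with s h1 h2 hs
    rw [← h2 hs]; exact h1 hs
  have hW₀nn := nonneg_of_ae_pos hW₀c hW₀pos
  have hUploc : LocallyIntegrableOn (fun s => U s ^ p) (Ioi 0) := by
    have h1 : ContinuousOn (fun s => W₀ s ^ p) (Ioi 0) :=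
      hW₀c.rpow_const fun s _ => Or.inr (by linarith)
    intro s hs
    obtain ⟨t, ht, ht'⟩ := h1.locallyIntegrableOn (μ := volume) measurableSet_Ioi s hs
    refine ⟨t ∩ Ioi 0, inter_mem ht self_mem_nhdsWithin, ?_⟩
    refine (ht'.mono_set inter_subset_left).congr_fun_ae ?_
    filter_upwards [ae_restrict_of_ae hUW₀, ae_restrict_of_ae_restrict_of_subset inter_subset_right
      (ae_restrict_mem (measurableSet_Ioi (a := (0 : ℝ))))] with x h2 h3
    rw [h2 h3]
  -- A non-integrable pairing would force `∫ U ^ p χ = 0` for a bump `χ`, although the integrand is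
  -- nonnegative and positive almost everywhere near `1`.
  have hint : ∀ (v g : Plane → ℂ) (G : Fin 2 → Plane → ℂ) (d : ℂ),
      HasFormDecomposition lam v g G d →
        Integrable (fun x => ((‖u x‖ ^ (p - 1) : ℝ) : ℂ) * u x * starRingEnd ℂ (v x)) := by
    intro v g G d hv
    by_contra hni
    obtain ⟨χ, hχ, hχ0, hχ1⟩ := exists_isTest_bump one_pos
    have hi : IntegrableOn (fun s => U s ^ p * χ s) (Ioi 0) :=
      (hχ.integrable_mul hUploc).integrableOn
    have h1 := integral_eq_zero_of_not_integrable hdec.hasH1Gradient heq hv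
      (hasFormDecomposition_test hχ.contDiff hχ.hasCompactSupport) hni ((hintiff χ).2 hi)
    rw [hinteq χ, Complex.ofReal_eq_zero] at h1
    have h2 := (mul_eq_zero.1 h1).resolve_left Real.pi_ne_zero
    rw [integral_eq_zero_iff_of_nonneg_ae] at h2
    · rw [EventuallyEq, ae_restrict_iff' measurableSet_Ioi] at h2
      have hfr : ∃ᶠ t in ae (volume : Measure ℝ), t ∈ Ioo ((1 : ℝ) - 1 / 4) (1 + 1 / 4) := by
        rw [frequently_ae_iff]
        simp only [ofPred_mem_eq, Real.volume_Ioo]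
        norm_num
      obtain ⟨t, ht, ht1, ht2⟩ := (hfr.and_eventually (h2.and hUpos)).exists
      have ht0 : t ∈ Ioi (0 : ℝ) := mem_Ioi.2 (by linarith [ht.1])
      have h3 := ht1 ht0
      rw [hχ1 t ht, mul_one] at h3
      have h4 := Real.rpow_pos_of_pos (ht2 ht0) p
      exact absurd h3 h4.ne'
    · rw [EventuallyLE, ae_restrict_iff' measurableSet_Ioi]
      filter_upwards [hUpos] with t ht ht0
      have := ht ht0
      have := hχ0 t
      simp only [Pi.zero_apply]
      positivity
    · exact hi
  obtain ⟨W, D, hUW, hW, B, hD⟩ := exists_flux_of_weak hUloc (hlamU.sub hUploc) (by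
    intro θ hθ
    rw [hweak θ hθ, hθ.setIntegral_mul, ← integral_sub (hθ.integrable_mul hlamU)
      (hθ.integrable_mul hUploc)]
    simp only [Pi.sub_apply, sub_mul])
  have hWc : ContinuousOn W (Ioi 0) :=
    fun s hs => (hW s hs).continuousAt.continuousWithinAt
  have hWpos : ∀ᵐ s : ℝ, s ∈ Ioi 0 → 0 < W s := by
    filter_upwards [hUpos, hUW] with s h1 h2 hs
    rw [← h2 hs]; exact h1 hs
  have hWnn := nonneg_of_ae_pos hWc hWpos
  have hkc : ContinuousOn (fun s => lam * W s - W s ^ p) (Ioi 0) :=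
    (hWc.const_smul lam).sub (hWc.rpow_const fun s _ => Or.inr (by linarith))
  have hDd : ∀ s > 0, HasDerivAt D ((lam * W s - W s ^ p) / 4) s := by
    intro s hs
    have h1 : HasDerivAt (fun s => ∫ t in (1 : ℝ)..s, (lam * W t - W t ^ p))
        (lam * W s - W s ^ p) s := by
      refine intervalIntegral.integral_hasDerivAt_right ?_ ?_ (hkc.continuousAt (Ioi_mem_nhds hs))
      · exact (hkc.mono fun x hx => (lt_min one_pos hs).trans_le hx.1).intervalIntegrable
      · exact hkc.stronglyMeasurableAtFilter isOpen_Ioi s hs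
    refine ((h1.sub_const B).div_const 4).congr_of_eventuallyEq ?_
    filter_upwards [Ioi_mem_nhds hs] with r hr
    rw [hD r hr]
    congr 2
    refine intervalIntegral.integral_congr_ae ?_
    filter_upwards [hUW] with t ht ht'
    have ht0 : t ∈ Ioi (0 : ℝ) := (lt_min one_pos hr).trans ht'.1
    simp only [Pi.sub_apply, ht ht0]
  -- A zero would spread to an interval, against positivity almost everywhere.
  have hWlt : ∀ s > 0, 0 < W s := by
    intro s hs
    refine lt_of_le_of_ne (hWnn s hs) fun h0 => ?_
    obtain ⟨r, hr, hr'⟩ := eq_zero_right_of_eq_zero hp hW hDd hWnn hs h0.symm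
    have hfr : ∃ᶠ t in ae (volume : Measure ℝ), t ∈ Ioo s r := by
      rw [frequently_ae_iff]
      simp only [ofPred_mem_eq, Real.volume_Ioo]
      simpa using hr
    obtain ⟨t, ht, ht1⟩ := (hfr.and_eventually hWpos).exists
    exact absurd (hr' t ht) (ht1 (hs.trans ht.1)).ne'
  have hcongr : ∀ q : ℝ → ℝ → ℝ, (fun s => q s (W s)) =ᵐ[volume.restrict (Ioi 0)]
      fun s => q s (U s) := fun q => by
    rw [EventuallyEq, ae_restrict_iff' measurableSet_Ioi]
    filter_upwards [hUW] with s h1 hs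
    rw [h1 hs]
  have huW : u =ᵐ[volume] fun x => (W (‖x‖ ^ 2) : ℂ) := by
    filter_upwards [hU, (ae_norm_sq_iff (P := fun s => U s = W s)).2 hUW] with x h1 h2
    rw [h1, h2]
  refine ⟨W, D, ⟨hWlt, hW, hDd, ?_, ?_⟩, huW, hint⟩
  · exact hsq.congr (hcongr fun _ w => w ^ 2).symm
  -- A cutoff equal to `1` near the origin lies in the form domain; its integrable pairing controls
  -- `U ^ p` up to the singularity, which `IsTest` functions do not see.
  · let f : ContDiffBump (0 : ℝ) := ⟨1, 2, one_pos, one_lt_two⟩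
    have h1 := hint _ _ _ _ (hasFormDecomposition_test f.contDiff f.hasCompactSupport)
    rw [hintiff] at h1
    have h2 : IntegrableOn (fun s => W s ^ p * f s) (Ioi 0) :=
      Integrable.congr h1 (hcongr fun s w => w ^ p * f s).symm
    refine (h2.mono_set Ioc_subset_Ioi_self).congr_fun (fun s hs => ?_) measurableSet_Ioc
    have : f s = 1 := f.one_of_mem_closedBall (by
      have : f.rIn = 1 := rfl
      rw [mem_closedBall_zero_iff, Real.norm_of_nonneg hs.1.le, this]
      exact hs.2)
    simp only [this, mul_one]

end ProfileExistence

end PointInteraction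

end

/-! ### Proof of the uniqueness theorem. -/

open PointInteraction

theorem mainTheorem1 (p α lam : ℝ) (hp : 1 < p)
    (hlam : |PointInteraction.eigenvalue α| < lam)
    (u v : PointInteraction.Plane → ℂ)
    (hu : PointInteraction.IsSolution p α lam u)
    (hu_pos : PointInteraction.IsPositive u)
    (hu_rad : PointInteraction.IsRadial u)
    (hv : PointInteraction.IsSolution p α lam v)
    (hv_pos : PointInteraction.IsPositive v)
    (hv_rad : PointInteraction.IsRadial v) :
    u =ᵐ[MeasureTheory.volume] v := by
  have hlam0 : 0 < lam := (abs_nonneg _).trans_lt hlam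
  obtain ⟨f, F, c, hudec, hueq⟩ := hu
  obtain ⟨g, G, d, hvdec, hveq⟩ := hv
  obtain ⟨U, D, hU, huU, huint⟩ := exists_isProfile hp hlam0 hudec hueq hu_pos hu_rad
  obtain ⟨V, E, hV, hvV, hvint⟩ := exists_isProfile hp hlam0 hvdec hveq hv_pos hv_rad
  have hUpos : ∀ᵐ s : ℝ, s ∈ Set.Ioi 0 → 0 < U s := Filter.Eventually.of_forall hU.pos
  have hVpos : ∀ᵐ s : ℝ, s ∈ Set.Ioi 0 → 0 < V s := Filter.Eventually.of_forall hV.pos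
  have hUV := nonlinearity_ae_eq (p := p) huU hUpos hvV
  have hVU := nonlinearity_ae_eq (p := p) hvV hVpos huU
  have hi := integrable_ofReal_norm_sq_iff (g := fun s => U s ^ p * V s) |>.1
    ((huint _ _ _ _ hvdec).congr hUV)
  have hi' := integrable_ofReal_norm_sq_iff (g := fun s => V s ^ p * U s) |>.1
    ((hvint _ _ _ _ hudec).congr hVU)
  -- Each solution is tested with the other; Hermitian symmetry then equates the two real integrals.
  have h1 := hueq _ _ _ _ hvdec
  have h2 := hveq _ _ _ _ hudec
  rw [integral_congr_ae hUV, integral_ofReal_norm_sq (fun s => U s ^ p * V s)] at h1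
  rw [integral_congr_ae hVU, integral_ofReal_norm_sq (fun s => V s ^ p * U s),
    ← shiftedForm_conj, h1, Complex.conj_ofReal] at h2
  have h3 := mul_left_cancel₀ Real.pi_ne_zero (Complex.ofReal_injective h2)
  simp only [mul_comm (U _ ^ p), mul_comm (V _ ^ p)] at h3 hi hi'
  have h4 := hU.eq_of_integral_eq hV hp hlam0 hi hi' h3
  have h5 := (ae_norm_sq_iff (P := fun s => U s = V s)).2 (Filter.Eventually.of_forall h4)
  filter_upwards [huU, hvV, h5] with x hx hx' hx''
  rw [hx, hx', hx'']
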